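/- **Theorem 4.1.** Let $\mu$ be a partition, viewed as a finite subset of $\mathbb{Z}_{\ge 0}^2$ (a Young diagram), and let $i_1,\dots,i_k\ge 0$ be integers ($k\ge 0$). Let $M_3=\mathbb{C}[x_3,x_3^{-1}]\otimes \mathbb{C}[x_1,x_2]/\mu[x_1,x_2]$, where $\mu[x_1,x_2]$ is the ideal spanned by the monomials $x_1^ix_2^j$ with $(i,j)\notin\mu$. The torus $(\mathbb{C}^*)^3$ acts by $t\cdot x_i=t_ix_i$. Let $Q_U$ run over the finitely generated (equivalently, finite-dimensional) torus-invariant $\mathbb{C}[x_1,x_2,x_3]$-submodules of $M_3/\langle 1\rangle$, let $\ell(Q_U)$ be the length of $Q_U$, and put $$\mathsf F_\mu=\sum_{(i,j)\in\mu}t_1^it_2^j,\qquad \mathsf F_U=\frac{\mathsf F_\mu}{1-t_3}+\mathrm{char}(Q_U),$$ $$\mathsf G_\mu=-\mathsf F_\mu-\frac{\overline{\mathsf F}_\mu}{t_1t_2}+\mathsf F_\mu\overline{\mathsf F}_\mu\frac{(1-t_1)(1-t_2)}{t_1t_2},$$ $$\mathsf V_U=\mathsf F_U-\frac{\overline{\mathsf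 F}_U}{t_1t_2t_3}+\mathsf F_U\overline{\mathsf F}_U\frac{(1-t_1)(1-t_2)(1-t_3)}{t_1t_2t_3}+\frac{\mathsf G_\mu}{1-t_3},$$ where the bar denotes $t_i\mapsto t_i^{-1}$. Both $\mathsf V_U$ and $\mathsf F_U(1-t_1)(1-t_2)(1-t_3)$ are Laurent polynomials in $t_1,t_2,t_3$, and the trivial weight does not occur in $\mathsf V_U$. For a Laurent polynomial $f=\sum_w c_wt^w$ with integer coefficients, write $w\cdot s=w_1s_1+w_2s_2+w_3s_3$ and set $e(f)=\prod_w(w\cdot s)^{c_w}$ and $\mathrm{ch}_n(f)=\sum_w c_w (w\cdot s)^n/n!$. The 1-leg descendent vertex is the Laurent series $$\mathsf W^{\mathsf{Vert}}_\mu\Big(\prod_{j=1}^k\tau_{i_j}([0])\Big)=\Big(\frac1{s_1s_2}\Big)^k\sum_{Q_U}e(-\mathsf V_U)\prod_{j=1}^k\mathrm{ch}_{2+i_j}\big(\mathsf F_U(1-t_1)(1-t_2)(1-t_3)\big)\,q^{\ell(Q_U)+|\mu|}\ \in\ \mathbb{Q}(s_1,s_2,s_3)((q)),$$ in which each power of $q$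 receives finitely many terms. Then for every integer $a>0$ the evaluation $$\mathsf W^{\mathsf{Vert}}_\mu\Big(\prod_{j=1}^k\tau_{i_j}([0])\Big)\Big|_{s_3=\frac1a(s_1+s_2)}$$ is well-defined (each coefficient of a power of $q$ is a quotient of polynomials in $s_1,s_2,s_3$ whose denominator does not vanish identically at $s_3=\frac1a(s_1+s_2)$) and is a Laurent polynomial in $q$ with coefficients in $\mathbb{Q}(s_1,s_2)$. -/

import Mathlib

noncomputable section

namespace OneLeg

/-! ### The module `M₃` and the torus-invariant submodules `Q_U` -/

/-- The coordinate ring `ℂ[x₁, x₂, x₃]` of the affine chart `U`. -/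
abbrev CoordRing := MvPolynomial (Fin 3) ℂ

/-- Exponents `(i, j, k)` of the monomials `x₁ⁱ x₂ʲ x₃ᵏ` of `ℂ[x₁, x₂, x₃, x₃⁻¹]`. -/
abbrev Expo := ℕ × ℕ × ℤ

/-- The localized ring `ℂ[x₁, x₂, x₃, x₃⁻¹]`, as a monoid algebra. -/
abbrev LocRing := AddMonoidAlgebra ℂ Expo

/-- The monomial `x₁ⁱ x₂ʲ x₃ᵏ`. -/
def mono (e : Expo) : LocRing := AddMonoidAlgebra.single e 1

/-- `ℂ[x₁, x₂, x₃] → ℂ[x₁, x₂, x₃, x₃⁻¹]`, sending each variable to itself. -/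
instance instAlgebraLocRing : Algebra CoordRing LocRing :=
  (MvPolynomial.aeval (R := ℂ)
    ![mono (1, 0, 0), mono (0, 1, 0), mono (0, 0, 1)]).toRingHom.toAlgebra

instance instTowerLocRing : IsScalarTower ℂ CoordRing LocRing :=
  IsScalarTower.of_algebraMap_eq fun c =>
    ((MvPolynomial.aeval (R := ℂ)
      ![mono (1, 0, 0), mono (0, 1, 0), mono (0, 0, 1)]).commutes c).symm

/-- The extension of the monomial ideal `μ[x₁, x₂]` to `ℂ[x₁, x₂, x₃, x₃⁻¹]`: it is generated by
the monomials whose `(x₁, x₂)`-exponent is not a box of `μ`. -/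
def legIdeal (μ : YoungDiagram) : Ideal LocRing :=
  Ideal.span (AddMonoidAlgebra.of' ℂ Expo '' {e | (e.1, e.2.1) ∉ μ})

/-- `M₃ = ℂ[x₃, x₃⁻¹] ⊗ ℂ[x₁, x₂] / μ[x₁, x₂]`, a `ℂ[x₁, x₂, x₃]`-module. -/
abbrev M₃ (μ : YoungDiagram) := LocRing ⧸ legIdeal μ

/-- The quotient `M₃ / ⟨1⟩` by the `ℂ[x₁, x₂, x₃]`-submodule generated by `1`. -/
abbrev M₃Quot (μ : YoungDiagram) :=
  M₃ μ ⧸ Submodule.span CoordRing {(1 : M₃ μ)}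

/-- The class in `M₃ / ⟨1⟩` of an element of `ℂ[x₁, x₂, x₃, x₃⁻¹]`. -/
def cls (μ : YoungDiagram) : LocRing →ₗ[CoordRing] M₃Quot μ :=
  (Submodule.span CoordRing {(1 : M₃ μ)}).mkQ ∘ₗ
    (Ideal.Quotient.mkₐ CoordRing (legIdeal μ)).toLinearMap

/-- The character `t ↦ t₁ⁱ t₂ʲ t₃ᵏ` of the torus `(ℂ*)³`. -/
def torusChar (t : Fin 3 → ℂˣ) (e : Expo) : ℂˣ := t 0 ^ e.1 * t 1 ^ e.2.1 * t 2 ^ e.2.2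

/-- The action of the torus `(ℂ*)³` on `ℂ[x₁, x₂, x₃, x₃⁻¹]` by algebra automorphisms,
`t · xᵢ = tᵢ xᵢ`. -/
def torusAct (t : Fin 3 → ℂˣ) : LocRing →ₐ[ℂ] LocRing :=
  AddMonoidAlgebra.lift ℂ LocRing Expo
    { toFun := fun e => AddMonoidAlgebra.single e.toAdd (torusChar t e.toAdd : ℂ)
      map_one' := by simp [torusChar, AddMonoidAlgebra.one_def]
      map_mul' := fun a b => by
        simp only [toAdd_mul, AddMonoidAlgebra.single_mul_single]
        congr 1
        simp only [torusChar, Prod.fst_add, Prod.snd_add, pow_add, zpow_add, Units.val_mul]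
        ring }

/-- A torus-fixed datum `Q_U`: a finitely generated (equivalently, finite dimensional)
torus-invariant `ℂ[x₁, x₂, x₃]`-submodule of `M₃ / ⟨1⟩`. The torus acts on `M₃ / ⟨1⟩` through
representatives in `ℂ[x₁, x₂, x₃, x₃⁻¹]`. -/
@[ext]
structure FixedPair (μ : YoungDiagram) where
  /-- the submodule -/
  Q : Submodule CoordRing (M₃Quot μ)
  finiteDimensional : FiniteDimensional ℂ Q
  invariant : ∀ (t : Fin 3 → ℂˣ) (f : LocRing), cls μ f ∈ Q → cls μ (torusAct t f) ∈ Q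

/-- The length `ℓ(Q_U)`. As the residue field is `ℂ`, it is the dimension over `ℂ`. -/
def FixedPair.length {μ : YoungDiagram} (P : FixedPair μ) : ℕ := Module.finrank ℂ P.Q

/-- The multiplicity in `Q_U` of the weight `t₁ⁱ t₂ʲ t₃ᵏ`: the corresponding weight space of
`M₃ / ⟨1⟩` is spanned by the class of `x₁ⁱ x₂ʲ x₃ᵏ`. -/
def FixedPair.mult {μ : YoungDiagram} (P : FixedPair μ) (e : Expo) : ℕ :=
  Module.finrank ℂ
    (P.Q.restrictScalars ℂ ⊓ Submodule.span ℂ {cls μ (mono e)} : Submodule ℂ (M₃Quot μ))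

theorem coeff_algebraMap (r : CoordRing) (e : Expo)
    (he : (algebraMap CoordRing LocRing r).coeff e ≠ 0) : 0 ≤ e.2.2 := by
  induction r using MvPolynomial.induction_on generalizing e with
  | C c =>
    have h : algebraMap CoordRing LocRing (MvPolynomial.C c) = AddMonoidAlgebra.single 0 c := by
      have := (IsScalarTower.algebraMap_apply ℂ CoordRing LocRing c).symm
      rw [MvPolynomial.algebraMap_eq] at this
      rw [this]
      simp
    rw [h, AddMonoidAlgebra.coeff_single, Finsupp.single_apply] at he
    split_ifs at he with h0
    · subst h0; exact le_rfl
    · simp at he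
  | add p q hp hq =>
    rw [map_add, AddMonoidAlgebra.coeff_add, Finsupp.add_apply] at he
    by_cases h : (algebraMap CoordRing LocRing p).coeff e = 0
    · exact hq e (by simpa [h] using he)
    · exact hp e h
  | mul_X p n hp =>
    have hX : algebraMap CoordRing LocRing (MvPolynomial.X n)
        = (![mono (1, 0, 0), mono (0, 1, 0), mono (0, 0, 1)] : Fin 3 → LocRing) n :=
      MvPolynomial.aeval_X _ n
    have key : ∀ d : Expo, 0 ≤ d.2.2 →
        (algebraMap CoordRing LocRing p * mono d).coeff e ≠ 0 → 0 ≤ e.2.2 := by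
      intro d hd h
      have := AddMonoidAlgebra.support_coeff_mul_subset (algebraMap CoordRing LocRing p) (mono d)
        (Finsupp.mem_support_iff.mpr h)
      obtain ⟨u, hu, v, hv, huv⟩ := Finset.mem_add.mp this
      have hv' : v = d := by
        have := Finsupp.support_single_subset hv
        simpa using this
      have h1 := hp u (Finsupp.mem_support_iff.mp hu)
      rw [← huv, hv']
      simp only [Prod.snd_add]
      omega
    rw [map_mul, hX] at he
    fin_cases n
    · exact key _ (by simp) he
    · exact key _ (by simp) he
    · exact key _ (by simp) he

/-- The boxes: exponents of the monomials that are nonzero in `M₃ / ⟨1⟩`. -/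
def boxes (μ : YoungDiagram) : Set Expo := {e | (e.1, e.2.1) ∈ μ ∧ e.2.2 < 0}

theorem smul_one_eq (μ : YoungDiagram) (r : CoordRing) :
    r • (1 : M₃ μ) = Ideal.Quotient.mk (legIdeal μ) (algebraMap CoordRing LocRing r) := by
  have h : r • (1 : M₃ μ) = Ideal.Quotient.mk (legIdeal μ) (r • (1 : LocRing)) := rfl
  rw [h, Algebra.smul_def, mul_one]

theorem cls_eq_zero {μ : YoungDiagram} {f : LocRing} (hf : cls μ f = 0) {e : Expo}
    (he : e ∈ boxes μ) : f.coeff e = 0 := by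
  by_contra hne
  have h1 : (Ideal.Quotient.mk (legIdeal μ) f) ∈ Submodule.span CoordRing {(1 : M₃ μ)} := by
    simpa [cls] using hf
  obtain ⟨r, hr⟩ := Submodule.mem_span_singleton.mp h1
  have h2 : Ideal.Quotient.mk (legIdeal μ) (algebraMap CoordRing LocRing r)
      = Ideal.Quotient.mk (legIdeal μ) f := by
    rw [← hr, smul_one_eq]
  rw [Ideal.Quotient.eq] at h2
  have h3 := AddMonoidAlgebra.mem_ideal_span_of'_image.mp h2 e
  have h4 : (algebraMap CoordRing LocRing r).coeff e = 0 := by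
    by_contra h
    have := coeff_algebraMap r e h
    exact absurd he.2 (by omega)
  have h5 : e ∈ (algebraMap CoordRing LocRing r - f).coeff.support := by
    rw [Finsupp.mem_support_iff, AddMonoidAlgebra.coeff_sub, Finsupp.sub_apply, h4]
    simpa using hne
  obtain ⟨m, hm, d, hd⟩ := h3 h5
  refine hm ?_
  refine μ.isLowerSet (a := (e.1, e.2.1)) ?_ he.1
  rw [hd]
  exact ⟨by simp, by simp⟩

theorem cls_mono_eq_zero {μ : YoungDiagram} {e : Expo} (he : e ∉ boxes μ) :
    cls μ (mono e) = 0 := by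
  by_cases h : (e.1, e.2.1) ∈ μ
  · have hk : 0 ≤ e.2.2 := by
      by_contra hk
      exact he ⟨h, by omega⟩
    have h1 : mono e = algebraMap CoordRing LocRing
        (MvPolynomial.X 0 ^ e.1 * MvPolynomial.X 1 ^ e.2.1 * MvPolynomial.X 2 ^ e.2.2.toNat) := by
      have hX : ∀ n, algebraMap CoordRing LocRing (MvPolynomial.X n)
          = (![mono (1, 0, 0), mono (0, 1, 0), mono (0, 0, 1)] : Fin 3 → LocRing) n :=
        fun n => MvPolynomial.aeval_X _ n
      simp only [map_mul, map_pow, hX]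
      simp [mono, AddMonoidAlgebra.single_pow, AddMonoidAlgebra.single_mul_single, hk]
    have h2 : cls μ (mono e) = (Submodule.span CoordRing {(1 : M₃ μ)}).mkQ
        (Ideal.Quotient.mk (legIdeal μ) (mono e)) := rfl
    rw [h2, Submodule.mkQ_apply, Submodule.Quotient.mk_eq_zero, Submodule.mem_span_singleton]
    refine ⟨MvPolynomial.X 0 ^ e.1 * MvPolynomial.X 1 ^ e.2.1 * MvPolynomial.X 2 ^ e.2.2.toNat, ?_⟩
    rw [smul_one_eq, h1]
  · have h1 : Ideal.Quotient.mk (legIdeal μ) (mono e) = 0 :=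
      Ideal.Quotient.eq_zero_iff_mem.mpr (Ideal.subset_span ⟨e, h, rfl⟩)
    have h2 : cls μ (mono e) = (Submodule.span CoordRing {(1 : M₃ μ)}).mkQ
        (Ideal.Quotient.mk (legIdeal μ) (mono e)) := rfl
    rw [h2, h1, map_zero]

theorem cls_surjective (μ : YoungDiagram) : Function.Surjective (cls μ) := fun x => by
  obtain ⟨y, rfl⟩ := Submodule.mkQ_surjective _ x
  obtain ⟨z, rfl⟩ := Ideal.Quotient.mk_surjective y
  exact ⟨z, rfl⟩

theorem cls_smul {μ : YoungDiagram} (c : ℂ) (f : LocRing) : cls μ (c • f) = c • cls μ f :=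
  ((cls μ).restrictScalars ℂ).map_smul c f

theorem single_eq (e : Expo) (c : ℂ) : (AddMonoidAlgebra.single e c : LocRing) = c • mono e := by
  simp [mono]

theorem coeff_torusAct (t : Fin 3 → ℂˣ) (f : LocRing) (e : Expo) :
    (torusAct t f).coeff e = torusChar t e * f.coeff e := by
  induction f using AddMonoidAlgebra.induction_linear with
  | zero => simp
  | add x y hx hy => simp [hx, hy, mul_add]
  | single m r =>
    rw [torusAct, AddMonoidAlgebra.lift_single]
    by_cases h : m = e
    · subst h
      simp [mul_comm]
    · simp [h]

theorem exists_torusChar_ne {e d : Expo} (h : e ≠ d) :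
    ∃ t : Fin 3 → ℂˣ, (torusChar t e : ℂ) ≠ torusChar t d := by
  let u : ℂˣ := Units.mk0 2 two_ne_zero
  have hu : Function.Injective fun n : ℤ => (u : ℂ) ^ n := by
    intro a b hab
    have h2 : ((2 : ℝ) : ℂ) ^ a = ((2 : ℝ) : ℂ) ^ b := by simpa [u] using hab
    exact zpow_right_injective₀ (a := (2 : ℝ)) (by norm_num) (by norm_num) (by exact_mod_cast h2)
  by_cases h1 : e.1 = d.1
  · by_cases h2 : e.2.1 = d.2.1
    · have h3 : e.2.2 ≠ d.2.2 := fun h3 => h (Prod.ext h1 (Prod.ext h2 h3))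
      refine ⟨![1, 1, u], fun hh => h3 (hu ?_)⟩
      simpa [torusChar] using hh
    · refine ⟨![1, u, 1], fun hh => h2 ?_⟩
      have : (u : ℂ) ^ (e.2.1 : ℤ) = (u : ℂ) ^ (d.2.1 : ℤ) := by simpa [torusChar] using hh
      exact_mod_cast hu this
  · refine ⟨![u, 1, 1], fun hh => h1 ?_⟩
    have : (u : ℂ) ^ (e.1 : ℤ) = (u : ℂ) ^ (d.1 : ℤ) := by simpa [torusChar] using hh
    exact_mod_cast hu this

/-- A torus-invariant submodule contains the monomials of its elements. -/
theorem FixedPair.mono_mem {μ : YoungDiagram} (P : FixedPair μ) {f : LocRing} (hf : cls μ f ∈ P.Q)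
    {e : Expo} (he : f.coeff e ≠ 0) : cls μ (mono e) ∈ P.Q := by
  induction hn : f.coeff.support.card using Nat.strong_induction_on generalizing f with
  | _ n ih =>
    by_cases hall : ∀ d, f.coeff d ≠ 0 → d = e
    · have hfe : f = f.coeff e • mono e := by
        ext d
        by_cases hd : e = d
        · subst hd; simp [mono]
        · have : f.coeff d = 0 := by
            by_contra h
            exact hd (hall d h).symm
          simp [mono, this, hd]
      rw [hfe, cls_smul] at hf
      have := (P.Q.restrictScalars ℂ).smul_mem (f.coeff e)⁻¹ hf
      rwa [inv_smul_smul₀ he] at this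
    · push Not at hall
      obtain ⟨d, hd, hde⟩ := hall
      obtain ⟨t, ht⟩ := exists_torusChar_ne hde.symm
      have hg : cls μ (torusAct t f - (torusChar t d : ℂ) • f) ∈ P.Q := by
        rw [map_sub, cls_smul]
        exact P.Q.sub_mem (P.invariant t f hf) ((P.Q.restrictScalars ℂ).smul_mem _ hf)
      have hc : ∀ b, (torusAct t f - (torusChar t d : ℂ) • f).coeff b
          = ((torusChar t b : ℂ) - torusChar t d) * f.coeff b := by
        intro b
        rw [AddMonoidAlgebra.coeff_sub, Finsupp.sub_apply, coeff_torusAct]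
        simp [sub_mul]
      refine ih _ ?_ hg ?_ rfl
      · rw [← hn]
        refine Finset.card_lt_card (Finset.ssubset_iff_subset_ne.mpr ⟨fun b hb => ?_, fun hEq => ?_⟩)
        · rw [Finsupp.mem_support_iff, hc] at hb
          exact Finsupp.mem_support_iff.mpr (right_ne_zero_of_mul hb)
        · have : d ∈ f.coeff.support := Finsupp.mem_support_iff.mpr hd
          rw [← hEq, Finsupp.mem_support_iff, hc] at this
          simp at this
      · rw [hc]
        exact mul_ne_zero (sub_ne_zero.mpr ht) he

/-- The boxes of a torus-fixed datum. -/
def FixedPair.boxSet {μ : YoungDiagram} (P : FixedPair μ) : Set Expo :=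
  {e | e ∈ boxes μ ∧ cls μ (mono e) ∈ P.Q}

theorem sum_coeff (T : Finset Expo) (g : T → ℂ) (e : T) :
    (∑ x : T, g x • mono (x : Expo)).coeff (e : Expo) = g e := by
  rw [AddMonoidAlgebra.coeff_sum, Finsupp.finsetSum_apply, Finset.sum_eq_single e]
  · simp [mono]
  · intro b _ hb
    have : (b : Expo) ≠ e := fun h => hb (Subtype.ext h)
    simp [mono, this]
  · simp

theorem linearIndependent_cls {μ : YoungDiagram} (T : Finset Expo)
    (hT : ∀ e ∈ T, e ∈ boxes μ) : LinearIndependent ℂ fun e : T => cls μ (mono e) := by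
  rw [Fintype.linearIndependent_iff]
  intro g hg e
  have h1 : cls μ (∑ x : T, g x • mono (x : Expo)) = 0 := by
    rw [map_sum, ← hg]
    exact Finset.sum_congr rfl fun x _ => cls_smul _ _
  rw [← sum_coeff T g e]
  exact cls_eq_zero h1 (hT e e.2)

theorem FixedPair.card_le {μ : YoungDiagram} (P : FixedPair μ) (T : Finset Expo)
    (hT : ∀ e ∈ T, e ∈ P.boxSet) : T.card ≤ P.length := by
  have : FiniteDimensional ℂ (P.Q.restrictScalars ℂ) := P.finiteDimensional
  have hli := linearIndependent_cls (μ := μ) T fun e he => (hT e he).1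
  have h1 : Submodule.span ℂ (Set.range fun e : T => cls μ (mono e)) ≤ P.Q.restrictScalars ℂ := by
    rw [Submodule.span_le]
    rintro _ ⟨e, rfl⟩
    exact (hT e e.2).2
  have h2 := Submodule.finrank_mono h1
  rw [finrank_span_eq_card hli, Fintype.card_coe] at h2
  exact h2

theorem FixedPair.boxSet_finite {μ : YoungDiagram} (P : FixedPair μ) : P.boxSet.Finite := by
  by_contra h
  obtain ⟨T, hT, hc⟩ := Set.Infinite.exists_subset_card_eq h (P.length + 1)
  have := P.card_le T fun e he => hT he
  omega

/-- The character of `Q_U` is a finite sum. -/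
theorem FixedPair.mult_finite {μ : YoungDiagram} (P : FixedPair μ) :
    (Function.support P.mult).Finite := by
  refine P.boxSet_finite.subset fun e he => ?_
  have hne : (P.Q.restrictScalars ℂ ⊓ Submodule.span ℂ {cls μ (mono e)}) ≠ ⊥ := by
    intro h
    refine he ?_
    rw [FixedPair.mult, h, finrank_bot]
  obtain ⟨x, hx, hx0⟩ := Submodule.exists_mem_ne_zero_of_ne_bot hne
  obtain ⟨c, hc⟩ := Submodule.mem_span_singleton.mp hx.2
  have hc0 : c ≠ 0 := by rintro rfl; exact hx0 (by simpa using hc.symm)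
  have hm0 : cls μ (mono e) ≠ 0 := by rintro h; exact hx0 (by simpa [h] using hc.symm)
  refine ⟨by_contra fun h => hm0 (cls_mono_eq_zero h), ?_⟩
  have := (P.Q.restrictScalars ℂ).smul_mem c⁻¹ hx.1
  rwa [← hc, inv_smul_smul₀ hc0] at this

theorem FixedPair.boxSet_injective {μ : YoungDiagram} :
    Function.Injective (FixedPair.boxSet (μ := μ)) := by
  have key : ∀ P P' : FixedPair μ, P.boxSet = P'.boxSet → P.Q ≤ P'.Q := by
    intro P P' h x hx
    obtain ⟨f, rfl⟩ := cls_surjective μ x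
    rw [← f.sum_coeff_single, Finsupp.sum, map_sum]
    refine Submodule.sum_mem _ fun e he => ?_
    rw [single_eq, cls_smul]
    refine (P'.Q.restrictScalars ℂ).smul_mem _ ?_
    by_cases hb : e ∈ boxes μ
    · have : e ∈ P.boxSet := ⟨hb, P.mono_mem hx (Finsupp.mem_support_iff.mp he)⟩
      rw [h] at this
      exact this.2
    · rw [cls_mono_eq_zero hb]
      exact Submodule.zero_mem _
  intro P P' h
  exact FixedPair.ext (le_antisymm (key P P' h) (key P' P h.symm))

/-- Boxes are closed under multiplication by `x₃` as long as the product is nonzero. -/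
theorem FixedPair.boxSet_up {μ : YoungDiagram} (P : FixedPair μ) {i j : ℕ} {k : ℤ}
    (h : (i, j, k) ∈ P.boxSet) (m : ℕ) (hm : k + m < 0) : (i, j, k + m) ∈ P.boxSet := by
  refine ⟨⟨h.1.1, hm⟩, ?_⟩
  have h1 := P.Q.smul_mem (MvPolynomial.X 2 ^ m) h.2
  rw [← map_smul, Algebra.smul_def, map_pow] at h1
  have hX : algebraMap CoordRing LocRing (MvPolynomial.X 2) = mono (0, 0, 1) :=
    MvPolynomial.aeval_X _ _
  rw [hX] at h1
  have h2 : mono (0, 0, 1) ^ m * mono (i, j, k) = mono (i, j, k + m) := by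
    simp [mono, AddMonoidAlgebra.single_pow, AddMonoidAlgebra.single_mul_single, add_comm]
  rwa [h2] at h1

/-- There are finitely many torus-fixed data of a given length, so that the sum in each
coefficient of the descendent vertex is finite. -/
theorem FixedPair.finite_length (μ : YoungDiagram) (n : ℕ) :
    {P : FixedPair μ | P.length = n}.Finite := by
  let B : Set Expo := (fun x : (ℕ × ℕ) × ℤ => (x.1.1, x.1.2, x.2)) ''
    ((μ.cells : Set (ℕ × ℕ)) ×ˢ Set.Icc (-(n : ℤ)) 0)
  have hB : B.Finite := ((μ.cells.finite_toSet).prod (Set.finite_Icc _ _)).image _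
  refine Set.Finite.of_finite_image (f := FixedPair.boxSet) (hB.finite_subsets.subset ?_)
    FixedPair.boxSet_injective.injOn
  rintro _ ⟨P, hP, rfl⟩ ⟨i, j, k⟩ he
  refine ⟨((i, j), k), ⟨he.1.1, ?_, he.1.2.le⟩, rfl⟩
  by_contra hk
  have hk' : k < -(n : ℤ) := by simpa using hk
  have := P.card_le ((Finset.range (n + 1)).image fun m : ℕ => ((i, j, k + m) : Expo)) ?_
  · rw [Finset.card_image_of_injective, Finset.card_range, hP] at this
    · omega
    · intro a b hab
      simpa using hab
  · intro e hmem
    obtain ⟨m, hm, rfl⟩ := Finset.mem_image.mp hmem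
    have := Finset.mem_range.mp hm
    exact P.boxSet_up he m (by omega)

/-! ### Characters -/

/-- Laurent polynomials in `t₁, t₂, t₃` with integer coefficients. -/
abbrev Laurent := AddMonoidAlgebra ℤ (ℤ × ℤ × ℤ)

/-- Rational functions `ℚ(t₁, t₂, t₃)`. -/
abbrev RatChar := FractionRing Laurent

/-- The Laurent monomial `t₁ᵃ t₂ᵇ t₃ᶜ`. -/
def tmono (a b c : ℤ) : Laurent := AddMonoidAlgebra.single (a, b, c) 1

/-- The variable `t₁` as a rational function. -/
def t₁ : RatChar := algebraMap Laurent RatChar (tmono 1 0 0)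
/-- The variable `t₂` as a rational function. -/
def t₂ : RatChar := algebraMap Laurent RatChar (tmono 0 1 0)
/-- The variable `t₃` as a rational function. -/
def t₃ : RatChar := algebraMap Laurent RatChar (tmono 0 0 1)

/-- The bar operation `tᵢ ↦ tᵢ⁻¹` on Laurent polynomials. -/
def barLaurent : Laurent ≃+* Laurent :=
  (AddMonoidAlgebra.domCongr ℤ ℤ (AddEquiv.neg (ℤ × ℤ × ℤ))).toRingEquiv

/-- The bar operation `tᵢ ↦ tᵢ⁻¹` on rational functions. -/
def bar : RatChar ≃+* RatChar := IsFractionRing.ringEquivOfRingEquiv barLaurent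

/-- The character `∑_{(i,j) ∈ μ} t₁ⁱ t₂ʲ`, as a Laurent polynomial. -/
def legLaurent (μ : YoungDiagram) : Laurent := ∑ c ∈ μ.cells, tmono c.1 c.2 0

/-- The character of `Q_U`, as a Laurent polynomial. -/
def FixedPair.charLaurent {μ : YoungDiagram} (P : FixedPair μ) : Laurent :=
  ∑ᶠ e : Expo, P.mult e • tmono e.1 e.2.1 e.2.2

/-- `F_μ = ∑_{(i,j) ∈ μ} t₁ⁱ t₂ʲ`. -/
def legChar (μ : YoungDiagram) : RatChar := algebraMap Laurent RatChar (legLaurent μ)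

/-- `G_μ = - F_μ - F̄_μ / (t₁ t₂) + F_μ F̄_μ (1 - t₁)(1 - t₂) / (t₁ t₂)`. -/
def edgeChar (μ : YoungDiagram) : RatChar :=
  - legChar μ - bar (legChar μ) / (t₁ * t₂)
    + legChar μ * bar (legChar μ) * ((1 - t₁) * (1 - t₂)) / (t₁ * t₂)

/-- The torus character `F_U` of the sheaf of the stable pair, from the exact sequence
`0 → 𝒪_C → F_U → Q_U → 0`, where `C` is the cylinder over `μ` along the third axis: the character
of `𝒪_C` is `F_μ / (1 - t₃)`. -/
def FixedPair.sheafChar {μ : YoungDiagram} (P : FixedPair μ) : RatChar :=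
  legChar μ / (1 - t₃) + algebraMap Laurent RatChar P.charLaurent

/-- The character of the `U` summand of the virtual tangent space,
`F_U - F̄_U / (t₁ t₂ t₃) + F_U F̄_U (1 - t₁)(1 - t₂)(1 - t₃) / (t₁ t₂ t₃)`. -/
def FixedPair.tangentChar {μ : YoungDiagram} (P : FixedPair μ) : RatChar :=
  P.sheafChar - bar P.sheafChar / (t₁ * t₂ * t₃)
    + P.sheafChar * bar P.sheafChar * ((1 - t₁) * (1 - t₂) * (1 - t₃)) / (t₁ * t₂ * t₃)

/-- The vertex character `V_U`. -/
def FixedPair.vertexChar {μ : YoungDiagram} (P : FixedPair μ) : RatChar :=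
  P.tangentChar + edgeChar μ / (1 - t₃)

/-- The argument `F_U (1 - t₁)(1 - t₂)(1 - t₃)` of the Chern characters. -/
def FixedPair.descChar {μ : YoungDiagram} (P : FixedPair μ) : RatChar :=
  P.sheafChar * ((1 - t₁) * (1 - t₂) * (1 - t₃))

/-- The Laurent polynomial equal to a given rational function (and `0` if there is none). -/
def toLaurent (x : RatChar) : Laurent :=
  open Classical in
  if h : ∃ f : Laurent, algebraMap Laurent RatChar f = x then h.choose else 0

theorem bar_algebraMap (f : Laurent) :
    bar (algebraMap Laurent RatChar f) = algebraMap Laurent RatChar (barLaurent f) :=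
  IsFractionRing.ringEquivOfRingEquiv_algebraMap _ _

theorem barLaurent_tmono (a b c : ℤ) : barLaurent (tmono a b c) = tmono (-a) (-b) (-c) :=
  AddMonoidAlgebra.domCongr_single (R := ℤ) _ _ _

theorem tmono_mul (a b c a' b' c' : ℤ) :
    tmono a b c * tmono a' b' c' = tmono (a + a') (b + b') (c + c') := by
  simp [tmono, AddMonoidAlgebra.single_mul_single]

theorem tmono_zero : tmono 0 0 0 = 1 := rfl

theorem tmono_ne_zero (a b c : ℤ) :
    algebraMap Laurent RatChar (tmono a b c) ≠ 0 := by
  intro h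
  rw [map_eq_zero_iff _ (IsFractionRing.injective Laurent RatChar)] at h
  have h2 := congrArg (fun f : Laurent => f.coeff (a, b, c)) h
  simp [tmono] at h2

theorem one_sub_t₃_ne_zero : 1 - t₃ ≠ 0 := by
  intro h
  have h1 : algebraMap Laurent RatChar (1 - tmono 0 0 1) = 0 := by
    rw [map_sub, map_one]; exact h
  rw [map_eq_zero_iff _ (IsFractionRing.injective Laurent RatChar)] at h1
  have h2 := congrArg (fun f : Laurent => f.coeff (0, 0, 0)) h1
  simp [tmono, AddMonoidAlgebra.one_def, ← Prod.zero_eq_mk] at h2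

/-- The bar operation inverts the variables. -/
theorem bar_tmono (a b c : ℤ) : bar (algebraMap Laurent RatChar (tmono a b c))
    = (algebraMap Laurent RatChar (tmono a b c))⁻¹ := by
  rw [bar_algebraMap, barLaurent_tmono]
  refine eq_inv_of_mul_eq_one_left ?_
  rw [← map_mul, tmono_mul]
  simp [tmono_zero]

/-- The argument of the Chern characters is a Laurent polynomial. -/
theorem FixedPair.exists_descChar {μ : YoungDiagram} (P : FixedPair μ) :
    ∃ f : Laurent, algebraMap Laurent RatChar f = P.descChar := by
  refine ⟨(legLaurent μ + P.charLaurent * (1 - tmono 0 0 1))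
    * ((1 - tmono 1 0 0) * (1 - tmono 0 1 0)), ?_⟩
  have h3 := one_sub_t₃_ne_zero
  simp only [map_mul, map_add, map_sub, map_one]
  rw [FixedPair.descChar, FixedPair.sheafChar, legChar, ← t₁, ← t₂, ← t₃]
  field_simp

/-- The vertex character is a Laurent polynomial. -/
theorem FixedPair.exists_vertexChar {μ : YoungDiagram} (P : FixedPair μ) :
    ∃ f : Laurent, algebraMap Laurent RatChar f = P.vertexChar := by
  refine ⟨P.charLaurent - barLaurent P.charLaurent * tmono (-1) (-1) (-1)
    - (1 - tmono 1 0 0) * (1 - tmono 0 1 0) * tmono (-1) (-1) 0 *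
      (P.charLaurent * barLaurent (legLaurent μ)
        - tmono 0 0 (-1) * barLaurent P.charLaurent * legLaurent μ
        - (1 - tmono 0 0 1) * tmono 0 0 (-1) * P.charLaurent * barLaurent P.charLaurent), ?_⟩
  have h1 : t₁ ≠ 0 := tmono_ne_zero _ _ _
  have h2 : t₂ ≠ 0 := tmono_ne_zero _ _ _
  have h3 : t₃ ≠ 0 := tmono_ne_zero _ _ _
  have h4 := one_sub_t₃_ne_zero
  have hb : bar t₃ = t₃⁻¹ := bar_tmono _ _ _
  have e1 : algebraMap Laurent RatChar (tmono (-1) (-1) (-1)) = (t₁ * t₂ * t₃)⁻¹ := by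
    refine eq_inv_of_mul_eq_one_left ?_
    rw [t₁, t₂, t₃]
    simp only [← map_mul, tmono_mul]
    simp [tmono_zero]
  have e2 : algebraMap Laurent RatChar (tmono (-1) (-1) 0) = (t₁ * t₂)⁻¹ := by
    refine eq_inv_of_mul_eq_one_left ?_
    rw [t₁, t₂]
    simp only [← map_mul, tmono_mul]
    simp [tmono_zero]
  have e3 : algebraMap Laurent RatChar (tmono 0 0 (-1)) = t₃⁻¹ := by
    refine eq_inv_of_mul_eq_one_left ?_
    rw [t₃]
    simp only [← map_mul, tmono_mul]
    simp [tmono_zero]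
  have h5 : 1 - t₃⁻¹ ≠ 0 := by
    intro h
    apply h4
    field_simp at h
    linear_combination -h
  have hbar : bar P.sheafChar = -t₃ * algebraMap Laurent RatChar (barLaurent (legLaurent μ))
      / (1 - t₃) + algebraMap Laurent RatChar (barLaurent P.charLaurent) := by
    rw [FixedPair.sheafChar, map_add, map_div₀, map_sub, map_one, hb, bar_algebraMap, legChar,
      bar_algebraMap]
    congr 1
    have h6 : t₃ - 1 ≠ 0 := fun h => h4 (by linear_combination -h)
    rw [div_eq_div_iff h5 h4]
    field_simp
    ring
  simp only [map_mul, map_sub, map_one, e1, e2, e3]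
  rw [FixedPair.vertexChar, FixedPair.tangentChar, hbar, edgeChar, FixedPair.sheafChar, legChar,
    bar_algebraMap, ← t₁, ← t₂, ← t₃]
  generalize algebraMap Laurent RatChar (barLaurent (legLaurent μ)) = fb
  generalize algebraMap Laurent RatChar (legLaurent μ) = f
  generalize algebraMap Laurent RatChar (barLaurent P.charLaurent) = qb
  generalize algebraMap Laurent RatChar P.charLaurent = q
  field_simp
  ring

theorem algebraMap_toLaurent {x : RatChar} (h : ∃ f : Laurent, algebraMap Laurent RatChar f = x) :
    algebraMap Laurent RatChar (toLaurent x) = x := by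
  rw [toLaurent, dif_pos h]
  exact h.choose_spec

/-! ### Equivariant weights and the descendent vertex -/

/-- `ℚ(s₁, s₂, s₃)`. -/
abbrev Coeff₃ := FractionRing (MvPolynomial (Fin 3) ℚ)

/-- `ℚ(s₁, s₂)`. -/
abbrev Coeff₂ := FractionRing (MvPolynomial (Fin 2) ℚ)

/-- The equivariant parameters `s₁, s₂, s₃` (indexed from `0`) in `ℚ(s₁, s₂, s₃)`. -/
def s (i : Fin 3) : Coeff₃ := algebraMap (MvPolynomial (Fin 3) ℚ) Coeff₃ (MvPolynomial.X i)

/-- The first Chern class `a s₁ + b s₂ + c s₃` of the character `t₁ᵃ t₂ᵇ t₃ᶜ`. -/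
def weight (w : ℤ × ℤ × ℤ) : Coeff₃ := w.1 * s 0 + w.2.1 * s 1 + w.2.2 * s 2

/-- The equivariant Euler class of a virtual representation:
`e(∑ c_w t^w) = ∏ (w · s)^{c_w}`. -/
def euler (f : Laurent) : Coeff₃ := f.coeff.prod fun w c => weight w ^ c

/-- The degree `n` part of the equivariant Chern character:
`ch_n(∑ c_w t^w) = ∑ c_w (w · s)ⁿ / n!`. -/
def chern (n : ℕ) (f : Laurent) : Coeff₃ :=
  f.coeff.sum fun w c => (c : Coeff₃) * weight w ^ n / (n.factorial : Coeff₃)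

/-- The descendent weight `w_{i₁,…,i_k}(Q_U) = e(-V_U) ∏ⱼ ch_{2+iⱼ}(F_U (1-t₁)(1-t₂)(1-t₃))`. -/
def FixedPair.descWeight {μ : YoungDiagram} (P : FixedPair μ) {k : ℕ} (i : Fin k → ℕ) : Coeff₃ :=
  euler (-toLaurent P.vertexChar) * ∏ j, chern (2 + i j) (toLaurent P.descChar)

/-- The 1-leg descendent vertex
`W_μ(∏ⱼ τ_{iⱼ}([0])) = (1 / (s₁ s₂))ᵏ ∑_{Q_U} w_{i₁,…,i_k}(Q_U) q^{ℓ(Q_U) + |μ|}`,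
a Laurent series in `q` over `ℚ(s₁, s₂, s₃)`. -/
def vertex (μ : YoungDiagram) {k : ℕ} (i : Fin k → ℕ) : LaurentSeries Coeff₃ :=
  HahnSeries.ofSuppBddBelow
    (fun n : ℤ => (1 / (s 0 * s 1)) ^ k *
      ∑ᶠ (P : FixedPair μ) (_ : (P.length : ℤ) + μ.card = n), P.descWeight i)
    ⟨0, fun n hn => by
      by_contra hlt
      refine hn ?_
      have h : ∀ P : FixedPair μ, ¬ ((P.length : ℤ) + μ.card = n) := fun P h => by omega
      simp [h]⟩

/-! ### Evaluation at `s₃ = (s₁ + s₂) / a` -/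

/-- The substitution `s₃ = (s₁ + s₂) / a` on polynomials. -/
def evalPoly (a : ℕ) : MvPolynomial (Fin 3) ℚ →ₐ[ℚ] Coeff₂ :=
  MvPolynomial.aeval
    ![algebraMap (MvPolynomial (Fin 2) ℚ) Coeff₂ (MvPolynomial.X 0),
      algebraMap (MvPolynomial (Fin 2) ℚ) Coeff₂ (MvPolynomial.X 1),
      algebraMap (MvPolynomial (Fin 2) ℚ) Coeff₂ (MvPolynomial.X 0 + MvPolynomial.X 1) / a]

/-- The rational function `x ∈ ℚ(s₁, s₂, s₃)` has a well-defined evaluation at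
`s₃ = (s₁ + s₂) / a`, and the value is `y`: one can write `x = p / r` with polynomials `p` and `r`
such that `r` does not vanish identically at `s₃ = (s₁ + s₂) / a`, and `y` is the quotient of the
evaluations. -/
def EvaluatesTo (a : ℕ) (x : Coeff₃) (y : Coeff₂) : Prop :=
  ∃ p r : MvPolynomial (Fin 3) ℚ, evalPoly a r ≠ 0 ∧
    x = algebraMap (MvPolynomial (Fin 3) ℚ) Coeff₃ p / algebraMap (MvPolynomial (Fin 3) ℚ) Coeff₃ r ∧
    y = evalPoly a p / evalPoly a r

/-- The value of a well-defined evaluation is unique. -/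
theorem EvaluatesTo.unique {a : ℕ} {x : Coeff₃} {y y' : Coeff₂} (h : EvaluatesTo a x y)
    (h' : EvaluatesTo a x y') : y = y' := by
  obtain ⟨p, r, hr, hx, rfl⟩ := h
  obtain ⟨p', r', hr', hx', rfl⟩ := h'
  have h0 : ∀ u : MvPolynomial (Fin 3) ℚ, evalPoly a u ≠ 0 →
      algebraMap (MvPolynomial (Fin 3) ℚ) Coeff₃ u ≠ 0 := by
    intro u hu h
    rw [map_eq_zero_iff _ (IsFractionRing.injective (MvPolynomial (Fin 3) ℚ) Coeff₃)] at h
    exact hu (by rw [h, map_zero])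
  rw [hx, div_eq_div_iff (h0 r hr) (h0 r' hr'), ← map_mul, ← map_mul] at hx'
  have h1 := IsFractionRing.injective (MvPolynomial (Fin 3) ℚ) Coeff₃ hx'
  rw [div_eq_div_iff hr hr', ← map_mul, ← map_mul, h1]

end OneLeg

end

/-!
Put `ε = s₁ + s₂ - a s₃`. The weight of a single `Q_U` may have a pole along `ε = 0`; the poles
cancel only in the sum over all `Q_U` of a given length, by an antisymmetrization.

A torus-fixed `Q_U` is the same as a reverse plane partition `n` on the cells of `μ`
(`FixedPair.height`, `FixedPair.ofHeight`), and `-V_U` is the difference of the values at `n` and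
at `0` of an expression that is quadratic in `∑ t₁ⁱ t₂ʲ t₃^{-n(i,j)}`
(`FixedPair.vertexChar_eq`). Modulo `ε`, the weight of `t₁ᵅ t₂ᵝ t₃ᵞ` is
`(α - β) s₁ + (γ + a β) s₃`. So the factors of `e(-V_U)` that vanish or blow up at `ε = 0` are
multiples of `ε` by rational numbers, indexed by pairs of cells on equal or neighbouring diagonals
and governed by the order of the numbers `x(i,j) = a min(i,j) - n(i,j)`; the other factors are
units at `ε = 0`, and are power series in the products of `ε` with the positions of the cells on
their diagonals (`IsEpsPoly`).

Count the main diagonal twice, once for each side of the diagram, and call the resulting cells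
*labels* (`Lab`). The product of the singular factors of a filling `x` is then
`ε ^ d * N(pos) / D(pos)`, where `D` is a product of differences of positions within diagonals and
`N` is a polynomial of degree at most `d + deg D`; the quotients of linear factors occurring in `N`
are polynomial quotients, so that `N(pos)` makes sense for every integral filling `x`. It vanishes
unless `x` comes from a reverse plane partition, as soon as the two copies of the main diagonal
carry the same multiset of entries (`valid_of_numF_ne_zero`, `Valid.numF_div_denF`). So the sum over
reverse plane partitions is a sum over a set of fillings that is closed under the permutations of
the entries on each diagonal (`card_mul_sum_fillWeight`). For a fixed multiset of entries on each
diagonal this is an alternating sum of values of polynomials, and an alternating sum kills all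
monomials of degree less than the number of pairs of labels on the same diagonal
(`altSum_eq_zero`); what survives is divisible by `ε ^ (-d)` (`eps_zpow_mul_sum_mem`). Hence every
coefficient of the vertex is regular at `ε = 0`.

In the critical degree the alternating sum does not depend on the lower order terms of the
polynomial (`altSum_eq`). The numerator depends on two parameters `w` and `t`, equal to `0` and `1`
for the actual weights, that only affect the lower order terms. If the length is large, then the
entries `x` leave a gap of length `a`, and for `t = 0` and a suitable `w` the numerator vanishes at
all rearrangements of `x` (`exists_numF_eq_zero`). So the sum is divisible by one more power of `ε`,
and the evaluation of the coefficient is zero. This leaves finitely many nonzero coefficients.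
-/

noncomputable section

namespace OneLeg

open Finset

/-! ### Alternating sums over block permutations -/

section Alternating
variable {Λ : Type*} [Fintype Λ]

open Classical in
/-- The permutations of `Λ` preserving every fibre (block) of `b`. -/
def blockPerms (b : Λ → ℕ) : Finset (Equiv.Perm Λ) := univ.filter fun σ => ∀ r, b (σ r) = b r

theorem mem_blockPerms {b : Λ → ℕ} {σ : Equiv.Perm Λ} :
    σ ∈ blockPerms b ↔ ∀ r, b (σ r) = b r := by simp [blockPerms]

/-- The product of an antisymmetric function over all pairs changes by the sign of a permutation. -/
theorem prod_lt_comp_perm {R : Type*} [CommRing R] [DecidableEq Λ] [LinearOrder Λ]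
    (σ : Equiv.Perm Λ)
    (f : Λ → Λ → R) (hf : ∀ r r', f r r' = -f r' r) :
    ∏ r, ∏ r', (if r' < r then f (σ r) (σ r') else 1)
      = (Equiv.Perm.sign σ : ℤ) * ∏ r, ∏ r', (if r' < r then f r r' else 1) := by
  let φ : Fin (Fintype.card Λ) ≃o Λ := Fintype.orderIsoFinOfCardEq Λ rfl
  have h := Equiv.Perm.prod_Iio_comp_eq_sign_mul_prod (φ.toEquiv.symm.permCongr σ)
    (f := fun i j => f (φ j) (φ i)) (fun i j => hf _ _)
  rw [Equiv.Perm.sign_permCongr] at h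
  have key : ∀ g : Λ → Λ → R, ∏ r, ∏ r', (if r' < r then g r r' else 1)
      = ∏ j, ∏ i ∈ Finset.Iio j, g (φ j) (φ i) := by
    intro g
    rw [← Equiv.prod_comp φ.toEquiv]
    refine Finset.prod_congr rfl fun j _ => ?_
    rw [← Equiv.prod_comp φ.toEquiv, ← Finset.prod_filter]
    refine Finset.prod_congr ?_ fun i _ => rfl
    ext i
    simp
  rw [key fun r r' => f (σ r) (σ r'), key f]
  convert h using 4
  all_goals simp [Equiv.permCongr_apply]

/-- The product of the differences over the pairs in a common block changes by the sign of a block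
permutation. -/
theorem prod_block_sub_comp [DecidableEq Λ] [LinearOrder Λ] (b : Λ → ℕ) (p : Λ → ℚ)
    {σ : Equiv.Perm Λ} (hσ : σ ∈ blockPerms b) :
    ∏ r, ∏ r', (if b r = b r' ∧ r' < r then p (σ r) - p (σ r') else 1)
      = (Equiv.Perm.sign σ : ℤ) * ∏ r, ∏ r', (if b r = b r' ∧ r' < r then p r - p r' else 1) := by
  rw [mem_blockPerms] at hσ
  -- outside the blocks, the alternating function `b r - b r'` is insensitive to `σ`
  let f : Λ → Λ → ℚ := fun r r' => if b r = b r' then p r - p r' else (b r : ℚ) - b r'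
  have hf : ∀ r r', f r r' = -f r' r := by
    intro r r'
    by_cases h : b r = b r'
    · simp [f, h]
    · simp [f, h, Ne.symm h]
  have h := prod_lt_comp_perm σ f hf
  let u : ℚ := ∏ r, ∏ r', (if ¬ b r = b r' ∧ r' < r then (b r : ℚ) - b r' else 1)
  have hu : u ≠ 0 := by
    refine Finset.prod_ne_zero_iff.2 fun r _ => Finset.prod_ne_zero_iff.2 fun r' _ => ?_
    split_ifs with h
    · exact sub_ne_zero.2 (by exact_mod_cast h.1)
    · exact one_ne_zero
  have key : ∀ τ : Equiv.Perm Λ, (∀ r, b (τ r) = b r) →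
      ∏ r, ∏ r', (if r' < r then f (τ r) (τ r') else 1)
      = (∏ r, ∏ r', (if b r = b r' ∧ r' < r then p (τ r) - p (τ r') else 1)) * u := by
    intro τ hτ
    simp only [u, ← Finset.prod_mul_distrib]
    refine Finset.prod_congr rfl fun r _ => Finset.prod_congr rfl fun r' _ => ?_
    simp only [f, hτ]
    by_cases h1 : r' < r <;> by_cases h2 : b r = b r' <;> simp [h1, h2]
  rw [key σ hσ] at h
  have h1 := key 1 (fun r => rfl)
  simp only [Equiv.Perm.coe_one, id_eq] at h1
  rw [h1, ← mul_assoc] at h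
  exact mul_right_cancel₀ hu h

open Classical in
/-- The number of pairs in a common block that are in increasing order does not depend on the key
`k` that orders the blocks. -/
theorem two_mul_card_lt {b : Λ → ℕ} {κ : Type*} [LinearOrder κ] (k : Λ → κ)
    (hk : ∀ r r', b r = b r' → k r = k r' → r = r') :
    2 * (∑ r, ∑ r', if b r = b r' ∧ k r' < k r then 1 else 0)
      = ∑ r, ∑ r', if b r = b r' ∧ r ≠ r' then 1 else 0 := by
  have h1 : (∑ r, ∑ r', if b r = b r' ∧ k r' < k r then 1 else 0)
      = ∑ r, ∑ r', if b r = b r' ∧ k r < k r' then 1 else 0 := by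
    rw [Finset.sum_comm]
    refine Finset.sum_congr rfl fun r _ => Finset.sum_congr rfl fun r' _ => ?_
    simp [eq_comm]
  rw [two_mul]
  nth_rw 2 [h1]
  simp only [← Finset.sum_add_distrib]
  refine Finset.sum_congr rfl fun r _ => Finset.sum_congr rfl fun r' _ => ?_
  by_cases h : b r = b r'
  · rcases lt_trichotomy (k r) (k r') with h2 | h2 | h2
    · have : r ≠ r' := fun e => by simp [e] at h2
      simp [h, h2, h2.not_gt, this]
    · have := hk r r' h h2
      simp [this]
    · have : r ≠ r' := fun e => by simp [e] at h2
      simp [h, h2, h2.not_gt, this]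
  · simp [h]

/-- On every block, `p` is a bijection with an initial segment of `ℕ`. -/
structure IsPos (b p : Λ → ℕ) : Prop where
  inj : ∀ r r', b r = b r' → p r = p r' → r = r'
  down : ∀ r, ∀ k < p r, ∃ r', b r = b r' ∧ p r' = k

open Classical in
theorem IsPos.sum_eq {b p : Λ → ℕ} (h : IsPos b p) :
    ∑ r, p r = ∑ r, ∑ r', if b r = b r' ∧ p r' < p r then 1 else 0 := by
  refine Finset.sum_congr rfl fun r _ => ?_
  rw [← Finset.sum_filter, Finset.sum_const, smul_eq_mul, mul_one]
  rw [← Finset.card_range (p r)]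
  symm
  refine Finset.card_bij (fun r' _ => p r') (fun r' hr' => ?_) (fun r' hr' r'' hr'' e => ?_) ?_
  · simpa using (Finset.mem_filter.1 hr').2.2
  · simp only [mem_filter, mem_univ, true_and] at hr' hr''
    exact h.inj _ _ (hr'.1.symm.trans hr''.1) e
  · intro k hk
    obtain ⟨r', h1, h2⟩ := h.down r k (by simpa using hk)
    exact ⟨r', by simpa [h1, h2] using hk, h2⟩

open Classical in
theorem IsPos.sum_le {b p : Λ → ℕ} (h : IsPos b p) (m : Λ → ℕ)
    (hm : ∀ r r', b r = b r' → m r = m r' → r = r') : ∑ r, p r ≤ ∑ r, m r := by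
  have h1 := two_mul_card_lt (b := b) p h.inj
  have h2 := two_mul_card_lt (b := b) m hm
  have h3 : (∑ r, ∑ r', if b r = b r' ∧ m r' < m r then 1 else 0) ≤ ∑ r, m r := by
    refine Finset.sum_le_sum fun r _ => ?_
    rw [← Finset.sum_filter, Finset.sum_const, smul_eq_mul, mul_one]
    refine (Finset.card_le_card_of_injOn (t := Finset.range (m r)) m (fun r' hr' => by
      simpa using (Finset.mem_filter.1 hr').2.2) fun r' hr' r'' hr'' e => by
      simp only [coe_filter, mem_univ, true_and, Set.mem_ofPred_eq] at hr' hr''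
      exact hm _ _ (hr'.1.symm.trans hr''.1) e).trans_eq (Finset.card_range _)
  have h4 := h.sum_eq
  omega

/-- The alternating sum over the block permutations of the values of a polynomial at the permuted
positions, two further variables being kept fixed. -/
def altSum (b p : Λ → ℕ) (f : MvPolynomial (Λ ⊕ Bool) ℚ) (y : Bool → ℚ) : ℚ :=
  open Classical in
  ∑ σ ∈ blockPerms b, ((Equiv.Perm.sign σ : ℤ) : ℚ)
    * MvPolynomial.eval (Sum.elim (fun r => (p (σ r) : ℚ)) y) f

open Classical in
/-- The alternating sum of a monomial vanishes if two exponents in one block agree, because the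
transposition of the two labels preserves the monomial. -/
theorem altSum_prod_pow_eq_zero {b p m : Λ → ℕ} {r r' : Λ} (hne : r ≠ r') (hb : b r = b r')
    (hm : m r = m r') :
    ∑ σ ∈ blockPerms b, ((Equiv.Perm.sign σ : ℤ) : ℚ) * ∏ q, (p (σ q) : ℚ) ^ m q = 0 := by
  have hms : ∀ q, m (Equiv.swap r r' q) = m q := fun q => by
    by_cases h1 : q = r
    · subst h1; simp [hm]
    by_cases h2 : q = r'
    · subst h2; simp [hm]
    rw [Equiv.swap_apply_of_ne_of_ne h1 h2]
  have hbs : ∀ q, b (Equiv.swap r r' q) = b q := fun q => by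
    by_cases h1 : q = r
    · subst h1; simp [hb]
    by_cases h2 : q = r'
    · subst h2; simp [hb]
    rw [Equiv.swap_apply_of_ne_of_ne h1 h2]
  refine Finset.sum_involution (fun σ _ => σ * Equiv.swap r r') ?_ ?_ ?_ ?_
  · intro σ _
    rw [Equiv.Perm.sign_mul, Equiv.Perm.sign_swap hne]
    have : ∏ q, (p ((σ * Equiv.swap r r') q) : ℚ) ^ m q = ∏ q, (p (σ q) : ℚ) ^ m q := by
      rw [← Equiv.prod_comp (Equiv.swap r r') fun q => (p (σ q) : ℚ) ^ m q]
      refine Finset.prod_congr rfl fun q _ => ?_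
      rw [hms]; rfl
    rw [this]
    push_cast
    ring
  · intro σ _ _ e
    have : Equiv.swap r r' = 1 := by simpa using e
    rw [Equiv.swap_eq_one_iff] at this
    exact hne this
  · intro σ hσ
    rw [mem_blockPerms] at hσ ⊢
    intro q
    rw [Equiv.Perm.mul_apply, hσ, hbs]
  · intro σ _
    ext q
    simp

/-- `f` has total degree at most `n`, in the sense that it vanishes if `n < 0`. -/
def DegLE {τ R : Type*} [CommSemiring R] (f : MvPolynomial τ R) (n : ℤ) : Prop :=
  ∀ m ∈ f.support, (m.degree : ℤ) ≤ n

open Classical in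
theorem altSum_expand (b p : Λ → ℕ) (f : MvPolynomial (Λ ⊕ Bool) ℚ) (y : Bool → ℚ) :
    altSum b p f y = ∑ m ∈ f.support, f.coeff m *
      ((∏ c, y c ^ m (Sum.inr c)) * ∑ σ ∈ blockPerms b, ((Equiv.Perm.sign σ : ℤ) : ℚ)
        * ∏ q, (p (σ q) : ℚ) ^ m (Sum.inl q)) := by
  simp only [altSum, MvPolynomial.eval_eq', Finset.mul_sum]
  rw [Finset.sum_comm]
  refine Finset.sum_congr rfl fun m _ => Finset.sum_congr rfl fun σ _ => ?_
  rw [Fintype.prod_sum_type]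
  simp only [Sum.elim_inl, Sum.elim_inr]
  ring

open Classical in
/-- An alternating sum over the block permutations only sees the monomials whose exponents are
distinct in every block; these have degree at least the sum of the positions. -/
theorem altSum_eq {b p : Λ → ℕ} (h : IsPos b p) {f : MvPolynomial (Λ ⊕ Bool) ℚ}
    (hf : DegLE f (∑ r, p r : ℕ)) (y y' : Bool → ℚ) : altSum b p f y = altSum b p f y' := by
  rw [altSum_expand, altSum_expand]
  refine Finset.sum_congr rfl fun m hm => ?_
  by_cases hinj : ∀ r r', b r = b r' → m (Sum.inl r) = m (Sum.inl r') → r = r'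
  · have h1 := h.sum_le _ hinj
    have h2 := hf m hm
    rw [Finsupp.degree_eq_sum, Fintype.sum_sum_type] at h2
    have h3 : ∑ c, m (Sum.inr c) = 0 := by
      push_cast at h2
      zify at h1 ⊢
      have : (0 : ℤ) ≤ ∑ c : Bool, (m (Sum.inr c) : ℤ) := by positivity
      linarith
    have h4 : ∀ c, m (Sum.inr c) = 0 := fun c => by simpa using (Finset.sum_eq_zero_iff.1 h3) c
    simp [h4]
  · push Not at hinj
    obtain ⟨r, r', hb, hm, hne⟩ := hinj
    rw [altSum_prod_pow_eq_zero (m := fun q => m (Sum.inl q)) hne hb hm]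
    simp

open Classical in
/-- Alternating sums kill the polynomials of degree less than the sum of the positions. -/
theorem altSum_eq_zero {b p : Λ → ℕ} (h : IsPos b p) {f : MvPolynomial (Λ ⊕ Bool) ℚ} {n : ℤ}
    (hf : DegLE f n) (hn : n < (∑ r, p r : ℕ)) (y : Bool → ℚ) : altSum b p f y = 0 := by
  rw [altSum_expand]
  refine Finset.sum_eq_zero fun m hm => ?_
  by_cases hinj : ∀ r r', b r = b r' → m (Sum.inl r) = m (Sum.inl r') → r = r'
  · have h1 := h.sum_le _ hinj
    have h2 := hf m hm
    rw [Finsupp.degree_eq_sum, Fintype.sum_sum_type] at h2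
    push_cast at h2 hn
    zify at h1
    have : (0 : ℤ) ≤ ∑ c : Bool, (m (Sum.inr c) : ℤ) := by positivity
    linarith
  · push Not at hinj
    obtain ⟨r, r', hb, hm, hne⟩ := hinj
    rw [altSum_prod_pow_eq_zero (m := fun q => m (Sum.inl q)) hne hb hm]
    simp

end Alternating

/-! ### Degree bounds -/

section Degree
variable {τ R : Type*} [CommRing R]

theorem DegLE.zero (n : ℤ) : DegLE (0 : MvPolynomial τ R) n := by simp [DegLE]

theorem DegLE.mono {f : MvPolynomial τ R} {m n : ℤ} (hf : DegLE f m) (h : m ≤ n) : DegLE f n :=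
  fun k hk => (hf k hk).trans h

theorem DegLE.add {f g : MvPolynomial τ R} {n : ℤ} (hf : DegLE f n) (hg : DegLE g n) :
    DegLE (f + g) n := by
  classical
  intro k hk
  rcases Finset.mem_union.1 (MvPolynomial.support_add hk) with h | h
  · exact hf k h
  · exact hg k h

theorem DegLE.neg {f : MvPolynomial τ R} {n : ℤ} (hf : DegLE f n) : DegLE (-f) n := by
  intro k hk
  rw [MvPolynomial.support_neg] at hk
  exact hf k hk

theorem DegLE.sub {f g : MvPolynomial τ R} {n : ℤ} (hf : DegLE f n) (hg : DegLE g n) :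
    DegLE (f - g) n := by
  rw [sub_eq_add_neg]
  exact hf.add hg.neg

theorem DegLE.mul {f g : MvPolynomial τ R} {m n : ℤ} (hf : DegLE f m) (hg : DegLE g n) :
    DegLE (f * g) (m + n) := by
  classical
  intro k hk
  obtain ⟨u, hu, v, hv, rfl⟩ := Finset.mem_add.1 (MvPolynomial.support_mul f g hk)
  rw [map_add]
  push_cast
  exact add_le_add (hf u hu) (hg v hv)

theorem DegLE.one : DegLE (1 : MvPolynomial τ R) 0 := by
  classical
  intro k hk
  have : k = 0 := by
    by_contra h
    rw [MvPolynomial.mem_support_iff, MvPolynomial.coeff_one, if_neg (Ne.symm h)] at hk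
    exact hk rfl
  simp [this]

theorem DegLE.X (i : τ) : DegLE (MvPolynomial.X i : MvPolynomial τ R) 1 := by
  classical
  intro k hk
  rw [MvPolynomial.mem_support_iff, MvPolynomial.coeff_X] at hk
  have : Finsupp.single i 1 = k := by
    by_contra h
    simp [h] at hk
  simp [← this]

theorem DegLE.sum {ι : Type*} {S : Finset ι} {f : ι → MvPolynomial τ R} {n : ℤ}
    (hf : ∀ i ∈ S, DegLE (f i) n) : DegLE (∑ i ∈ S, f i) n := by
  classical
  induction S using Finset.induction_on with
  | empty => simpa using DegLE.zero n
  | insert i S hi ih =>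
    rw [Finset.sum_insert hi]
    exact (hf i (by simp)).add (ih fun j hj => hf j (by simp [hj]))

theorem DegLE.prod {ι : Type*} {S : Finset ι} {f : ι → MvPolynomial τ R} {n : ι → ℤ}
    (hf : ∀ i ∈ S, DegLE (f i) (n i)) : DegLE (∏ i ∈ S, f i) (∑ i ∈ S, n i) := by
  classical
  induction S using Finset.induction_on with
  | empty => simpa using DegLE.one
  | insert i S hi ih =>
    rw [Finset.prod_insert hi, Finset.sum_insert hi]
    exact (hf i (by simp)).mul (ih fun j hj => hf j (by simp [hj]))

theorem DegLE.pow {f : MvPolynomial τ R} {n : ℤ} (hf : DegLE f n) (k : ℕ) :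
    DegLE (f ^ k) (k * n) := by
  induction k with
  | zero => simpa using DegLE.one
  | succ k ih =>
    rw [pow_succ]
    convert ih.mul hf using 1
    push_cast; ring

theorem DegLE.ite {P : Prop} [Decidable P] {f : MvPolynomial τ R} {n : ℤ} (hf : DegLE f n) :
    DegLE (if P then f else 1) (if P then n else 0) := by
  split_ifs
  · exact hf
  · exact DegLE.one

/-- A polynomial in one more variable has total degree at most `n`. -/
def PolyDegLE (p : Polynomial (MvPolynomial τ R)) (n : ℤ) : Prop :=
  ∀ i, DegLE (p.coeff i) (n - i)

theorem PolyDegLE.one : PolyDegLE (1 : Polynomial (MvPolynomial τ R)) 0 := by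
  intro i
  rw [Polynomial.coeff_one]
  split_ifs with h
  · simpa [h] using DegLE.one
  · exact DegLE.zero _

theorem PolyDegLE.X_add_C_mul {p : Polynomial (MvPolynomial τ R)} {n : ℤ} (hp : PolyDegLE p n)
    {c : MvPolynomial τ R} (hc : DegLE c 1) :
    PolyDegLE ((Polynomial.X + Polynomial.C c) * p) (1 + n) := by
  intro i
  rw [add_mul, Polynomial.coeff_add, Polynomial.coeff_C_mul]
  refine DegLE.add ?_ ((hc.mul (hp i)).mono (by linarith))
  cases i with
  | zero => simpa using DegLE.zero _
  | succ i =>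
    rw [Polynomial.coeff_X_mul]
    exact (hp i).mono (by push_cast; linarith)

theorem PolyDegLE.prod {ι : Type*} {S : Finset ι} {P : ι → Prop} [DecidablePred P]
    {c : ι → MvPolynomial τ R} (hc : ∀ i, DegLE (c i) 1) :
    PolyDegLE (∏ i ∈ S, if P i then Polynomial.X + Polynomial.C (c i) else 1)
      (∑ i ∈ S, if P i then 1 else 0) := by
  classical
  induction S using Finset.induction_on with
  | empty => simpa using PolyDegLE.one
  | insert i S hi ih =>
    rw [Finset.prod_insert hi, Finset.sum_insert hi]
    split_ifs
    · exact ih.X_add_C_mul (hc i)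
    · simpa using ih

theorem PolyDegLE.divByMonic_X_add_C {p : Polynomial (MvPolynomial τ R)} {n : ℤ}
    (hp : PolyDegLE p n) {c : MvPolynomial τ R} (hc : DegLE c 1) :
    PolyDegLE (p /ₘ (Polynomial.X + Polynomial.C c)) (n - 1) := by
  intro i
  have : Polynomial.X + Polynomial.C c = Polynomial.X - Polynomial.C (-c) := by simp
  rw [this, Polynomial.coeff_divByMonic_X_sub_C]
  refine DegLE.sum fun j hj => ?_
  have hj := (Finset.mem_Icc.1 hj).1
  refine ((hc.neg.pow (j - (i + 1))).mul (hp j)).mono ?_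
  push_cast [hj]
  linarith

/-- Division by a product of monic polynomials is iterated division. -/
theorem divByMonic_mul {p f g : Polynomial R} (hf : f.Monic) (hg : g.Monic) :
    p /ₘ (f * g) = (p /ₘ f) /ₘ g := by
  nontriviality R
  refine (Polynomial.div_modByMonic_unique (r := p %ₘ f + f * ((p /ₘ f) %ₘ g)) _
    (hf.mul hg) ⟨?_, ?_⟩).1
  · have h1 := Polynomial.modByMonic_add_div p f
    have h2 := Polynomial.modByMonic_add_div (p /ₘ f) g
    linear_combination h1 + f * h2
  · have h1 : (p %ₘ f).degree < f.degree := Polynomial.degree_modByMonic_lt _ hf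
    have h2 : ((p /ₘ f) %ₘ g).degree < g.degree := Polynomial.degree_modByMonic_lt _ hg
    have hg0 : (0 : WithBot ℕ) ≤ g.degree := Polynomial.zero_le_degree_iff.2 hg.ne_zero
    have hf0 : f.degree ≠ ⊥ := Polynomial.degree_ne_bot.2 hf.ne_zero
    rw [hg.degree_mul]
    refine (Polynomial.degree_add_le _ _).trans_lt (max_lt ?_ ?_)
    · exact h1.trans_le (le_add_of_nonneg_right hg0)
    · rw [hf.degree_mul_comm, hf.degree_mul, add_comm]
      exact WithBot.add_lt_add_left hf0 h2

theorem monic_prod {ι : Type*} (S : Finset ι) (P : ι → Prop) [DecidablePred P] (c : ι → R) :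
    (∏ i ∈ S, if P i then Polynomial.X + Polynomial.C (c i) else 1).Monic := by
  refine Polynomial.monic_prod_of_monic _ _ fun i _ => ?_
  split_ifs
  · exact Polynomial.monic_X_add_C _
  · exact Polynomial.monic_one

theorem PolyDegLE.divByMonic_prod {ι : Type*} {S : Finset ι} {P : ι → Prop} [DecidablePred P]
    {c : ι → MvPolynomial τ R} (hc : ∀ i, DegLE (c i) 1)
    {p : Polynomial (MvPolynomial τ R)} {n : ℤ} (hp : PolyDegLE p n) :
    PolyDegLE (p /ₘ ∏ i ∈ S, if P i then Polynomial.X + Polynomial.C (c i) else 1)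
      (n - ∑ i ∈ S, if P i then 1 else 0) := by
  classical
  induction S using Finset.induction_on generalizing p n with
  | empty => simpa using hp
  | insert i S hi ih =>
    rw [Finset.prod_insert hi, Finset.sum_insert hi]
    split_ifs
    · rw [divByMonic_mul (Polynomial.monic_X_add_C _) (monic_prod _ _ _), ← sub_sub]
      exact ih (hp.divByMonic_X_add_C (hc i))
    · simpa using ih hp

theorem PolyDegLE.eval {p : Polynomial (MvPolynomial τ R)} {n : ℤ} (hp : PolyDegLE p n)
    {x : MvPolynomial τ R} (hx : DegLE x 1) : DegLE (p.eval x) n := by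
  rw [Polynomial.eval_eq_sum_range]
  refine DegLE.sum fun i _ => ?_
  exact ((hp i).mul (hx.pow i)).mono (by linarith)

end Degree

/-! ### Labels -/

/-- The cell at position `ρ` of the diagonal at distance `d` from the main diagonal, on the side
`i ≥ j` if `σ = true` and on the side `i ≤ j` if `σ = false`. -/
def cellOf (σ : Bool) (d ρ : ℕ) : ℕ × ℕ := if σ then (ρ + d, ρ) else (ρ, ρ + d)

/-- The cells of `μ`, indexed by side, diagonal and position on the diagonal. The cells of the main
diagonal occur twice, once on each side. -/
abbrev Lab (μ : YoungDiagram) := {p : Bool × ℕ × ℕ // cellOf p.1 p.2.1 p.2.2 ∈ μ}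

namespace Lab
variable {μ : YoungDiagram}

/-- The side of a label. -/
abbrev side (r : Lab μ) : Bool := r.1.1
/-- The distance from the main diagonal. -/
abbrev diag (r : Lab μ) : ℕ := r.1.2.1
/-- The position on the diagonal. -/
abbrev pos (r : Lab μ) : ℕ := r.1.2.2
/-- The cell of a label. -/
def cell (r : Lab μ) : ℕ × ℕ := cellOf r.side r.diag r.pos
/-- A code for the pair of the side and the diagonal. -/
def block (r : Lab μ) : ℕ := 2 * r.diag + (if r.side then 1 else 0)

theorem block_eq_iff {r r' : Lab μ} :
    r.block = r'.block ↔ r.side = r'.side ∧ r.diag = r'.diag := by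
  unfold block
  cases h1 : r.side <;> cases h2 : r'.side <;> simp <;> omega

theorem ext' {r r' : Lab μ} (h1 : r.side = r'.side) (h2 : r.diag = r'.diag) (h3 : r.pos = r'.pos) :
    r = r' := Subtype.ext (Prod.ext h1 (Prod.ext h2 h3))

theorem mem_of_le {r : Lab μ} {p : ℕ × ℕ} (h : p ≤ r.cell) : p ∈ μ :=
  μ.isLowerSet h r.2

instance : Finite (Lab μ) := by
  refine Finite.of_injective
    (fun r : Lab μ => ((r.side, ⟨r.cell, r.2⟩) : Bool × {c // c ∈ μ.cells})) ?_
  intro r r' h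
  simp only [Prod.mk.injEq] at h
  obtain ⟨h1, h2⟩ := h
  have h2 : cellOf r.side r.diag r.pos = cellOf r'.side r'.diag r'.pos := congrArg Subtype.val h2
  unfold cellOf at h2
  rw [h1] at h2
  cases h3 : r'.side
  · simp only [h3, Prod.mk.injEq, Bool.false_eq_true, if_false] at h2
    exact ext' h1 (by omega) (by omega)
  · simp only [h3, Prod.mk.injEq, if_true] at h2
    exact ext' h1 (by omega) (by omega)

instance : Fintype (Lab μ) := Fintype.ofFinite _

theorem exists_pos_of_le (r : Lab μ) {k : ℕ} (hk : k ≤ r.pos) :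
    ∃ r' : Lab μ, r'.side = r.side ∧ r'.diag = r.diag ∧ r'.pos = k := by
  refine ⟨⟨(r.side, r.diag, k), mem_of_le (r := r) ?_⟩, rfl, rfl, rfl⟩
  cases h : r.side <;> simp [cellOf, cell, h, hk]

theorem exists_diag_of_le (r : Lab μ) {k : ℕ} (hk : k ≤ r.diag) :
    ∃ r' : Lab μ, r'.side = r.side ∧ r'.diag = k ∧ r'.pos = r.pos := by
  refine ⟨⟨(r.side, k, r.pos), mem_of_le (r := r) ?_⟩, rfl, rfl, rfl⟩
  cases h : r.side <;> simp [cellOf, cell, h, hk]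

theorem exists_succ_diag (r : Lab μ) {k : ℕ} (hk : k + 1 = r.pos) :
    ∃ r' : Lab μ, r'.side = r.side ∧ r'.diag = r.diag + 1 ∧ r'.pos = k := by
  refine ⟨⟨(r.side, r.diag + 1, k), mem_of_le (r := r) ?_⟩, rfl, rfl, rfl⟩
  cases h : r.side <;> simp [cellOf, cell, h] <;> omega

theorem isPos (μ : YoungDiagram) : IsPos (block (μ := μ)) pos where
  inj r r' h1 h2 := ext' (block_eq_iff.1 h1).1 (block_eq_iff.1 h1).2 h2
  down r k hk := by
    obtain ⟨r', h1, h2, h3⟩ := r.exists_pos_of_le hk.le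
    exact ⟨r', block_eq_iff.2 ⟨h1.symm, h2.symm⟩, h3⟩

end Lab

/-! ### The localized weight as a quotient of a polynomial by a discriminant -/

section Formula
variable {μ : YoungDiagram} (a : ℕ) (x : Lab μ → ℤ) {K : Type*} [CommRing K] (e : Lab μ → K)
  (w t : K)

/-- The factors of the numerator that involve a single label of the main diagonal. -/
def facI : K := ∏ r : Lab μ, if (r.side = true ∧ r.diag = 0) ∧ 0 < x r then e r - w else 1

/-- The factors of the numerator from pairs of labels on one diagonal and on the next one. -/
def facT : K := ∏ r' : Lab μ, ∏ r : Lab μ,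
  if (r.side = r'.side ∧ r.diag = r'.diag + 1) ∧ x r' < x r then e r - e r' else 1

/-- The numerator of the factor `facE` for the label `r'`. -/
def numE (r' : Lab μ) : Polynomial K := ∏ r : Lab μ,
  if (r.side = r'.side ∧ r.diag + 1 = r'.diag) ∧ x r' + a < x r then
    Polynomial.X + Polynomial.C (e r) else 1

/-- The denominator of the factor `facE` for the label `r'`. -/
def denE (r' : Lab μ) : Polynomial K := ∏ r : Lab μ,
  if (r.side = r'.side ∧ r.diag = r'.diag) ∧ x r' + a < x r then
    Polynomial.X + Polynomial.C (e r) else 1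

/-- The quotients of the factors from one diagonal to the previous one, by those within the
diagonal. The polynomial quotient replaces the quotient of values, which need not make sense. -/
def facE : K := ∏ r' : Lab μ, if 1 ≤ r'.diag then
  (numE a x e r' /ₘ denE a x e r').eval (-(e r' + t)) else 1

/-- The numerator of the factor `facD` for the label `r'`. -/
def numD (r' : Lab μ) : Polynomial K := (∏ r : Lab μ,
  if (r.side = true ∧ r.diag = 0) ∧ x r' < x r then
    Polynomial.X + Polynomial.C (e r) else 1) *
  (if x r' < -(a : ℤ) then Polynomial.X + Polynomial.C (w - t) else 1)

/-- The denominator of the factor `facD` for the label `r'`. -/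
def denD (r' : Lab μ) : Polynomial K := ∏ r : Lab μ,
  if (r.side = true ∧ r.diag = 0) ∧ x r' + a < x r then
    Polynomial.X + Polynomial.C (e r - t) else 1

/-- The factors from the two copies of the main diagonal. -/
def facD : K := ∏ r' : Lab μ, if r'.side = false ∧ r'.diag = 0 then
  (numD a x e w t r' /ₘ denD a x e t r').eval (-e r') else 1

/-- The numerator, a polynomial in `e`, `w` and `t`. The weight of a configuration is obtained for
`w = 0` and `t = 1`, `e` being the positions of the labels. -/
def numF : K := facI x e w * facT x e * facE a x e t * facD a x e w t

/-- The denominator: differences of positions within blocks. -/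
def denF : K := ∏ r' : Lab μ, ∏ r : Lab μ,
  if (r.side = r'.side ∧ r.diag = r'.diag) ∧ x r' < x r then e r - e r' else 1

theorem denE_monic (r' : Lab μ) : (denE a x e r').Monic := monic_prod _ _ _

theorem denD_monic (r' : Lab μ) : (denD a x e t r').Monic := monic_prod _ _ _

variable {e w t} in
theorem map_ite_prod {L ι : Type*} [CommRing L] (φ : K →+* L) (S : Finset ι) (P : ι → Prop)
    [DecidablePred P] (c : ι → K) :
    (∏ i ∈ S, if P i then Polynomial.X + Polynomial.C (c i) else 1).map φ
      = ∏ i ∈ S, if P i then Polynomial.X + Polynomial.C (φ (c i)) else 1 := by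
  rw [Polynomial.map_prod]
  refine Finset.prod_congr rfl fun i _ => ?_
  split_ifs <;> simp

theorem map_numF {L : Type*} [CommRing L] (φ : K →+* L) :
    φ (numF a x e w t) = numF a x (fun r => φ (e r)) (φ w) (φ t) := by
  simp only [numF, map_mul]
  congr 1; congr 1; congr 1
  · simp only [facI, map_prod]
    refine Finset.prod_congr rfl fun r _ => ?_
    split_ifs <;> simp
  · simp only [facT, map_prod]
    refine Finset.prod_congr rfl fun r _ => Finset.prod_congr rfl fun r' _ => ?_
    split_ifs <;> simp
  · simp only [facE, map_prod]
    refine Finset.prod_congr rfl fun r' _ => ?_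
    split_ifs
    · rw [← Polynomial.eval_map_apply, Polynomial.map_divByMonic _ (denE_monic _ _ _ _)]
      simp [numE, denE, map_ite_prod]
    · simp
  · simp only [facD, map_prod]
    refine Finset.prod_congr rfl fun r' _ => ?_
    split_ifs
    · rw [← Polynomial.eval_map_apply, Polynomial.map_divByMonic _ (denD_monic _ _ _ _ _)]
      rw [numD, numD, denD, denD, Polynomial.map_mul, map_ite_prod, map_ite_prod, map_neg]
      simp only [map_sub]
      congr 3
      split_ifs <;> simp
    · simp

section Relabel
variable {σ : Equiv.Perm (Lab μ)}

theorem side_perm (hσ : σ ∈ blockPerms (Lab.block (μ := μ))) (r : Lab μ) :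
    (σ r).side = r.side := (Lab.block_eq_iff.1 (mem_blockPerms.1 hσ r)).1

theorem diag_perm (hσ : σ ∈ blockPerms (Lab.block (μ := μ))) (r : Lab μ) :
    (σ r).diag = r.diag := (Lab.block_eq_iff.1 (mem_blockPerms.1 hσ r)).2

theorem denF_comp (hσ : σ ∈ blockPerms (Lab.block (μ := μ))) :
    denF (fun r => x (σ r)) (fun r => e (σ r)) = denF x e := by
  refine Fintype.prod_equiv σ _ _ fun r' => Fintype.prod_equiv σ _ _ fun r => ?_
  simp only [side_perm hσ, diag_perm hσ]

theorem numF_comp (hσ : σ ∈ blockPerms (Lab.block (μ := μ))) :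
    numF a (fun r => x (σ r)) (fun r => e (σ r)) w t = numF a x e w t := by
  unfold numF
  congr 1; congr 1; congr 1
  · refine Fintype.prod_equiv σ _ _ fun r => ?_
    simp only [side_perm hσ, diag_perm hσ]
  · refine Fintype.prod_equiv σ _ _ fun r' => Fintype.prod_equiv σ _ _ fun r => ?_
    simp only [side_perm hσ, diag_perm hσ]
  · refine Fintype.prod_equiv σ _ _ fun r' => ?_
    have h1 : numE a (fun r => x (σ r)) (fun r => e (σ r)) r' = numE a x e (σ r') := by
      refine Fintype.prod_equiv σ _ _ fun r => ?_
      simp only [side_perm hσ, diag_perm hσ]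
    have h2 : denE a (fun r => x (σ r)) (fun r => e (σ r)) r' = denE a x e (σ r') := by
      refine Fintype.prod_equiv σ _ _ fun r => ?_
      simp only [side_perm hσ, diag_perm hσ]
    rw [h1, h2]
    simp only [diag_perm hσ]
  · refine Fintype.prod_equiv σ _ _ fun r' => ?_
    have h1 : numD a (fun r => x (σ r)) (fun r => e (σ r)) w t r' = numD a x e w t (σ r') := by
      unfold numD
      congr 1
      refine Fintype.prod_equiv σ _ _ fun r => ?_
      simp only [side_perm hσ, diag_perm hσ]
    have h2 : denD a (fun r => x (σ r)) (fun r => e (σ r)) t r' = denD a x e t (σ r') := by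
      refine Fintype.prod_equiv σ _ _ fun r => ?_
      simp only [side_perm hσ, diag_perm hσ]
    rw [h1, h2]
    simp only [side_perm hσ, diag_perm hσ]

end Relabel

/-- The degree of the numerator. -/
def degF : ℤ :=
  (∑ r : Lab μ, if (r.side = true ∧ r.diag = 0) ∧ 0 < x r then 1 else 0)
  + (∑ r' : Lab μ, ∑ r : Lab μ,
      if (r.side = r'.side ∧ r.diag = r'.diag + 1) ∧ x r' < x r then 1 else 0)
  + (∑ r' : Lab μ, if 1 ≤ r'.diag then
      (∑ r : Lab μ, if (r.side = r'.side ∧ r.diag + 1 = r'.diag) ∧ x r' + a < x r then 1 else 0)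
      - (∑ r : Lab μ, if (r.side = r'.side ∧ r.diag = r'.diag) ∧ x r' + a < x r then 1 else 0)
      else 0)
  + (∑ r' : Lab μ, if r'.side = false ∧ r'.diag = 0 then
      ((∑ r : Lab μ, if (r.side = true ∧ r.diag = 0) ∧ x r' < x r then 1 else 0)
        + (if x r' < -(a : ℤ) then 1 else 0))
      - (∑ r : Lab μ, if (r.side = true ∧ r.diag = 0) ∧ x r' + a < x r then 1 else 0)
      else 0)

/-- The degree of the denominator. -/
def degDen : ℤ := ∑ r' : Lab μ, ∑ r : Lab μ,
  if (r.side = r'.side ∧ r.diag = r'.diag) ∧ x r' < x r then 1 else 0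

theorem degDen_comp {σ : Equiv.Perm (Lab μ)} (hσ : σ ∈ blockPerms (Lab.block (μ := μ))) :
    degDen (fun r => x (σ r)) = degDen x := by
  refine Fintype.sum_equiv σ _ _ fun r' => Fintype.sum_equiv σ _ _ fun r => ?_
  simp only [side_perm hσ, diag_perm hσ]

theorem degF_comp {σ : Equiv.Perm (Lab μ)} (hσ : σ ∈ blockPerms (Lab.block (μ := μ))) :
    degF a (fun r => x (σ r)) = degF a x := by
  have key : ∀ (f g : Lab μ → ℤ), (∀ r, f r = g (σ r)) → ∑ r, f r = ∑ r, g r :=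
    fun f g h => Fintype.sum_equiv σ f g h
  unfold degF
  congr 1; congr 1; congr 1
  · refine key _ _ fun r => ?_
    simp only [side_perm hσ, diag_perm hσ]
  · refine key _ _ fun r' => key _ _ fun r => ?_
    simp only [side_perm hσ, diag_perm hσ]
  · refine key _ _ fun r' => ?_
    simp only [diag_perm hσ]
    congr 2 <;> (refine key _ _ fun r => ?_; simp only [side_perm hσ, diag_perm hσ])
  · refine key _ _ fun r' => ?_
    simp only [side_perm hσ, diag_perm hσ]
    congr 2
    · congr 1
      refine key _ _ fun r => ?_
      simp only [side_perm hσ, diag_perm hσ]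
    · refine key _ _ fun r => ?_
      simp only [side_perm hσ, diag_perm hσ]

section
variable {τ : Type*} {E : Lab μ → MvPolynomial τ ℚ} {W T : MvPolynomial τ ℚ}

theorem degLE_facE_aux (hE : ∀ r, DegLE (E r) 1) (hT : DegLE T 1) (r' : Lab μ) :
    DegLE ((numE a x E r' /ₘ denE a x E r').eval (-(E r' + T)))
      ((∑ r : Lab μ, if (r.side = r'.side ∧ r.diag + 1 = r'.diag) ∧ x r' + a < x r then 1 else 0)
      - (∑ r : Lab μ, if (r.side = r'.side ∧ r.diag = r'.diag) ∧ x r' + a < x r then 1 else 0)) :=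
  PolyDegLE.eval (PolyDegLE.divByMonic_prod hE (PolyDegLE.prod hE)) ((hE _).add hT).neg

theorem degLE_facD_aux (hE : ∀ r, DegLE (E r) 1) (hW : DegLE W 1) (hT : DegLE T 1) (r' : Lab μ) :
    DegLE ((numD a x E W T r' /ₘ denD a x E T r').eval (-E r'))
      (((∑ r : Lab μ, if (r.side = true ∧ r.diag = 0) ∧ x r' < x r then 1 else 0)
        + (if x r' < -(a : ℤ) then 1 else 0))
      - (∑ r : Lab μ, if (r.side = true ∧ r.diag = 0) ∧ x r' + a < x r then 1 else 0)) := by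
  have h : PolyDegLE (∏ r : Lab μ, if (r.side = true ∧ r.diag = 0) ∧ x r' < x r then
      Polynomial.X + Polynomial.C (E r) else 1)
      (∑ r : Lab μ, if (r.side = true ∧ r.diag = 0) ∧ x r' < x r then 1 else 0) :=
    PolyDegLE.prod hE
  have h2 : PolyDegLE (numD a x E W T r')
      ((∑ r : Lab μ, if (r.side = true ∧ r.diag = 0) ∧ x r' < x r then 1 else 0)
        + (if x r' < -(a : ℤ) then 1 else 0)) := by
    unfold numD
    generalize (∏ r : Lab μ, if (r.side = true ∧ r.diag = 0) ∧ x r' < x r then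
      Polynomial.X + Polynomial.C (E r) else 1) = p at h ⊢
    generalize (∑ r : Lab μ, if (r.side = true ∧ r.diag = 0) ∧ x r' < x r then (1 : ℤ) else 0)
      = n at h ⊢
    by_cases h0 : x r' < -(a : ℤ)
    · simp only [h0, if_true]
      have h3 := h.X_add_C_mul (hW.sub hT)
      rwa [mul_comm, add_comm 1 n] at h3
    · simpa only [h0, if_false, mul_one, add_zero] using h
  exact PolyDegLE.eval (PolyDegLE.divByMonic_prod (fun r => (hE r).sub hT) h2) (hE _).neg

theorem degLE_numF (hE : ∀ r, DegLE (E r) 1) (hW : DegLE W 1) (hT : DegLE T 1) :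
    DegLE (numF a x E W T) (degF a x) := by
  unfold numF degF
  refine DegLE.mul (DegLE.mul (DegLE.mul ?_ ?_) ?_) ?_
  · exact DegLE.prod fun r _ => ((hE r).sub hW).ite
  · exact DegLE.prod fun r' _ => DegLE.prod fun r _ => ((hE r).sub (hE r')).ite
  · exact DegLE.prod fun r' _ => DegLE.ite (degLE_facE_aux a x hE hT r')
  · exact DegLE.prod fun r' _ => DegLE.ite (degLE_facD_aux a x hE hW hT r')

end

end Formula

/-! ### The involution of the main diagonal -/

namespace Lab
variable {μ : YoungDiagram}

theorem flip_mem (r : Lab μ) (h : r.diag = 0) : cellOf (!r.side) 0 r.pos ∈ μ := by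
  have := mem_of_le (r := r) (p := cellOf (!r.side) 0 r.pos) ?_
  · exact this
  · cases h' : r.side <;> simp [cellOf, cell, h, h']

/-- The function underlying `flip`. -/
def flipFun (r : Lab μ) : Lab μ := if h : r.diag = 0 then ⟨(!r.side, 0, r.pos), flip_mem r h⟩ else r

theorem flipFun_involutive : Function.Involutive (flipFun (μ := μ)) := by
  intro r
  by_cases h : r.diag = 0
  · have h1 : flipFun r = ⟨(!r.side, 0, r.pos), flip_mem r h⟩ := dif_pos h
    have h2 : (flipFun r).diag = 0 := by rw [h1]
    rw [flipFun, dif_pos h2]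
    refine ext' ?_ h.symm ?_
    · change (!(flipFun r).side) = r.side
      rw [h1]
      exact Bool.not_not _
    · change (flipFun r).pos = r.pos
      rw [h1]
  · have h1 : flipFun r = r := dif_neg h
    rw [h1, h1]

/-- The involution exchanging the two copies of the main diagonal. -/
def flip : Equiv.Perm (Lab μ) := flipFun_involutive.toPerm

theorem flip_of_diag {r : Lab μ} (h : r.diag = 0) :
    flip r = ⟨(!r.side, 0, r.pos), flip_mem r h⟩ := dif_pos h

theorem flip_of_diag_ne {r : Lab μ} (h : r.diag ≠ 0) : flip r = r := dif_neg h

theorem flip_side {r : Lab μ} (h : r.diag = 0) : (flip r).side = !r.side := by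
  rw [flip_of_diag h]

@[simp] theorem flip_diag (r : Lab μ) : (flip r).diag = r.diag := by
  by_cases h : r.diag = 0
  · rw [flip_of_diag h]; exact h.symm
  · rw [flip_of_diag_ne h]

@[simp] theorem flip_pos (r : Lab μ) : (flip r).pos = r.pos := by
  by_cases h : r.diag = 0
  · rw [flip_of_diag h]
  · rw [flip_of_diag_ne h]

@[simp] theorem flip_flip (r : Lab μ) : flip (flip r) = r :=
  flipFun_involutive r

end Lab

/-! ### The value of the formula at the positions -/

theorem eval_divByMonic_mul_eval {K : Type*} [CommRing K] {p q : Polynomial K} (hq : q.Monic)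
    (h : q ∣ p) (y : K) : (p /ₘ q).eval y * q.eval y = p.eval y := by
  obtain ⟨c, rfl⟩ := h
  rw [Polynomial.mul_divByMonic_cancel_left _ hq, Polynomial.eval_mul, mul_comm]

theorem prod_ite_dvd_prod_ite {ι κ M : Type*} [CommMonoid M] [Fintype ι] [Fintype κ]
    {P : ι → Prop} {Q : κ → Prop} [DecidablePred P] [DecidablePred Q] {f : ι → M} {g : κ → M}
    (φ : ι → κ) (h1 : ∀ i, P i → Q (φ i)) (h2 : ∀ i j, P i → P j → φ i = φ j → i = j)
    (h3 : ∀ i, P i → f i = g (φ i)) :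
    (∏ i, if P i then f i else 1) ∣ ∏ k, if Q k then g k else 1 := by
  classical
  rw [← Finset.prod_filter, ← Finset.prod_filter]
  have : ∏ i ∈ univ.filter P, f i = ∏ k ∈ (univ.filter P).image φ, g k := by
    rw [Finset.prod_image fun i hi j hj => h2 i j (by simpa using hi) (by simpa using hj)]
    exact Finset.prod_congr rfl fun i hi => h3 i (by simpa using hi)
  rw [this]
  refine Finset.prod_dvd_prod_of_subset _ _ _ fun k hk => ?_
  obtain ⟨i, hi, rfl⟩ := Finset.mem_image.1 hk
  simpa using h1 i (by simpa using hi)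

theorem eval_prod_ite {ι K : Type*} [CommRing K] (S : Finset ι) (P : ι → Prop) [DecidablePred P]
    (c : ι → K) (y : K) :
    (∏ i ∈ S, if P i then Polynomial.X + Polynomial.C (c i) else 1).eval y
      = ∏ i ∈ S, if P i then y + c i else 1 := by
  rw [Polynomial.eval_prod]
  refine Finset.prod_congr rfl fun i _ => ?_
  split_ifs <;> simp

theorem prod_ite_eq_zero_iff {ι K : Type*} [CommRing K] [IsDomain K] [Fintype ι] (P : ι → Prop)
    [DecidablePred P] (c : ι → K) :
    (∏ i, if P i then c i else 1) = 0 ↔ ∃ i, P i ∧ c i = 0 := by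
  rw [Finset.prod_eq_zero_iff]
  refine exists_congr fun i => ?_
  by_cases h : P i <;> simp [h]

section Pointwise
variable {μ : YoungDiagram} (a : ℕ) (x : Lab μ → ℤ)

/-- The positions of the labels. -/
def posQ (r : Lab μ) : ℚ := r.pos

/-- The fillings `x` that arise from reverse plane partitions `n` as `x = a * pos - n`: they are
weakly monotone along both coordinates, bounded at the corner, and compatible on the two copies of
the main diagonal. -/
structure Valid : Prop where
  init : ∀ r : Lab μ, r.side = true → r.diag = 0 → r.pos = 0 → x r ≤ 0
  step : ∀ r r' : Lab μ, r'.side = r.side → r'.diag = r.diag + 1 → r'.pos = r.pos → x r' ≤ x r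
  climb : ∀ r r' : Lab μ, r'.side = r.side → r'.diag = r.diag + 1 → r.pos = r'.pos + 1 →
    x r ≤ x r' + a
  compat : ∀ r : Lab μ, x (Lab.flip r) = x r

/-- The two copies of the main diagonal carry the same multiset of entries. -/
def Balanced : Prop :=
  (univ.filter fun r : Lab μ => r.side = true ∧ r.diag = 0).val.map x
    = (univ.filter fun r : Lab μ => r.side = false ∧ r.diag = 0).val.map x

variable {a x}

/-- A descent between neighbouring diagonals at equal positions makes a factor of `facT` vanish. -/
theorem step_of_facT_ne_zero {e : Lab μ → ℚ} (he : e = posQ) (h : facT x e ≠ 0) :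
    ∀ r r' : Lab μ, r'.side = r.side → r'.diag = r.diag + 1 → r'.pos = r.pos → x r' ≤ x r := by
  intro r r' h1 h2 h3
  by_contra! hlt
  refine h (Finset.prod_eq_zero (Finset.mem_univ r) ?_)
  exact (prod_ite_eq_zero_iff _ _).2 ⟨r', ⟨⟨h1, h2⟩, hlt⟩, by simp [he, posQ, h3]⟩

/-- The quotient in `facE` is a true quotient once `x` decreases along the arms: every factor of the
denominator occurs in the numerator, for the label at the same position on the previous diagonal. -/
theorem denE_dvd_numE (hstep : ∀ r r' : Lab μ, r'.side = r.side → r'.diag = r.diag + 1 →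
      r'.pos = r.pos → x r' ≤ x r) {r' : Lab μ} (h1 : 1 ≤ r'.diag) :
    denE a x posQ r' ∣ numE a x posQ r' := by
  have : ∀ r : Lab μ, ∃ q : Lab μ, (r.side = r'.side ∧ r.diag = r'.diag) →
      q.side = r.side ∧ q.diag + 1 = r.diag ∧ q.pos = r.pos := by
    intro r
    by_cases h : r.side = r'.side ∧ r.diag = r'.diag
    · obtain ⟨q, h2, h3, h4⟩ := r.exists_diag_of_le (k := r.diag - 1) (by omega)
      exact ⟨q, fun _ => ⟨h2, by omega, h4⟩⟩
    · exact ⟨r, fun h' => absurd h' h⟩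
  choose φ hφ using this
  refine prod_ite_dvd_prod_ite φ ?_ ?_ ?_
  · rintro r ⟨h, hx⟩
    obtain ⟨h2, h3, h4⟩ := hφ r h
    exact ⟨⟨h2.trans h.1, h3.trans h.2⟩, hx.trans_le (hstep _ _ h2.symm h3.symm h4.symm)⟩
  · rintro r q ⟨hr, -⟩ ⟨hq, -⟩ heq
    obtain ⟨h2, h3, h4⟩ := hφ r hr
    obtain ⟨h5, h6, h7⟩ := hφ q hq
    rw [heq] at h2 h3 h4
    exact Lab.ext' (h2.symm.trans h5) (h3.symm.trans h6) (h4.symm.trans h7)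
  · rintro r ⟨h, -⟩
    obtain ⟨h2, h3, h4⟩ := hφ r h
    simp [posQ, h4]

/-- For `t = 1`, an increase by more than `a` towards the main diagonal makes a factor of `facE`
vanish. -/
theorem climb_of_facE_ne_zero (hstep : ∀ r r' : Lab μ, r'.side = r.side → r'.diag = r.diag + 1 →
      r'.pos = r.pos → x r' ≤ x r) (h : facE a x posQ (1 : ℚ) ≠ 0) :
    ∀ r r' : Lab μ, r'.side = r.side → r'.diag = r.diag + 1 → r.pos = r'.pos + 1 →
      x r ≤ x r' + a := by
  by_contra hcon
  let V : Finset (Lab μ) := univ.filter fun r' => ∃ r : Lab μ, r'.side = r.side ∧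
    r'.diag = r.diag + 1 ∧ r.pos = r'.pos + 1 ∧ x r' + a < x r
  have hV : V.Nonempty := by
    push Not at hcon
    obtain ⟨r, r', h1, h2, h3, h4⟩ := hcon
    exact ⟨r', Finset.mem_filter.2 ⟨Finset.mem_univ _, r, h1, h2, h3, h4⟩⟩
  -- a violation on the outermost possible diagonal makes a factor vanish
  obtain ⟨r', hr', hmax⟩ := V.exists_max_image (fun r => r.diag) hV
  obtain ⟨r, h1, h2, h3, h4⟩ := (Finset.mem_filter.1 hr').2
  refine h (Finset.prod_eq_zero (Finset.mem_univ r') ?_)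
  rw [if_pos (by omega)]
  have hq := eval_divByMonic_mul_eval (denE_monic a x posQ r')
    (denE_dvd_numE hstep (r' := r') (by omega)) (-(posQ r' + 1))
  have hnum : (numE a x posQ r').eval (-(posQ r' + 1)) = 0 := by
    rw [numE, eval_prod_ite, prod_ite_eq_zero_iff]
    exact ⟨r, ⟨⟨h1.symm, h2.symm⟩, h4⟩, by simp [posQ, h3]⟩
  have hden : (denE a x posQ r').eval (-(posQ r' + 1)) ≠ 0 := by
    rw [denE, eval_prod_ite, Ne, prod_ite_eq_zero_iff]
    rintro ⟨q, ⟨⟨hq1, hq2⟩, hq3⟩, hq4⟩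
    have hq5 : q.pos = r'.pos + 1 := by
      have : (q.pos : ℚ) = r'.pos + 1 := by
        simp only [posQ] at hq4
        linarith
      exact_mod_cast this
    obtain ⟨p, hp1, hp2, hp3⟩ := q.exists_succ_diag hq5.symm
    have hp4 := hstep r' p (hp1.trans hq1) (by omega) hp3
    have : p ∈ V := by
      simp only [V, Finset.mem_filter, Finset.mem_univ, true_and]
      exact ⟨q, hp1, hp2, by omega, by omega⟩
    have h7 : p.diag ≤ r'.diag := hmax p this
    omega
  rw [hnum] at hq
  exact (mul_eq_zero.1 hq).resolve_right hden

/-- Along the main diagonal, the entries increase by at most `a`. -/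
theorem le_add_of_step_climb (hstep : ∀ r r' : Lab μ, r'.side = r.side → r'.diag = r.diag + 1 →
      r'.pos = r.pos → x r' ≤ x r)
    (hclimb : ∀ r r' : Lab μ, r'.side = r.side → r'.diag = r.diag + 1 → r.pos = r'.pos + 1 →
      x r ≤ x r' + a) {r q : Lab μ} (h1 : r.side = q.side) (h2 : r.diag = q.diag)
    (h3 : r.pos = q.pos + 1) : x r ≤ x q + a := by
  obtain ⟨p, hp1, hp2, hp3⟩ := r.exists_succ_diag h3.symm
  have h4 := hclimb r p hp1 hp2 (by omega)
  have h5 := hstep q p (hp1.trans h1) (by omega) hp3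
  omega

open Classical in
/-- The quotient in `facD` is a true quotient once `x` increases by at most `a` along the main
diagonal: every factor of the denominator occurs in the numerator, for the previous position, and
for position `0` it is the additional factor of the numerator. -/
theorem denD_dvd_numD (hinit : ∀ r : Lab μ, r.side = true → r.diag = 0 → r.pos = 0 → x r ≤ 0)
    (hdiag : ∀ r q : Lab μ, r.side = q.side → r.diag = q.diag → r.pos = q.pos + 1 →
      x r ≤ x q + a) (r' : Lab μ) :
    denD a x posQ (1 : ℚ) r' ∣ numD a x posQ 0 1 r' := by
  have hnum : numD a x posQ (0 : ℚ) 1 r' = ∏ o : Option (Lab μ),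
      if (o.elim (x r' < -(a : ℤ)) fun r => (r.side = true ∧ r.diag = 0) ∧ x r' < x r) then
        Polynomial.X + Polynomial.C (o.elim (0 - 1) posQ) else 1 := by
    rw [Fintype.prod_option, mul_comm, numD]
    congr 1
    · refine Finset.prod_congr rfl fun r _ => ?_
      congr 1
    · congr 1
  have : ∀ r : Lab μ, ∃ o : Option (Lab μ), ((r.side = true ∧ r.diag = 0) ∧ x r' + a < x r) →
      (o.elim (x r' < -(a : ℤ) ∧ r.pos = 0) fun q => (q.side = true ∧ q.diag = 0) ∧ x r' < x q ∧
        r.pos = q.pos + 1) := by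
    intro r
    by_cases h : (r.side = true ∧ r.diag = 0) ∧ x r' + a < x r
    · obtain ⟨⟨h1, h2⟩, h3⟩ := h
      rcases Nat.eq_zero_or_pos r.pos with h4 | h4
      · refine ⟨none, fun _ => ⟨?_, h4⟩⟩
        have := hinit r h1 h2 h4
        omega
      · obtain ⟨q, h5, h6, h7⟩ := r.exists_pos_of_le (k := r.pos - 1) (by omega)
        have := hdiag r q h5.symm h6.symm (by omega)
        exact ⟨some q, fun _ => ⟨⟨h5.trans h1, h6.trans h2⟩, by omega, by omega⟩⟩
    · exact ⟨none, fun h' => absurd h' h⟩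
  choose φ hφ using this
  rw [hnum]
  refine prod_ite_dvd_prod_ite φ ?_ ?_ ?_
  · intro r hr
    have := hφ r hr
    cases h : φ r with
    | none => rw [h] at this; exact this.1
    | some q => rw [h] at this; exact ⟨this.1, this.2.1⟩
  · intro r q hr hq heq
    have h1 := hφ r hr
    have h2 := hφ q hq
    rw [heq] at h1
    have h3 : r.pos = q.pos := by
      cases h : φ q with
      | none => rw [h] at h1 h2; exact h1.2.trans h2.2.symm
      | some p => rw [h] at h1 h2; exact h1.2.2.trans h2.2.2.symm
    exact Lab.ext' (hr.1.1.trans hq.1.1.symm) (hr.1.2.trans hq.1.2.symm) h3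
  · intro r hr
    have := hφ r hr
    cases h : φ r with
    | none => rw [h] at this; simp [posQ, this.2]
    | some q => rw [h] at this; simp [posQ, this.2.2]

/-- The two copies of the main diagonal carry the same sum of entries. -/
theorem Balanced.sum_eq (h : Balanced x) :
    ∑ r : Lab μ, (if r.side = false ∧ r.diag = 0 then x (Lab.flip r) - x r else 0) = 0 := by
  have h1 := congrArg Multiset.sum h
  have h2 : ∑ r : Lab μ, (if r.side = true ∧ r.diag = 0 then x r else 0)
      = ∑ r : Lab μ, (if r.side = false ∧ r.diag = 0 then x r else 0) := by
    rw [← Finset.sum_filter, ← Finset.sum_filter]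
    exact h1
  have h3 : ∑ r : Lab μ, (if r.side = true ∧ r.diag = 0 then x r else 0)
      = ∑ r : Lab μ, (if r.side = false ∧ r.diag = 0 then x (Lab.flip r) else 0) := by
    rw [← Equiv.sum_comp Lab.flip]
    refine Finset.sum_congr rfl fun r _ => ?_
    by_cases h : r.diag = 0
    · rw [Lab.flip_diag, Lab.flip_side h]
      simp
    · rw [Lab.flip_diag]
      simp [h]
  rw [h3] at h2
  rw [← sub_eq_zero, ← Finset.sum_sub_distrib] at h2
  refine Eq.trans ?_ h2
  refine Finset.sum_congr rfl fun r _ => ?_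
  split_ifs <;> simp

/-- The polynomial formula for the weight vanishes on the fillings that do not come from reverse
plane partitions. -/
theorem valid_of_numF_ne_zero (hbal : Balanced x) (h : numF a x posQ (0 : ℚ) 1 ≠ 0) :
    Valid a x := by
  unfold numF at h
  have hD := right_ne_zero_of_mul h
  have hE := right_ne_zero_of_mul (left_ne_zero_of_mul h)
  have hT := right_ne_zero_of_mul (left_ne_zero_of_mul (left_ne_zero_of_mul h))
  have hI := left_ne_zero_of_mul (left_ne_zero_of_mul (left_ne_zero_of_mul h))
  have hstep := step_of_facT_ne_zero rfl hT
  have hclimb := climb_of_facE_ne_zero hstep hE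
  have hinit : ∀ r : Lab μ, r.side = true → r.diag = 0 → r.pos = 0 → x r ≤ 0 := by
    intro r h1 h2 h3
    by_contra! h4
    exact hI ((prod_ite_eq_zero_iff _ _).2 ⟨r, ⟨⟨h1, h2⟩, h4⟩, by simp [posQ, h3]⟩)
  have hdiag : ∀ r q : Lab μ, r.side = q.side → r.diag = q.diag → r.pos = q.pos + 1 →
      x r ≤ x q + a := fun r q => le_add_of_step_climb hstep hclimb
  refine ⟨hinit, hstep, hclimb, ?_⟩
  have key : ∀ r : Lab μ, r.side = false → r.diag = 0 → x (Lab.flip r) ≤ x r := by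
    by_contra hcon
    let V : Finset (Lab μ) := univ.filter fun r => (r.side = false ∧ r.diag = 0) ∧
      x r < x (Lab.flip r)
    have hV : V.Nonempty := by
      push Not at hcon
      obtain ⟨r, h1, h2, h3⟩ := hcon
      exact ⟨r, by simp only [V, Finset.mem_filter]; exact ⟨Finset.mem_univ _, ⟨h1, h2⟩, h3⟩⟩
    -- a violation at the last possible position makes a factor vanish
    obtain ⟨r', hr', hmax⟩ := V.exists_max_image (fun r => r.pos) hV
    obtain ⟨⟨h1, h2⟩, h3⟩ := (Finset.mem_filter.1 hr').2
    have hf1 : (Lab.flip r').side = true := by rw [Lab.flip_side h2, h1]; rfl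
    have hf2 : (Lab.flip r').diag = 0 := by rw [Lab.flip_diag, h2]
    refine hD (Finset.prod_eq_zero (Finset.mem_univ r') ?_)
    rw [if_pos ⟨h1, h2⟩]
    have hq := eval_divByMonic_mul_eval (denD_monic a x posQ 1 r')
      (denD_dvd_numD hinit hdiag r') (-posQ r')
    have hnum : (numD a x posQ (0 : ℚ) 1 r').eval (-posQ r') = 0 := by
      rw [numD, Polynomial.eval_mul, eval_prod_ite]
      refine mul_eq_zero_of_left ((prod_ite_eq_zero_iff _ _).2 ?_) _
      exact ⟨Lab.flip r', ⟨⟨hf1, hf2⟩, h3⟩, by simp [posQ]⟩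
    have hden : (denD a x posQ (1 : ℚ) r').eval (-posQ r') ≠ 0 := by
      rw [denD, eval_prod_ite, Ne, prod_ite_eq_zero_iff]
      rintro ⟨q, ⟨⟨hq1, hq2⟩, hq3⟩, hq4⟩
      have hq5 : q.pos = r'.pos + 1 := by
        have : (q.pos : ℚ) = r'.pos + 1 := by
          simp only [posQ] at hq4
          linarith
        exact_mod_cast this
      have h4 := hdiag (Lab.flip q) r' (by rw [Lab.flip_side hq2, hq1, h1]; rfl)
        (by rw [Lab.flip_diag, hq2, h2]) (by rw [Lab.flip_pos, hq5])
      have : Lab.flip q ∈ V := by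
        simp only [V, Finset.mem_filter, Finset.mem_univ, true_and, Lab.flip_flip]
        exact ⟨⟨by rw [Lab.flip_side hq2, hq1]; rfl, by rw [Lab.flip_diag, hq2]⟩, by omega⟩
      have := hmax _ this
      simp only [Lab.flip_pos] at this
      omega
    rw [hnum] at hq
    exact (mul_eq_zero.1 hq).resolve_right hden
  have key2 : ∀ r : Lab μ, r.side = false → r.diag = 0 → x (Lab.flip r) = x r := by
    intro r h1 h2
    have h3 := (Finset.sum_eq_zero_iff_of_nonpos fun q _ => ?_).1 hbal.sum_eq r (Finset.mem_univ _)
    · rw [if_pos ⟨h1, h2⟩] at h3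
      omega
    · split_ifs with h4
      · have := key q h4.1 h4.2
        omega
      · exact le_rfl
  intro r
  by_cases h2 : r.diag = 0
  · cases h1 : r.side with
    | false => exact key2 r h1 h2
    | true =>
      have := key2 (Lab.flip r) (by rw [Lab.flip_side h2, h1]; rfl) (by rw [Lab.flip_diag, h2])
      rw [Lab.flip_flip] at this
      exact this.symm
  · rw [Lab.flip_of_diag_ne h2]

/-- The value of the formula for the weight at the positions `e` of a valid filling, with quotients
of values in place of the polynomial quotients. -/
def valF (a : ℕ) (x : Lab μ → ℤ) {K : Type*} [Field K] (e : Lab μ → K) (t : K) : K :=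
  facI x e 0 * facT x e
  * (∏ r' : Lab μ, if 1 ≤ r'.diag then
      (∏ r : Lab μ, if (r.side = r'.side ∧ r.diag + 1 = r'.diag) ∧ x r' + a < x r then
        e r - e r' - t else 1)
      / (∏ r : Lab μ, if (r.side = r'.side ∧ r.diag = r'.diag) ∧ x r' + a < x r then
        e r - e r' - t else 1) else 1)
  * (∏ r' : Lab μ, if r'.side = false ∧ r'.diag = 0 then
      ((∏ r : Lab μ, if (r.side = true ∧ r.diag = 0) ∧ x r' < x r then e r - e r' else 1)
        * (if x r' < -(a : ℤ) then -t - e r' else 1))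
      / (∏ r : Lab μ, if (r.side = true ∧ r.diag = 0) ∧ x r' + a < x r then
        e r - e r' - t else 1) else 1)
  / denF x e

/-- The denominators of `valF` do not vanish for valid fillings. -/
theorem Valid.pos_ne {a : ℕ} {x : Lab μ → ℤ} (h : Valid a x) {r r' : Lab μ}
    (h1 : r.side = r'.side) (h2 : r.diag = r'.diag)
    (h3 : x r' + a < x r) : (r.pos : ℚ) - r'.pos - 1 ≠ 0 := by
  intro h4
  have h5 : r.pos = r'.pos + 1 := by
    have : (r.pos : ℚ) = r'.pos + 1 := by linarith
    exact_mod_cast this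
  have := le_add_of_step_climb h.step h.climb h1 h2 h5
  omega

/-- On valid fillings the polynomial quotients in the formula are quotients of values. -/
theorem Valid.numF_div_denF (h : Valid a x) :
    numF a x posQ (0 : ℚ) 1 / denF x posQ = valF a x posQ 1 := by
  unfold numF valF
  congr 2
  · congr 1
    refine Finset.prod_congr rfl fun r' _ => ?_
    split_ifs with h1
    · have hq := eval_divByMonic_mul_eval (denE_monic a x posQ r')
        (denE_dvd_numE h.step h1) (-(posQ r' + 1))
      rw [numE, denE, eval_prod_ite, eval_prod_ite] at hq
      have e1 : ∀ r : Lab μ, -(posQ r' + 1) + posQ r = posQ r - posQ r' - 1 := fun r => by ring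
      simp only [e1] at hq
      rw [eq_div_iff, ← hq]
      · rfl
      · rw [Ne, prod_ite_eq_zero_iff]
        rintro ⟨r, ⟨⟨h3, h4⟩, h5⟩, h6⟩
        exact h.pos_ne h3 h4 h5 h6
    · rfl
  · refine Finset.prod_congr rfl fun r' _ => ?_
    split_ifs with h1 h2
    all_goals try rfl
    all_goals
      have hq := eval_divByMonic_mul_eval (denD_monic a x posQ 1 r')
        (denD_dvd_numD h.init (fun r q => le_add_of_step_climb h.step h.climb) r') (-posQ r')
      nth_rw 2 [numD] at hq
      nth_rw 2 [denD] at hq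
      rw [Polynomial.eval_mul, eval_prod_ite, eval_prod_ite] at hq
      have e1 : ∀ r : Lab μ, -posQ r' + posQ r = posQ r - posQ r' := fun r => by ring
      have e2 : ∀ r : Lab μ, -posQ r' + (posQ r - 1) = posQ r - posQ r' - 1 := fun r => by ring
      simp only [e1, e2, h2, if_true, if_false, Polynomial.eval_add, Polynomial.eval_X,
        Polynomial.eval_C, Polynomial.eval_one] at hq
      rw [eq_div_iff]
      · rw [hq]
        try ring
      · rw [Ne, prod_ite_eq_zero_iff]
        rintro ⟨r, ⟨⟨h3, h4⟩, h5⟩, h6⟩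
        rw [← h.compat r'] at h5
        refine h.pos_ne (r := r) (r' := Lab.flip r') ?_ ?_ h5 ?_
        · rw [Lab.flip_side h1.2, h1.1, h3]; rfl
        · rw [Lab.flip_diag, h4, h1.2]
        · rw [Lab.flip_pos]; exact h6

end Pointwise

/-! ### Vanishing of the numerator across a gap -/

section Gap
variable {μ : YoungDiagram} {a : ℕ} {x : Lab μ → ℤ} {P : ℤ}

/-- For `t = 0`, consecutive entries along an arm differ by at most `a` if no factor vanishes. -/
theorem arm_of_facE_ne_zero (hstep : ∀ r r' : Lab μ, r'.side = r.side → r'.diag = r.diag + 1 →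
      r'.pos = r.pos → x r' ≤ x r) (h : facE a x posQ (0 : ℚ) ≠ 0) (r r' : Lab μ)
    (h1 : r'.side = r.side) (h2 : r'.diag = r.diag + 1) (h3 : r'.pos = r.pos) :
    x r ≤ x r' + a := by
  by_contra! h4
  refine h (Finset.prod_eq_zero (Finset.mem_univ r') ?_)
  rw [if_pos (by omega)]
  have hq := eval_divByMonic_mul_eval (denE_monic a x posQ r')
    (denE_dvd_numE hstep (r' := r') (by omega)) (-(posQ r' + 0))
  have hnum : (numE a x posQ r').eval (-(posQ r' + 0)) = 0 := by
    rw [numE, eval_prod_ite, prod_ite_eq_zero_iff]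
    exact ⟨r, ⟨⟨h1.symm, h2.symm⟩, h4⟩, by simp [posQ, h3]⟩
  have hden : (denE a x posQ r').eval (-(posQ r' + 0)) ≠ 0 := by
    rw [denE, eval_prod_ite, Ne, prod_ite_eq_zero_iff]
    rintro ⟨q, ⟨⟨hq1, hq2⟩, hq3⟩, hq4⟩
    have hq5 : q.pos = r'.pos := by
      have : (q.pos : ℚ) = r'.pos := by
        simp only [posQ] at hq4
        linarith
      exact_mod_cast this
    rw [Lab.ext' hq1 hq2 hq5] at hq3
    omega
  rw [hnum] at hq
  exact (mul_eq_zero.1 hq).resolve_right hden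

/-- If the entries avoid the interval `(P, P + a]`, then the start of an arm is at most `P` as soon
as another entry of the arm is. -/
theorem arm_start_le (hsplit : ∀ r, x r ≤ P ∨ P + a < x r)
    (harm : ∀ r r' : Lab μ, r'.side = r.side → r'.diag = r.diag + 1 → r'.pos = r.pos →
      x r ≤ x r' + a) (n : ℕ) : ∀ r : Lab μ, r.diag = n → x r ≤ P →
      ∃ q : Lab μ, q.side = r.side ∧ q.diag = 0 ∧ q.pos = r.pos ∧ x q ≤ P := by
  induction n with
  | zero => exact fun r h1 h2 => ⟨r, rfl, h1, rfl, h2⟩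
  | succ n ih =>
    intro r h1 h2
    obtain ⟨q, h3, h4, h5⟩ := r.exists_diag_of_le (k := n) (by omega)
    have h6 := harm q r h3.symm (by omega) h5.symm
    have h7 : x q ≤ P := (hsplit q).resolve_right (by omega)
    obtain ⟨p, p1, p2, p3, p4⟩ := ih q h4 h7
    exact ⟨p, p1.trans h3, p2, p3.trans h5, p4⟩

/-- The case in which no entry below the gap lies on the side `i ≤ j`. Then the arms through the
entries below the gap start on the other copy of the main diagonal, which is impossible as the two
copies carry the same entries. -/
theorem numF_gap_eq_zero_of_forall (hbal : Balanced x) (hsplit : ∀ r, x r ≤ P ∨ P + a < x r)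
    (hL : ∃ r, x r ≤ P) (hno : ∀ r : Lab μ, r.side = false → ¬ x r ≤ P) (w : ℚ) :
    numF a x posQ w 0 = 0 := by
  by_contra h
  unfold numF at h
  have hE := right_ne_zero_of_mul (left_ne_zero_of_mul h)
  have hT := right_ne_zero_of_mul (left_ne_zero_of_mul (left_ne_zero_of_mul h))
  have hstep := step_of_facT_ne_zero rfl hT
  have harm := arm_of_facE_ne_zero hstep hE
  obtain ⟨r, hr⟩ := hL
  obtain ⟨q, h1, h2, h3, h4⟩ := arm_start_le hsplit harm _ r rfl hr
  have h5 : q.side = true := by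
    rw [h1]
    by_contra h6
    exact hno r (by simpa using h6) hr
  have h6 : x q ∈ (univ.filter fun r : Lab μ => r.side = true ∧ r.diag = 0).val.map x :=
    Multiset.mem_map_of_mem x (Finset.mem_filter.2 ⟨Finset.mem_univ _, h5, h2⟩)
  rw [hbal] at h6
  obtain ⟨p, hp, hpx⟩ := Multiset.mem_map.1 h6
  exact hno p (Finset.mem_filter.1 hp).2.1 (hpx ▸ h4)

/-- The case in which some entry below the gap lies on the side `i ≤ j`. On the outermost diagonal
with such an entry, it can only be at the last position, which is that of `rs`; following its arm to
the main diagonal, the factor of `facD` with root `w = posQ rs` vanishes. -/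
theorem numF_gap_eq_zero (hP : P < -(a : ℤ)) (hsplit : ∀ r, x r ≤ P ∨ P + a < x r) {rs : Lab μ}
    (hs : rs.side = false)
    (hpos : ∀ r : Lab μ, r.side = false → r.diag = rs.diag → r.pos ≤ rs.pos)
    (hL : ∃ r : Lab μ, r.side = false ∧ r.diag = rs.diag ∧ x r ≤ P)
    (hmax : ∀ r : Lab μ, r.side = false → x r ≤ P → r.diag ≤ rs.diag) :
    numF a x posQ (posQ rs) 0 = 0 := by
  by_contra h
  unfold numF at h
  have hD := right_ne_zero_of_mul h
  have hE := right_ne_zero_of_mul (left_ne_zero_of_mul h)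
  have hT := right_ne_zero_of_mul (left_ne_zero_of_mul (left_ne_zero_of_mul h))
  have hstep := step_of_facT_ne_zero rfl hT
  have harm := arm_of_facE_ne_zero hstep hE
  obtain ⟨r, h1, h2, h3⟩ := hL
  -- the arm through `r` ends at `r`, so `r` is at the last position of its diagonal
  have h4 : r.pos = rs.pos := by
    refine le_antisymm (hpos r h1 h2) ?_
    by_contra! h5
    obtain ⟨q, q1, q2, q3⟩ := rs.exists_pos_of_le (k := r.pos + 1) (by omega)
    obtain ⟨p, p1, p2, p3⟩ := q.exists_succ_diag (k := r.pos) (by omega)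
    have h6 := hstep r p (by rw [p1, q1, hs, h1]) (by omega) p3
    have := hmax p (by rw [p1, q1, hs]) (by omega)
    omega
  obtain ⟨r', q1, q2, q3, q4⟩ := arm_start_le hsplit harm _ r rfl h3
  refine hD (Finset.prod_eq_zero (Finset.mem_univ r') ?_)
  rw [if_pos ⟨q1.trans h1, q2⟩]
  have hdvd : denD a x posQ (0 : ℚ) r' ∣ ∏ r : Lab μ,
      if (r.side = true ∧ r.diag = 0) ∧ x r' < x r then
        Polynomial.X + Polynomial.C (posQ r) else 1 := by
    refine prod_ite_dvd_prod_ite id ?_ ?_ ?_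
    · rintro r ⟨h5, h6⟩
      exact ⟨h5, by simp only [id]; omega⟩
    · exact fun _ _ _ _ h => h
    · intro r _
      simp
  obtain ⟨c, hc⟩ := hdvd
  rw [numD, hc, mul_assoc, Polynomial.mul_divByMonic_cancel_left _ (denD_monic _ _ _ _ _),
    if_pos (by omega), Polynomial.eval_mul]
  simp [posQ, q3, h4]

end Gap

/-! ### Functions that are polynomial to every order in `ε` -/

section EpsPoly
variable {Λ R : Type*} [CommRing R]

/-- Modulo every power of `ε`, the function `g` of the integers `e` is a polynomial in the
products `ε * e i`. -/
def EpsPoly (ε : R) (g : (Λ → ℤ) → R) : Prop :=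
  ∀ D : ℕ, ∃ G : MvPolynomial Λ R, ∀ e : Λ → ℤ,
    ε ^ D ∣ g e - MvPolynomial.eval (fun i => ε * (e i : R)) G

variable {ε : R} {f g : (Λ → ℤ) → R}

theorem EpsPoly.const (c : R) : EpsPoly ε fun _ : Λ → ℤ => c :=
  fun _ => ⟨MvPolynomial.C c, fun e => by simp⟩

theorem EpsPoly.coord (i : Λ) : EpsPoly ε fun e : Λ → ℤ => ε * (e i : R) :=
  fun _ => ⟨MvPolynomial.X i, fun e => by simp⟩

theorem EpsPoly.add (hf : EpsPoly ε f) (hg : EpsPoly ε g) : EpsPoly ε fun e => f e + g e := by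
  intro D
  obtain ⟨F, hF⟩ := hf D
  obtain ⟨G, hG⟩ := hg D
  refine ⟨F + G, fun e => ?_⟩
  convert dvd_add (hF e) (hG e) using 1
  rw [map_add]; ring

theorem EpsPoly.mul (hf : EpsPoly ε f) (hg : EpsPoly ε g) : EpsPoly ε fun e => f e * g e := by
  intro D
  obtain ⟨F, hF⟩ := hf D
  obtain ⟨G, hG⟩ := hg D
  refine ⟨F * G, fun e => ?_⟩
  convert dvd_add ((hF e).mul_left (g e))
    ((hG e).mul_left (MvPolynomial.eval (fun i => ε * (e i : R)) F)) using 1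
  rw [map_mul]; ring

theorem EpsPoly.pow (hf : EpsPoly ε f) (n : ℕ) : EpsPoly ε fun e => f e ^ n := by
  induction n with
  | zero => simpa using EpsPoly.const (1 : R)
  | succ n ih => simpa only [pow_succ] using ih.mul hf

theorem EpsPoly.sum {ι : Type*} (S : Finset ι) {f : ι → (Λ → ℤ) → R}
    (h : ∀ i ∈ S, EpsPoly ε (f i)) : EpsPoly ε fun e => ∑ i ∈ S, f i e := by
  classical
  induction S using Finset.induction_on with
  | empty => simpa using EpsPoly.const (0 : R)
  | insert i S hi ih =>
    simp only [Finset.sum_insert hi]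
    exact (h i (by simp)).add (ih fun j hj => h j (by simp [hj]))

/-- The inverse of `c + ε l` with `c` invertible is a geometric series. -/
theorem EpsPoly.inv {c c' : R} (hc : c * c' = 1) {l v : (Λ → ℤ) → R}
    (hl : EpsPoly ε fun e => ε * l e) (hv : ∀ e, (c + ε * l e) * v e = 1) : EpsPoly ε v := by
  intro D
  have h1 : EpsPoly ε fun e => c' * ∑ j ∈ range D, (-c' * (ε * l e)) ^ j :=
    (EpsPoly.const c').mul (EpsPoly.sum _ fun j _ => ((EpsPoly.const (-c')).mul hl).pow j)
  obtain ⟨G, hG⟩ := h1 D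
  refine ⟨G, fun e => ?_⟩
  have h2 : ε ^ D ∣ v e - c' * ∑ j ∈ range D, (-c' * (ε * l e)) ^ j := by
    have h3 := mul_neg_geom_sum (-c' * (ε * l e)) D
    refine ⟨v e * (-c' * l e) ^ D, ?_⟩
    have h4 : ε ^ D * (v e * (-c' * l e) ^ D) = v e * (-c' * (ε * l e)) ^ D := by
      rw [mul_pow, mul_pow, mul_pow]; ring
    rw [h4]
    have h5 : (-c' * (ε * l e)) ^ D = 1 - (1 - -c' * (ε * l e)) *
        ∑ j ∈ range D, (-c' * (ε * l e)) ^ j := by rw [h3]; ring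
    rw [h5]
    linear_combination ((∑ j ∈ range D, (-c' * (ε * l e)) ^ j) * c') * hv e
      - (v e * ∑ j ∈ range D, (-c' * (ε * l e)) ^ j) * hc
  convert dvd_add h2 (hG e) using 1
  ring

end EpsPoly

/-! ### Evaluation at `s₃ = (s₁ + s₂) / a` -/

section Eval
variable {a : ℕ}

theorem algebraMap_ne_zero_of_evalPoly {u : MvPolynomial (Fin 3) ℚ} (hu : evalPoly a u ≠ 0) :
    algebraMap (MvPolynomial (Fin 3) ℚ) Coeff₃ u ≠ 0 := by
  intro h
  rw [map_eq_zero_iff _ (IsFractionRing.injective (MvPolynomial (Fin 3) ℚ) Coeff₃)] at h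
  exact hu (by rw [h, map_zero])

theorem EvaluatesTo.of_poly (p : MvPolynomial (Fin 3) ℚ) :
    EvaluatesTo a (algebraMap _ Coeff₃ p) (evalPoly a p) :=
  ⟨p, 1, by simp, by simp, by simp⟩

theorem EvaluatesTo.add {x x' : Coeff₃} {y y' : Coeff₂} (h : EvaluatesTo a x y)
    (h' : EvaluatesTo a x' y') : EvaluatesTo a (x + x') (y + y') := by
  obtain ⟨p, r, hr, rfl, rfl⟩ := h
  obtain ⟨p', r', hr', rfl, rfl⟩ := h'
  refine ⟨p * r' + r * p', r * r', by rw [map_mul]; exact mul_ne_zero hr hr', ?_, ?_⟩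
  · rw [div_add_div _ _ (algebraMap_ne_zero_of_evalPoly hr) (algebraMap_ne_zero_of_evalPoly hr')]
    simp
  · rw [div_add_div _ _ hr hr']
    simp

theorem EvaluatesTo.mul {x x' : Coeff₃} {y y' : Coeff₂} (h : EvaluatesTo a x y)
    (h' : EvaluatesTo a x' y') : EvaluatesTo a (x * x') (y * y') := by
  obtain ⟨p, r, hr, rfl, rfl⟩ := h
  obtain ⟨p', r', hr', rfl, rfl⟩ := h'
  refine ⟨p * p', r * r', by rw [map_mul]; exact mul_ne_zero hr hr', ?_, ?_⟩
  · rw [div_mul_div_comm]; simp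
  · rw [div_mul_div_comm]; simp

theorem EvaluatesTo.neg {x : Coeff₃} {y : Coeff₂} (h : EvaluatesTo a x y) :
    EvaluatesTo a (-x) (-y) := by
  obtain ⟨p, r, hr, rfl, rfl⟩ := h
  exact ⟨-p, r, hr, by simp [neg_div], by simp [neg_div]⟩

theorem EvaluatesTo.inv_poly {p : MvPolynomial (Fin 3) ℚ} (hp : evalPoly a p ≠ 0) :
    EvaluatesTo a (algebraMap _ Coeff₃ p)⁻¹ (evalPoly a p)⁻¹ :=
  ⟨1, p, hp, by simp, by simp⟩

variable (a) in
/-- The ring of the rational functions that can be evaluated at `s₃ = (s₁ + s₂) / a`. -/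
def evalRing : Subring Coeff₃ where
  carrier := {x | ∃ y, EvaluatesTo a x y}
  zero_mem' := ⟨_, by simpa using EvaluatesTo.of_poly (a := a) 0⟩
  one_mem' := ⟨_, by simpa using EvaluatesTo.of_poly (a := a) 1⟩
  add_mem' := fun ⟨_, h⟩ ⟨_, h'⟩ => ⟨_, h.add h'⟩
  mul_mem' := fun ⟨_, h⟩ ⟨_, h'⟩ => ⟨_, h.mul h'⟩
  neg_mem' := fun ⟨_, h⟩ => ⟨_, h.neg⟩

theorem poly_mem_evalRing (p : MvPolynomial (Fin 3) ℚ) : algebraMap _ Coeff₃ p ∈ evalRing a :=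
  ⟨_, EvaluatesTo.of_poly p⟩

theorem algebraMap_rat_mem_evalRing (q : ℚ) : algebraMap ℚ Coeff₃ q ∈ evalRing a := by
  have h := poly_mem_evalRing (a := a) (MvPolynomial.C q)
  rwa [← MvPolynomial.algebraMap_eq, ← IsScalarTower.algebraMap_apply] at h

variable (a) in
/-- The linear form vanishing on the plane `s₃ = (s₁ + s₂) / a`. -/
def eps : Coeff₃ := s 0 + s 1 - a * s 2

variable (a) in
/-- The linear form `δ s₁ + k s₃ + m ε`. -/
def lin (δ k m : ℤ) : Coeff₃ := δ * s 0 + k * s 2 + m * eps a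

variable (a) in
/-- The linear form `δ s₁ + k s₃ + m ε` as a polynomial. -/
def linPoly (δ k m : ℤ) : MvPolynomial (Fin 3) ℚ :=
  (δ : MvPolynomial (Fin 3) ℚ) * MvPolynomial.X 0 + (k : MvPolynomial (Fin 3) ℚ) * MvPolynomial.X 2
    + (m : MvPolynomial (Fin 3) ℚ) * (MvPolynomial.X 0 + MvPolynomial.X 1
      - (a : MvPolynomial (Fin 3) ℚ) * MvPolynomial.X 2)

theorem algebraMap_linPoly (δ k m : ℤ) :
    algebraMap (MvPolynomial (Fin 3) ℚ) Coeff₃ (linPoly a δ k m) = lin a δ k m := by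
  simp [linPoly, lin, eps, s]

theorem weight_eq_lin (w : ℤ × ℤ × ℤ) :
    weight w = lin a (w.1 - w.2.1) (w.2.2 + a * w.2.1) w.2.1 := by
  simp only [weight, lin, eps]
  push_cast
  ring

theorem evalPoly_linPoly (ha : 0 < a) (δ k m : ℤ) : evalPoly a (linPoly a δ k m)
    = algebraMap (MvPolynomial (Fin 2) ℚ) Coeff₂ ((δ : MvPolynomial (Fin 2) ℚ) * MvPolynomial.X 0)
      + k * (algebraMap (MvPolynomial (Fin 2) ℚ) Coeff₂ (MvPolynomial.X 0 + MvPolynomial.X 1) / a)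
    := by
  have h : (a : Coeff₂) ≠ 0 := by exact_mod_cast ha.ne'
  simp only [evalPoly, linPoly, map_add, map_mul, map_sub, map_intCast, map_natCast,
    MvPolynomial.aeval_X]
  simp only [Matrix.cons_val_zero, Matrix.cons_val_one, Matrix.cons_val]
  field_simp
  ring

theorem evalPoly_linPoly_ne_zero (ha : 0 < a) {δ k m : ℤ} (h : δ ≠ 0 ∨ k ≠ 0) :
    evalPoly a (linPoly a δ k m) ≠ 0 := by
  have ha' : (a : Coeff₂) ≠ 0 := by exact_mod_cast ha.ne'
  rw [evalPoly_linPoly ha]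
  intro h0
  have h1 : algebraMap (MvPolynomial (Fin 2) ℚ) Coeff₂
      ((a : MvPolynomial (Fin 2) ℚ) * ((δ : MvPolynomial (Fin 2) ℚ) * MvPolynomial.X 0)
      + (k : MvPolynomial (Fin 2) ℚ) * (MvPolynomial.X 0 + MvPolynomial.X 1)) = 0 := by
    have h2 : algebraMap (MvPolynomial (Fin 2) ℚ) Coeff₂
      ((a : MvPolynomial (Fin 2) ℚ) * ((δ : MvPolynomial (Fin 2) ℚ) * MvPolynomial.X 0)
      + (k : MvPolynomial (Fin 2) ℚ) * (MvPolynomial.X 0 + MvPolynomial.X 1))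
      = a * (algebraMap (MvPolynomial (Fin 2) ℚ) Coeff₂
        ((δ : MvPolynomial (Fin 2) ℚ) * MvPolynomial.X 0)
          + k * (algebraMap (MvPolynomial (Fin 2) ℚ) Coeff₂
          (MvPolynomial.X 0 + MvPolynomial.X 1) / a)) := by
      simp only [map_add, map_mul, map_intCast, map_natCast]
      field_simp
    rw [h2, h0, mul_zero]
  rw [map_eq_zero_iff _ (IsFractionRing.injective (MvPolynomial (Fin 2) ℚ) Coeff₂)] at h1
  have h3 := congrArg (MvPolynomial.eval ![(0 : ℚ), 1]) h1
  have h4 := congrArg (MvPolynomial.eval ![(1 : ℚ), -1]) h1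
  simp only [map_add, map_mul, map_intCast, map_natCast, MvPolynomial.eval_X, map_zero] at h3 h4
  simp at h3 h4
  rcases h with h | h
  · exact (h4.resolve_left ha.ne') |> h
  · exact h h3

theorem lin_mem_evalRing (δ k m : ℤ) : lin a δ k m ∈ evalRing a := by
  rw [← algebraMap_linPoly]
  exact poly_mem_evalRing _

theorem inv_lin_mem_evalRing (ha : 0 < a) {δ k m : ℤ} (h : δ ≠ 0 ∨ k ≠ 0) :
    (lin a δ k m)⁻¹ ∈ evalRing a := by
  rw [← algebraMap_linPoly]
  exact ⟨_, EvaluatesTo.inv_poly (evalPoly_linPoly_ne_zero ha h)⟩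

theorem lin_ne_zero (ha : 0 < a) {δ k m : ℤ} (h : δ ≠ 0 ∨ k ≠ 0) : lin a δ k m ≠ 0 := by
  rw [← algebraMap_linPoly]
  exact algebraMap_ne_zero_of_evalPoly (evalPoly_linPoly_ne_zero ha h)

theorem eps_eq_lin : eps a = lin a 0 0 1 := by simp [lin]

theorem eps_mem_evalRing : eps a ∈ evalRing a := by
  rw [eps_eq_lin]; exact lin_mem_evalRing _ _ _

theorem eps_ne_zero : eps a ≠ 0 := by
  rw [eps_eq_lin, ← algebraMap_linPoly, Ne,
    map_eq_zero_iff _ (IsFractionRing.injective (MvPolynomial (Fin 3) ℚ) Coeff₃)]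
  intro h
  have := congrArg (MvPolynomial.eval ![(1 : ℚ), 0, 0]) h
  simp [linPoly] at this

theorem evaluatesTo_eps (ha : 0 < a) : EvaluatesTo a (eps a) 0 := by
  have h := EvaluatesTo.of_poly (a := a) (linPoly a 0 0 1)
  rw [algebraMap_linPoly, evalPoly_linPoly ha, ← eps_eq_lin] at h
  simpa using h

/-- The linear form `ε` as an element of the ring of the functions that can be evaluated. -/
def epsR : evalRing a := ⟨eps a, eps_mem_evalRing⟩

variable (a) in
/-- A function with values in `ℚ(s₁, s₂, s₃)` that is polynomial to every order in `ε`, with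
coefficients that can be evaluated. -/
def IsEpsPoly {Λ : Type*} (g : (Λ → ℤ) → Coeff₃) : Prop :=
  ∃ g' : (Λ → ℤ) → evalRing a, (∀ e, g e = g' e) ∧ EpsPoly epsR g'

section
variable {Λ : Type*} {f g : (Λ → ℤ) → Coeff₃}

theorem IsEpsPoly.const {c : Coeff₃} (hc : c ∈ evalRing a) : IsEpsPoly a fun _ : Λ → ℤ => c :=
  ⟨fun _ => ⟨c, hc⟩, fun _ => rfl, EpsPoly.const _⟩

theorem IsEpsPoly.mul (hf : IsEpsPoly a f) (hg : IsEpsPoly a g) :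
    IsEpsPoly a fun e => f e * g e := by
  obtain ⟨f', hf, hf'⟩ := hf
  obtain ⟨g', hg, hg'⟩ := hg
  exact ⟨_, fun e => by simp only [hf, hg]; rfl, hf'.mul hg'⟩

theorem IsEpsPoly.add (hf : IsEpsPoly a f) (hg : IsEpsPoly a g) :
    IsEpsPoly a fun e => f e + g e := by
  obtain ⟨f', hf, hf'⟩ := hf
  obtain ⟨g', hg, hg'⟩ := hg
  exact ⟨_, fun e => by simp only [hf, hg]; rfl, hf'.add hg'⟩

theorem IsEpsPoly.one : IsEpsPoly a fun _ : Λ → ℤ => (1 : Coeff₃) := IsEpsPoly.const (one_mem _)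

theorem IsEpsPoly.pow (hf : IsEpsPoly a f) (n : ℕ) : IsEpsPoly a fun e => f e ^ n := by
  induction n with
  | zero => simpa using IsEpsPoly.one
  | succ n ih => simpa only [pow_succ] using ih.mul hf

theorem IsEpsPoly.prod {ι : Type*} (S : Finset ι) {f : ι → (Λ → ℤ) → Coeff₃}
    (h : ∀ i ∈ S, IsEpsPoly a (f i)) : IsEpsPoly a fun e => ∏ i ∈ S, f i e := by
  classical
  induction S using Finset.induction_on with
  | empty => simpa using IsEpsPoly.one
  | insert i S hi ih =>
    simp only [Finset.prod_insert hi]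
    exact (h i (by simp)).mul (ih fun j hj => h j (by simp [hj]))

theorem IsEpsPoly.sum {ι : Type*} (S : Finset ι) {f : ι → (Λ → ℤ) → Coeff₃}
    (h : ∀ i ∈ S, IsEpsPoly a (f i)) : IsEpsPoly a fun e => ∑ i ∈ S, f i e := by
  classical
  induction S using Finset.induction_on with
  | empty => simpa using IsEpsPoly.const (zero_mem (evalRing a))
  | insert i S hi ih =>
    simp only [Finset.sum_insert hi]
    exact (h i (by simp)).add (ih fun j hj => h j (by simp [hj]))

variable (a) in
/-- An affine function of the integers `e`, with integral coefficients. -/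
def IsAffine (m : (Λ → ℤ) → ℤ) : Prop :=
  EpsPoly (epsR (a := a)) fun e => epsR (a := a) * ((m e : ℤ) : evalRing a)

theorem IsAffine.coord (i : Λ) : IsAffine a fun e : Λ → ℤ => e i := EpsPoly.coord i

theorem IsAffine.const (n : ℤ) : IsAffine a fun _ : Λ → ℤ => n := EpsPoly.const _

theorem IsAffine.add {m n : (Λ → ℤ) → ℤ} (hm : IsAffine a m) (hn : IsAffine a n) :
    IsAffine a fun e => m e + n e := by
  have := EpsPoly.add hm hn
  unfold IsAffine
  convert this using 2
  push_cast; ring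

theorem IsAffine.neg {m : (Λ → ℤ) → ℤ} (hm : IsAffine a m) : IsAffine a fun e => -m e := by
  have := EpsPoly.mul (EpsPoly.const (-1)) hm
  unfold IsAffine
  convert this using 2
  push_cast; ring

theorem IsAffine.sub {m n : (Λ → ℤ) → ℤ} (hm : IsAffine a m) (hn : IsAffine a n) :
    IsAffine a fun e => m e - n e := by
  simpa only [sub_eq_add_neg] using hm.add hn.neg

theorem isEpsPoly_lin (δ k : ℤ) {m : (Λ → ℤ) → ℤ} (hm : IsAffine a m) :
    IsEpsPoly a fun e => lin a δ k (m e) := by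
  refine ⟨_, fun e => ?_, (EpsPoly.const ⟨lin a δ k 0, lin_mem_evalRing _ _ _⟩).add hm⟩
  simp only [lin, epsR]
  push_cast
  ring

theorem isEpsPoly_inv_lin (ha : 0 < a) {δ k : ℤ} (h : δ ≠ 0 ∨ k ≠ 0) {m : (Λ → ℤ) → ℤ}
    (hm : IsAffine a m) : IsEpsPoly a fun e => (lin a δ k (m e))⁻¹ := by
  refine ⟨fun e => ⟨_, inv_lin_mem_evalRing ha h⟩, fun e => rfl, ?_⟩
  refine EpsPoly.inv (c := ⟨lin a δ k 0, lin_mem_evalRing _ _ _⟩)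
    (c' := ⟨(lin a δ k 0)⁻¹, inv_lin_mem_evalRing ha h⟩) ?_ hm ?_
  · exact Subtype.ext (mul_inv_cancel₀ (lin_ne_zero ha h))
  · intro e
    refine Subtype.ext ?_
    have : lin a δ k (m e) = lin a δ k 0 + eps a * m e := by simp only [lin]; push_cast; ring
    have h1 := mul_inv_cancel₀ (lin_ne_zero (m := m e) ha h)
    nth_rw 1 [this] at h1
    simpa [epsR] using h1

end

/-! ### Alternating sums of functions that are polynomial in `ε` -/

open Classical in
/-- If the alternating numerator has degree at most `d + ∑ p`, then the alternating sum over the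
block permutations is divisible by `ε ^ (-d)`, and even by one more power of `ε` if the numerator
vanishes identically for other values of the additional variables. -/
theorem eps_zpow_mul_sum_mem {Λ : Type*} [Fintype Λ] {b p : Λ → ℕ} (h : IsPos b p)
    {N : MvPolynomial (Λ ⊕ Bool) ℚ} {d : ℤ} (hN : DegLE N (d + (∑ r, p r : ℕ)))
    {g : (Λ → ℤ) → Coeff₃} (hg : IsEpsPoly a g) (y : Bool → ℚ) (κ : ℕ) (hκ : κ ≤ 1)
    (hgap : κ = 1 → ∃ y' : Bool → ℚ, ∀ σ ∈ blockPerms b,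
      MvPolynomial.eval (Sum.elim (fun r => (p (σ r) : ℚ)) y') N = 0) :
    ∃ u ∈ evalRing a, eps a ^ d * ∑ σ ∈ blockPerms b,
      algebraMap ℚ Coeff₃ (((Equiv.Perm.sign σ : ℤ) : ℚ)
        * MvPolynomial.eval (Sum.elim (fun r => (p (σ r) : ℚ)) y) N)
        * g (fun r => (p (σ r) : ℤ)) = eps a ^ κ * u := by
  obtain ⟨g', hg, hg'⟩ := hg
  obtain ⟨G, hG⟩ := hg' ((-d).toNat + 1)
  choose u hu using hG
  let c : Equiv.Perm Λ → ℚ := fun σ => ((Equiv.Perm.sign σ : ℤ) : ℚ)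
        * MvPolynomial.eval (Sum.elim (fun r => (p (σ r) : ℚ)) y) N
  let M : (Λ →₀ ℕ) → MvPolynomial (Λ ⊕ Bool) ℚ := fun m => ∏ i, MvPolynomial.X (Sum.inl i) ^ m i
  have hval : ∀ σ : Equiv.Perm Λ, g (fun r => (p (σ r) : ℤ)) =
      (∑ m ∈ G.support, ((G.coeff m : evalRing a) : Coeff₃) * (eps a ^ m.degree *
        algebraMap ℚ Coeff₃ (∏ i, (p (σ i) : ℚ) ^ m i)))
      + eps a ^ ((-d).toNat + 1) * u (fun r => (p (σ r) : ℤ)) := by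
    intro σ
    have h1 := congrArg (fun z : evalRing a => (z : Coeff₃)) (hu (fun r => (p (σ r) : ℤ)))
    simp only [MvPolynomial.eval_eq', AddSubgroupClass.coe_sub, MulMemClass.coe_mul,
      SubmonoidClass.coe_pow] at h1
    rw [hg, sub_eq_iff_eq_add.1 h1, add_comm]
    congr 1
    rw [AddSubmonoidClass.coe_finsetSum]
    refine Finset.sum_congr rfl fun m _ => ?_
    rw [MulMemClass.coe_mul, SubmonoidClass.coe_finsetProd]
    congr 1
    rw [Finsupp.degree_eq_sum, ← Finset.prod_pow_eq_pow_sum, map_prod, ← Finset.prod_mul_distrib]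
    refine Finset.prod_congr rfl fun i _ => ?_
    rw [map_pow, ← mul_pow]
    simp [epsR]
  have hsum : ∑ σ ∈ blockPerms b, algebraMap ℚ Coeff₃ (c σ) * g (fun r => (p (σ r) : ℤ))
      = (∑ m ∈ G.support, ((G.coeff m : evalRing a) : Coeff₃) * (eps a ^ m.degree *
          algebraMap ℚ Coeff₃ (altSum b p (N * M m) y)))
        + eps a ^ ((-d).toNat + 1) * ∑ σ ∈ blockPerms b,
          algebraMap ℚ Coeff₃ (c σ) * u (fun r => (p (σ r) : ℤ)) := by
    simp only [hval, mul_add, Finset.sum_add_distrib, Finset.mul_sum]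
    congr 1
    · rw [Finset.sum_comm]
      refine Finset.sum_congr rfl fun m _ => ?_
      rw [altSum, map_sum, Finset.mul_sum, Finset.mul_sum]
      refine Finset.sum_congr rfl fun σ _ => ?_
      simp only [c, M, map_mul, map_prod, map_pow, MvPolynomial.eval_X, Sum.elim_inl]
      ring
    · refine Finset.sum_congr rfl fun σ _ => ?_
      ring
  change ∃ u ∈ evalRing a, eps a ^ d * ∑ σ ∈ blockPerms b,
    algebraMap ℚ Coeff₃ (c σ) * g (fun r => (p (σ r) : ℤ)) = eps a ^ κ * u
  have hε := eps_ne_zero (a := a)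
  have hM : ∀ m, DegLE (N * M m) (d + m.degree + (∑ r, p r : ℕ)) := by
    intro m
    have h1 : DegLE (M m) m.degree := by
      rw [Finsupp.degree_eq_sum]
      push_cast
      exact DegLE.prod fun i _ => by simpa using (DegLE.X (Sum.inl i)).pow (m i)
    exact (hN.mul h1).mono (by linarith)
  have hmon : ∀ m : Λ →₀ ℕ, ∃ v ∈ evalRing a, eps a ^ d * (eps a ^ m.degree *
      algebraMap ℚ Coeff₃ (altSum b p (N * M m) y)) = eps a ^ κ * v := by
    intro m
    rcases lt_or_ge (d + m.degree) κ with h1 | h1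
    · refine ⟨0, zero_mem _, ?_⟩
      have : altSum b p (N * M m) y = 0 := by
        rcases lt_or_ge (d + m.degree) 0 with h2 | h2
        · exact altSum_eq_zero h (hM m) (by linarith) y
        · have hκ1 : κ = 1 := by omega
          obtain ⟨y', hy'⟩ := hgap hκ1
          rw [altSum_eq h ((hM m).mono (by omega)) y y', altSum]
          refine Finset.sum_eq_zero fun σ hσ => ?_
          rw [map_mul, hy' σ hσ]
          ring
      simp [this]
    · obtain ⟨n, hn⟩ := Int.eq_ofNat_of_zero_le (sub_nonneg.2 h1)
      refine ⟨eps a ^ n * algebraMap ℚ Coeff₃ (altSum b p (N * M m) y),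
        mul_mem (pow_mem eps_mem_evalRing _) (algebraMap_rat_mem_evalRing _), ?_⟩
      rw [← mul_assoc, ← mul_assoc, ← zpow_natCast, ← zpow_natCast (eps a) κ,
        ← zpow_natCast (eps a) n, ← zpow_add₀ hε, ← zpow_add₀ hε]
      congr 2
      omega
  choose v hv hv' using hmon
  obtain ⟨n, hn⟩ := Int.eq_ofNat_of_zero_le
    (a := d + ((-d).toNat + 1 : ℕ) - κ) (by push_cast; omega)
  refine ⟨(∑ m ∈ G.support, ((G.coeff m : evalRing a) : Coeff₃) * v m)
    + eps a ^ n * ∑ σ ∈ blockPerms b,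
    algebraMap ℚ Coeff₃ (c σ) * u (fun r => (p (σ r) : ℤ)), ?_, ?_⟩
  · refine add_mem (sum_mem fun m _ => mul_mem (SetLike.coe_mem _) (hv m))
      (mul_mem (pow_mem eps_mem_evalRing _) (sum_mem fun σ _ =>
        mul_mem (algebraMap_rat_mem_evalRing _) (SetLike.coe_mem _)))
  · rw [hsum, mul_add, mul_add, Finset.mul_sum, Finset.mul_sum (s := G.support)]
    congr 1
    · refine Finset.sum_congr rfl fun m _ => ?_
      linear_combination ((G.coeff m : evalRing a) : Coeff₃) * hv' m
    · rw [← mul_assoc, ← mul_assoc]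
      congr 1
      rw [← zpow_natCast, ← zpow_natCast (eps a) κ,
        ← zpow_natCast (eps a) n, ← zpow_add₀ hε, ← zpow_add₀ hε]
      congr 1
      omega

end Eval

/-! ### Euler classes of Laurent polynomials -/

section Euler
variable {a : ℕ}

theorem weight_ne_zero {w : ℤ × ℤ × ℤ} (hw : w ≠ 0) : weight w ≠ 0 := by
  have h : weight w = algebraMap (MvPolynomial (Fin 3) ℚ) Coeff₃
      ((w.1 : MvPolynomial (Fin 3) ℚ) * MvPolynomial.X 0
        + (w.2.1 : MvPolynomial (Fin 3) ℚ) * MvPolynomial.X 1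
        + (w.2.2 : MvPolynomial (Fin 3) ℚ) * MvPolynomial.X 2) := by
    simp [weight, s]
  rw [h, Ne, map_eq_zero_iff _ (IsFractionRing.injective (MvPolynomial (Fin 3) ℚ) Coeff₃)]
  intro h0
  have h1 := congrArg (MvPolynomial.eval ![(1 : ℚ), 0, 0]) h0
  have h2 := congrArg (MvPolynomial.eval ![(0 : ℚ), 1, 0]) h0
  have h3 := congrArg (MvPolynomial.eval ![(0 : ℚ), 0, 1]) h0
  simp at h1 h2 h3
  exact hw (Prod.ext h1 (Prod.ext h2 h3))

/-- The weight, with the trivial weight replaced by `1`. -/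
def unitWeight (w : ℤ × ℤ × ℤ) : Coeff₃ := if w = 0 then 1 else weight w

theorem unitWeight_ne_zero (w : ℤ × ℤ × ℤ) : unitWeight w ≠ 0 := by
  unfold unitWeight
  split_ifs with h
  · exact one_ne_zero
  · exact weight_ne_zero h

/-- The Euler class, with the trivial weight replaced by `1`, so that it is multiplicative. -/
def eul (f : Laurent) : Coeff₃ := f.coeff.prod fun w c => unitWeight w ^ c

theorem euler_eq_eul {f : Laurent} (hf : f.coeff 0 = 0) : euler f = eul f := by
  refine Finset.prod_congr rfl fun w hw => ?_
  have : w ≠ 0 := by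
    rintro rfl
    exact (Finsupp.mem_support_iff.1 hw) hf
  simp only [unitWeight, if_neg this]

theorem eul_zero : eul 0 = 1 := by simp [eul]

theorem eul_add (f g : Laurent) : eul (f + g) = eul f * eul g := by
  unfold eul
  rw [AddMonoidAlgebra.coeff_add]
  exact Finsupp.prod_add_index' (fun _ => zpow_zero _)
    fun w m n => zpow_add₀ (unitWeight_ne_zero w) m n

theorem eul_neg (f : Laurent) : eul (-f) = (eul f)⁻¹ := by
  refine eq_inv_of_mul_eq_one_left ?_
  rw [← eul_add, neg_add_cancel, eul_zero]

theorem eul_sub (f g : Laurent) : eul (f - g) = eul f * (eul g)⁻¹ := by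
  rw [sub_eq_add_neg, eul_add, eul_neg]

theorem eul_sum {ι : Type*} (S : Finset ι) (f : ι → Laurent) :
    eul (∑ i ∈ S, f i) = ∏ i ∈ S, eul (f i) := by
  classical
  induction S using Finset.induction_on with
  | empty => simp [eul_zero]
  | insert i S hi ih => rw [Finset.sum_insert hi, Finset.prod_insert hi, eul_add, ih]

theorem eul_tmono (α β γ : ℤ) : eul (tmono α β γ) = unitWeight (α, β, γ) := by
  simp [eul, tmono]

theorem chern_add (n : ℕ) (f g : Laurent) : chern n (f + g) = chern n f + chern n g := by
  unfold chern
  rw [AddMonoidAlgebra.coeff_add]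
  refine Finsupp.sum_add_index' (fun _ => by simp) fun w b c => ?_
  push_cast; ring

theorem chern_zero (n : ℕ) : chern n 0 = 0 := by simp [chern]

theorem chern_neg (n : ℕ) (f : Laurent) : chern n (-f) = -chern n f := by
  have h := chern_add n f (-f)
  rw [add_neg_cancel, chern_zero] at h
  exact (neg_eq_of_add_eq_zero_right h.symm).symm

theorem chern_sub (n : ℕ) (f g : Laurent) : chern n (f - g) = chern n f - chern n g := by
  rw [sub_eq_add_neg, chern_add, chern_neg, sub_eq_add_neg]

theorem chern_sum (n : ℕ) {ι : Type*} (S : Finset ι) (f : ι → Laurent) :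
    chern n (∑ i ∈ S, f i) = ∑ i ∈ S, chern n (f i) := by
  classical
  induction S using Finset.induction_on with
  | empty => simp [chern_zero]
  | insert i S hi ih => rw [Finset.sum_insert hi, Finset.sum_insert hi, chern_add, ih]

theorem chern_tmono (n : ℕ) (α β γ : ℤ) :
    chern n (tmono α β γ) = weight (α, β, γ) ^ n / (n.factorial : Coeff₃) := by
  simp [chern, tmono]

theorem sum_Ico_sub_mul {A : Type*} [CommRing A] (f : ℤ → A) (t : A)
    (hf : ∀ k, f (k + 1) = f k * t) (k : ℤ) :
    ((∑ g ∈ Ico k 0, f g) - ∑ g ∈ Ico 0 k, f g) * (1 - t) = f k - f 0 := by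
  induction k with
  | zero => simp
  | succ k ih =>
    rw [Ico_eq_empty (by omega)] at ih ⊢
    have h : Ico (0 : ℤ) (k + 1) = insert (k : ℤ) (Ico 0 (k : ℤ)) := by
      ext g; simp only [mem_Ico, mem_insert]; omega
    rw [h, sum_insert (by simp), hf]
    linear_combination ih
  | pred k ih =>
    rw [Ico_eq_empty (a := (0 : ℤ)) (by omega)] at ih ⊢
    have h : Ico (-(k : ℤ) - 1) 0 = insert (-(k : ℤ) - 1) (Ico (-(k : ℤ)) 0) := by
      ext g; simp only [mem_Ico, mem_insert]; omega
    have h1 := hf (-(k : ℤ) - 1)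
    rw [sub_add_cancel] at h1
    rw [h, sum_insert (by simp)]
    linear_combination ih + h1

variable (a) in
/-- The quotient of `t₁ᵅ t₂ᵝ (t₃ᵞ - t₃^{-aβ})` by `1 - t₃`. -/
def rl (α β γ : ℤ) : Laurent :=
  (∑ g ∈ Ico (γ + a * β) 0, tmono α β (g - a * β)) - ∑ g ∈ Ico 0 (γ + a * β), tmono α β (g - a * β)

theorem rl_mul (α β γ : ℤ) :
    rl a α β γ * (1 - tmono 0 0 1) = tmono α β γ - tmono α β (-(a * β)) := by
  have h := sum_Ico_sub_mul (fun g => tmono α β (g - a * β)) (tmono 0 0 1) (fun k => by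
    rw [tmono_mul]; congr 1 <;> ring) (γ + a * β)
  rw [rl, h]
  congr 2 <;> ring

theorem rl_coeff_zero {α β γ : ℤ} (h : α = 0 → β = 0 → γ ≤ 0) : (rl a α β γ).coeff 0 = 0 := by
  have h1 : ∀ g : ℤ, (tmono α β g).coeff 0 = if (α, β, g) = 0 then 1 else 0 := by
    intro g
    rw [tmono, AddMonoidAlgebra.coeff_single, Finsupp.single_apply]
  rw [rl, AddMonoidAlgebra.coeff_sub, AddMonoidAlgebra.coeff_sum, AddMonoidAlgebra.coeff_sum,
    Finsupp.sub_apply, Finsupp.finsetSum_apply, Finsupp.finsetSum_apply, sum_eq_zero,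
    sum_eq_zero, sub_zero]
  · intro g hg
    rw [h1, if_neg]
    rintro h2
    simp only [Prod.mk_eq_zero] at h2
    obtain ⟨rfl, rfl, h3⟩ := h2
    have := h rfl rfl
    simp only [mem_Ico] at hg
    omega
  · intro g hg
    rw [h1, if_neg]
    rintro h2
    simp only [Prod.mk_eq_zero] at h2
    obtain ⟨rfl, rfl, h3⟩ := h2
    simp only [mem_Ico] at hg
    omega

variable (a) in
/-- The factor of `eul (rl a α β γ)` that can vanish or be infinite at `ε = 0`; here `δ = α - β`,
`k = γ + a β` and `m = β`. -/
def hEps (δ k m : ℤ) : Coeff₃ := if δ = 0 ∧ 0 < k then (m * eps a)⁻¹ else 1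

variable (a) in
/-- The factor of `eul (rl a α β γ)` that is regular and invertible at `ε = 0`. -/
def hUnit (δ k m : ℤ) : Coeff₃ := (∏ g ∈ Ico k 0, lin a δ g m)
  * ∏ g ∈ Ico 0 k, if δ = 0 ∧ g = 0 then 1 else (lin a δ g m)⁻¹

theorem eul_rl {α β γ : ℤ} (h : α = 0 → β = 0 → γ ≤ 0) : eul (rl a α β γ)
    = hEps a (α - β) (γ + a * β) β * hUnit a (α - β) (γ + a * β) β := by
  have h1 : ∀ g : ℤ, ¬(α = 0 ∧ β = 0 ∧ g = 0) →
      unitWeight (α, β, g - a * β) = lin a (α - β) g β := by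
    intro g hg
    rw [unitWeight, if_neg, weight_eq_lin (a := a)]
    · simp
    · intro h2
      simp only [Prod.mk_eq_zero] at h2
      obtain ⟨rfl, rfl, h3⟩ := h2
      exact hg ⟨rfl, rfl, by linarith⟩
  have h2 : ∏ g ∈ Ico (γ + a * β) 0, eul (tmono α β (g - a * β))
      = ∏ g ∈ Ico (γ + a * β) 0, lin a (α - β) g β := by
    refine prod_congr rfl fun g hg => ?_
    rw [eul_tmono, h1]
    simp only [mem_Ico] at hg
    omega
  have h3 : ∏ g ∈ Ico 0 (γ + a * β), eul (tmono α β (g - a * β))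
      = ∏ g ∈ Ico 0 (γ + a * β), lin a (α - β) g β := by
    refine prod_congr rfl fun g hg => ?_
    rw [eul_tmono, h1]
    rintro ⟨h4, h5, h6⟩
    have := h h4 h5
    simp only [mem_Ico, h5] at hg
    omega
  rw [rl, eul_sub, eul_sum, eul_sum, h2, h3, hUnit, ← prod_inv_distrib]
  have h4 : ∏ g ∈ Ico 0 (γ + a * β), (lin a (α - β) g β)⁻¹ = hEps a (α - β) (γ + a * β) β
      * ∏ g ∈ Ico 0 (γ + a * β), if α - β = 0 ∧ g = 0 then 1 else (lin a (α - β) g β)⁻¹ := by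
    unfold hEps
    by_cases h5 : α - β = 0
    · rw [h5]
      by_cases h6 : 0 < γ + a * β
      · have h7 : Ico 0 (γ + a * β) = insert 0 (Ico 1 (γ + a * β)) := by
          ext g; simp only [mem_Ico, mem_insert]; omega
        rw [if_pos ⟨rfl, h6⟩, h7, prod_insert (by simp), prod_insert (by simp)]
        have h8 : lin a 0 0 β = β * eps a := by simp [lin]
        rw [if_pos ⟨rfl, rfl⟩, one_mul, h8]
        congr 1
        refine prod_congr rfl fun g hg => ?_
        rw [if_neg]
        simp only [mem_Ico] at hg
        omega
      · rw [Ico_eq_empty (by omega)]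
        simp [h6]
    · simp [h5]
  rw [h4]
  ring

/-! ### The vertex character of a reverse plane partition -/

section Config
variable (μ : YoungDiagram)

/-- The character `∑ t₁ⁱ t₂ʲ t₃^{-n(i,j)}`. -/
def confLaurent (n : ℕ × ℕ → ℤ) : Laurent := ∑ c ∈ μ.cells, tmono c.1 c.2 (-n c)

variable (a) in
/-- The sum of a function of the weights over the monomials of
`-A - Ā / (t₁ t₂) + A Ā (1 - t₁) (1 - t₂) / (t₁ t₂)`, where `A = ∑ t₁ⁱ t₂ʲ t₃^{-n(i,j)}`. -/
def edgeSum (n : ℕ × ℕ → ℤ) (f : ℤ → ℤ → ℤ → Laurent) : Laurent :=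
  (∑ c ∈ μ.cells, (-f c.1 c.2 (-n c) - f (-c.1 - 1) (-c.2 - 1) (n c)))
  + ∑ c ∈ μ.cells, ∑ c' ∈ μ.cells,
    (f (c.1 - c'.1 - 1) (c.2 - c'.2 - 1) (n c' - n c) - f (c.1 - c'.1) (c.2 - c'.2 - 1) (n c' - n c)
      - f (c.1 - c'.1 - 1) (c.2 - c'.2) (n c' - n c) + f (c.1 - c'.1) (c.2 - c'.2) (n c' - n c))

/-- The operation `A ↦ -A - Ā / (t₁ t₂) + A Ā (1 - t₁) (1 - t₂) / (t₁ t₂)`. -/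
def edgeOp (A : Laurent) : Laurent :=
  -A - barLaurent A * tmono (-1) (-1) 0
    + A * barLaurent A * ((1 - tmono 1 0 0) * (1 - tmono 0 1 0) * tmono (-1) (-1) 0)

theorem edgeOp_confLaurent (n : ℕ × ℕ → ℤ) :
    edgeOp (confLaurent μ n) = edgeSum μ n tmono := by
  have h1 : barLaurent (confLaurent μ n) = ∑ c ∈ μ.cells, tmono (-c.1) (-c.2) (n c) := by
    rw [confLaurent, map_sum]
    refine sum_congr rfl fun c _ => ?_
    rw [barLaurent_tmono, neg_neg]
  have h2 : (1 - tmono 1 0 0) * (1 - tmono 0 1 0) * tmono (-1) (-1) 0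
      = tmono (-1) (-1) 0 - tmono 0 (-1) 0 - tmono (-1) 0 0 + 1 := by
    have e1 : tmono 1 0 0 * tmono (-1) (-1) 0 = tmono 0 (-1) 0 := by rw [tmono_mul]; rfl
    have e2 : tmono 0 1 0 * tmono (-1) (-1) 0 = tmono (-1) 0 0 := by rw [tmono_mul]; rfl
    have e3 : tmono 1 0 0 * tmono (-1) 0 0 = 1 := by rw [tmono_mul]; rfl
    linear_combination -e1 + (-1 + tmono 1 0 0) * e2 + e3
  rw [edgeOp, h1, h2, edgeSum, sum_sub_distrib, sum_neg_distrib]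
  congr 1
  · congr 1
    rw [sum_mul]
    refine sum_congr rfl fun c _ => ?_
    rw [tmono_mul]
    simp only [sub_eq_add_neg, add_zero]
  · rw [confLaurent, sum_mul_sum, sum_mul]
    refine sum_congr rfl fun c _ => ?_
    rw [sum_mul]
    refine sum_congr rfl fun c' _ => ?_
    rw [tmono_mul, mul_add, mul_sub, mul_sub, tmono_mul, tmono_mul, tmono_mul, mul_one]
    congr 1
    · congr 1
      · congr 1
        all_goals congr 1 <;> ring
      · congr 1 <;> ring
    · congr 1; ring

theorem edgeSum_rl_sub_mul (n n' : ℕ × ℕ → ℤ) :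
    (edgeSum μ n (rl a) - edgeSum μ n' (rl a)) * (1 - tmono 0 0 1)
      = edgeSum μ n tmono - edgeSum μ n' tmono := by
  have key : ∀ n : ℕ × ℕ → ℤ, edgeSum μ n (rl a) * (1 - tmono 0 0 1)
      = edgeSum μ n tmono - edgeSum μ n (fun α β _ => tmono α β (-(a * β))) := by
    intro n
    unfold edgeSum
    rw [add_mul, sum_mul, sum_mul, add_sub_add_comm, ← sum_sub_distrib, ← sum_sub_distrib]
    congr 1
    · refine sum_congr rfl fun c _ => ?_
      rw [sub_mul, neg_mul, rl_mul, rl_mul]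
      ring
    · refine sum_congr rfl fun c _ => ?_
      rw [sum_mul, ← sum_sub_distrib]
      refine sum_congr rfl fun c' _ => ?_
      rw [add_mul, sub_mul, sub_mul, rl_mul, rl_mul, rl_mul, rl_mul]
      ring
  have h : edgeSum μ n (fun α β _ => tmono α β (-(a * β)))
    = edgeSum μ n' (fun α β _ => tmono α β (-(a * β))) := rfl
  rw [sub_mul, key, key, h]
  ring

variable {μ}

theorem FixedPair.descChar_eq (P : FixedPair μ) {n : ℕ × ℕ → ℤ}
    (hn : legLaurent μ + P.charLaurent * (1 - tmono 0 0 1) = confLaurent μ n) :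
    toLaurent P.descChar = confLaurent μ n * ((1 - tmono 1 0 0) * (1 - tmono 0 1 0)) := by
  apply IsFractionRing.injective Laurent RatChar
  rw [algebraMap_toLaurent P.exists_descChar, ← hn]
  have h3 := one_sub_t₃_ne_zero
  simp only [map_mul, map_add, map_sub, map_one]
  rw [FixedPair.descChar, FixedPair.sheafChar, legChar, ← t₁, ← t₂, ← t₃]
  field_simp

theorem FixedPair.vertexChar_eq (P : FixedPair μ) {n : ℕ × ℕ → ℤ}
    (hn : legLaurent μ + P.charLaurent * (1 - tmono 0 0 1) = confLaurent μ n) :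
    toLaurent P.vertexChar = edgeSum μ 0 (rl a) - edgeSum μ n (rl a) := by
  apply IsFractionRing.injective Laurent RatChar
  rw [algebraMap_toLaurent P.exists_vertexChar]
  have h1 : t₁ ≠ 0 := tmono_ne_zero _ _ _
  have h2 : t₂ ≠ 0 := tmono_ne_zero _ _ _
  have h3 : t₃ ≠ 0 := tmono_ne_zero _ _ _
  have h4 := one_sub_t₃_ne_zero
  have hb : bar t₃ = t₃⁻¹ := bar_tmono _ _ _
  have e2 : algebraMap Laurent RatChar (tmono (-1) (-1) 0) = (t₁ * t₂)⁻¹ := by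
    refine eq_inv_of_mul_eq_one_left ?_
    rw [t₁, t₂]
    simp only [← map_mul, tmono_mul]
    simp [tmono_zero]
  have h5 : 1 - t₃⁻¹ ≠ 0 := by
    intro h
    apply h4
    field_simp at h
    linear_combination -h
  have hleg : legLaurent μ = confLaurent μ 0 := by simp [legLaurent, confLaurent]
  have hsheaf : P.sheafChar = algebraMap Laurent RatChar (confLaurent μ n) / (1 - t₃) := by
    rw [← hn]
    simp only [map_mul, map_add, map_sub, map_one]
    rw [FixedPair.sheafChar, legChar, ← t₃]
    field_simp
  have hbar : bar P.sheafChar = -t₃ * algebraMap Laurent RatChar (barLaurent (confLaurent μ n))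
      / (1 - t₃) := by
    rw [hsheaf, map_div₀, map_sub, map_one, hb, bar_algebraMap]
    rw [div_eq_div_iff h5 h4]
    field_simp
    ring
  have key := edgeSum_rl_sub_mul (a := a) μ 0 n
  rw [← edgeOp_confLaurent, ← edgeOp_confLaurent] at key
  have key2 := congrArg (algebraMap Laurent RatChar) key
  rw [map_mul, map_sub _ 1, map_one, ← t₃, ← eq_div_iff h4] at key2
  rw [key2, map_sub]
  simp only [edgeOp, map_mul, map_sub, map_one, map_add, map_neg, e2]
  rw [FixedPair.vertexChar, FixedPair.tangentChar, hbar, hsheaf, edgeChar, legChar,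
    bar_algebraMap, hleg, ← t₁, ← t₂]
  generalize algebraMap Laurent RatChar (barLaurent (confLaurent μ 0)) = fb
  generalize algebraMap Laurent RatChar (confLaurent μ 0) = f
  generalize algebraMap Laurent RatChar (barLaurent (confLaurent μ n)) = qb
  generalize algebraMap Laurent RatChar (confLaurent μ n) = q
  field_simp
  ring

end Config

end Euler

/-! ### The Euler class as a product over pairs of cells -/

section PairProd
variable {a : ℕ}

variable (a) in
/-- The product of a function `H` of the weights, with multiplicities, over the weights of
`edgeSum`, written in terms of the contents `C`, the shifted fillings `X` and the columns `J` of
the cells. -/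
def pairProd {ι : Type*} (H : ℤ → ℤ → ℤ → Coeff₃) (S : Finset ι) (C X J : ι → ℤ) : Coeff₃ :=
  (∏ r ∈ S, ((H (C r) (X r) (J r))⁻¹ * (H (-C r) (-X r - a) (-J r - 1))⁻¹))
  * ∏ r ∈ S, ∏ r' ∈ S, (H (C r - C r') (X r - X r' - a) (J r - J r' - 1)
    * (H (C r - C r' + 1) (X r - X r' - a) (J r - J r' - 1))⁻¹
    * (H (C r - C r' - 1) (X r - X r') (J r - J r'))⁻¹
    * H (C r - C r') (X r - X r') (J r - J r'))

theorem pairProd_mul {ι : Type*} (H H' : ℤ → ℤ → ℤ → Coeff₃) (S : Finset ι) (C X J : ι → ℤ) :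
    pairProd a (fun δ k m => H δ k m * H' δ k m) S C X J
      = pairProd a H S C X J * pairProd a H' S C X J := by
  unfold pairProd
  rw [mul_mul_mul_comm]
  congr 1
  · rw [← prod_mul_distrib]
    refine prod_congr rfl fun r _ => ?_
    simp only [mul_inv]
    ring
  · rw [← prod_mul_distrib]
    refine prod_congr rfl fun r _ => ?_
    rw [← prod_mul_distrib]
    refine prod_congr rfl fun r' _ => ?_
    simp only [mul_inv]
    ring

theorem pairProd_image {ι κ : Type*} [DecidableEq κ] (H : ℤ → ℤ → ℤ → Coeff₃) (S : Finset ι)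
    (φ : ι → κ) (hφ : Set.InjOn φ S) (C X J : κ → ℤ) :
    pairProd a H (S.image φ) C X J
      = pairProd a H S (fun r => C (φ r)) (fun r => X (φ r)) (fun r => J (φ r)) := by
  unfold pairProd
  rw [prod_image hφ, prod_image hφ]
  congr 1
  refine prod_congr rfl fun r _ => ?_
  rw [prod_image hφ]

/-- The Euler class of the edge term of a reverse plane partition, as a product over pairs of
cells. -/
theorem eul_edgeSum {μ : YoungDiagram} {n : ℕ × ℕ → ℤ} (h0 : ∀ c ∈ μ.cells, 0 ≤ n c)
    (hn : ∀ c ∈ μ.cells, ∀ c' ∈ μ.cells, c' ≤ c → n c' ≤ n c) :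
    eul (edgeSum μ n (rl a)) = pairProd a (fun δ k m => hEps a δ k m * hUnit a δ k m) μ.cells
      (fun c => c.1 - c.2) (fun c => a * c.2 - n c) (fun c => c.2) := by
  rw [edgeSum, eul_add, eul_sum, eul_sum, pairProd]
  congr 1
  · refine prod_congr rfl fun c hc => ?_
    rw [eul_sub, eul_neg, eul_rl fun _ _ => by linarith [h0 c hc], eul_rl fun h => by omega]
    congr 3 <;> congr 1 <;> ring
  · refine prod_congr rfl fun c hc => ?_
    rw [eul_sum]
    refine prod_congr rfl fun c' hc' => ?_
    have key : ∀ u v : ℤ, 0 ≤ u → 0 ≤ v →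
        ((c.1 : ℤ) - c'.1 - u = 0 → (c.2 : ℤ) - c'.2 - v = 0 → n c' - n c ≤ 0) := by
      intro u v hu hv h1 h2
      have : c' ≤ c := ⟨by zify; linarith, by zify; linarith⟩
      linarith [hn c hc c' hc' this]
    have k00 := key 0 0 le_rfl le_rfl
    have k01 := key 0 1 le_rfl zero_le_one
    have k10 := key 1 0 zero_le_one le_rfl
    have k11 := key 1 1 zero_le_one zero_le_one
    simp only [sub_zero] at k00 k01 k10
    rw [eul_add, eul_sub, eul_sub, eul_rl k00, eul_rl k01, eul_rl k10, eul_rl k11]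
    congr 1
    · congr 1
      · congr 1
        · congr 2 <;> ring
        · congr 3 <;> ring
      · congr 3 <;> ring
    · congr 2 <;> ring

theorem isEpsPoly_hUnit (ha : 0 < a) {Λ : Type*} (δ k : ℤ) {m : (Λ → ℤ) → ℤ}
    (hm : IsAffine a m) : IsEpsPoly a fun e => hUnit a δ k (m e) := by
  refine (IsEpsPoly.prod _ fun g _ => isEpsPoly_lin δ g hm).mul (IsEpsPoly.prod _ fun g _ => ?_)
  by_cases h : δ = 0 ∧ g = 0
  · simpa only [if_pos h] using IsEpsPoly.one
  · simp only [if_neg h]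
    exact isEpsPoly_inv_lin ha (by tauto) hm

theorem isEpsPoly_inv_hUnit (ha : 0 < a) {Λ : Type*} (δ k : ℤ) {m : (Λ → ℤ) → ℤ}
    (hm : IsAffine a m) : IsEpsPoly a fun e => (hUnit a δ k (m e))⁻¹ := by
  unfold hUnit
  simp only [mul_inv, ← prod_inv_distrib]
  refine (IsEpsPoly.prod _ fun g hg => ?_).mul (IsEpsPoly.prod _ fun g _ => ?_)
  · simp only [mem_Ico] at hg
    exact isEpsPoly_inv_lin ha (Or.inr (by omega)) hm
  · by_cases h : δ = 0 ∧ g = 0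
    · simpa only [if_pos h, inv_one] using IsEpsPoly.one
    · simp only [if_neg h, inv_inv]
      exact isEpsPoly_lin δ g hm

theorem isEpsPoly_pairProd_hUnit (ha : 0 < a) {Λ ι : Type*} (S : Finset ι) (C X : ι → ℤ)
    {J : ι → (Λ → ℤ) → ℤ} (hJ : ∀ r, IsAffine a (J r)) :
    IsEpsPoly a fun e => pairProd a (hUnit a) S C X (fun r => J r e) := by
  have h1 : ∀ r r', IsAffine a fun e => J r e - J r' e := fun r r' => (hJ r).sub (hJ r')
  have h2 : ∀ r r', IsAffine a fun e => J r e - J r' e - 1 := fun r r' =>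
    (h1 r r').sub (IsAffine.const 1)
  have h3 : ∀ r, IsAffine a fun e => -J r e - 1 := fun r => (hJ r).neg.sub (IsAffine.const 1)
  refine (IsEpsPoly.prod _ fun r _ => ?_).mul
    (IsEpsPoly.prod _ fun r _ => IsEpsPoly.prod _ fun r' _ => ?_)
  · exact (isEpsPoly_inv_hUnit ha _ _ (hJ r)).mul (isEpsPoly_inv_hUnit ha _ _ (h3 r))
  · exact (((isEpsPoly_hUnit ha _ _ (h2 r r')).mul (isEpsPoly_inv_hUnit ha _ _ (h2 r r'))).mul
      (isEpsPoly_inv_hUnit ha _ _ (h1 r r'))).mul (isEpsPoly_hUnit ha _ _ (h1 r r'))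

end PairProd

/-! ### From cells to labels -/

namespace Lab
variable {μ : YoungDiagram}

/-- The labels without the second copy of the main diagonal; they correspond to the cells. -/
def main (μ : YoungDiagram) : Finset (Lab μ) := univ.filter fun r => ¬ (r.side = false ∧ r.diag = 0)

theorem mem_main {r : Lab μ} : r ∈ main μ ↔ ¬ (r.side = false ∧ r.diag = 0) := by simp [main]

/-- The content of the cell of a label. -/
def cont (r : Lab μ) : ℤ := if r.side then r.diag else -r.diag

/-- The difference between the column of the cell and the position of a label. -/
def off (r : Lab μ) : ℤ := if r.side then 0 else r.diag

theorem cell_fst_sub (r : Lab μ) : (r.cell.1 : ℤ) - r.cell.2 = r.cont := by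
  unfold cell cellOf cont
  cases r.side <;> simp

theorem cell_snd (r : Lab μ) : (r.cell.2 : ℤ) = r.pos + r.off := by
  unfold cell cellOf off
  cases r.side <;> simp

theorem cont_flip (r : Lab μ) : (flip r).cont = r.cont := by
  by_cases h : r.diag = 0
  · simp only [cont, flip_diag, h]; simp
  · rw [flip_of_diag_ne h]

theorem off_flip (r : Lab μ) : (flip r).off = r.off := by
  by_cases h : r.diag = 0
  · simp only [off, flip_diag, h]; simp
  · rw [flip_of_diag_ne h]

theorem cell_injOn_main : Set.InjOn (cell (μ := μ)) (main μ) := by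
  intro r hr r' hr' h
  have hr := mem_main.1 hr
  have hr' := mem_main.1 hr'
  have h1 : r.cell.1 = r'.cell.1 := by rw [h]
  have h2 : r.cell.2 = r'.cell.2 := by rw [h]
  simp only [cell, cellOf] at h1 h2
  cases h3 : r.side <;> cases h4 : r'.side <;> simp only [h3, h4] at hr hr' h1 h2 <;>
    simp at h1 h2 hr hr'
  · exact ext' (by rw [h3, h4]) (by omega) (by omega)
  · omega
  · omega
  · exact ext' (by rw [h3, h4]) (by omega) (by omega)

theorem image_cell_main : (main μ).image cell = μ.cells := by
  ext ⟨i, j⟩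
  simp only [mem_image, mem_main]
  constructor
  · rintro ⟨r, -, h⟩
    rw [← h]; exact r.2
  · intro h
    rcases le_or_gt j i with h1 | h1
    · exact ⟨⟨(true, i - j, j), by simpa [cellOf, h1] using h⟩, by simp, by
        simp only [cell, cellOf, side, diag, pos, if_true]
        rw [Nat.add_sub_cancel' h1]⟩
    · exact ⟨⟨(false, j - i, i), by simpa [cellOf, h1.le] using h⟩, by
        simp only [side, diag]; omega, by
        simp only [cell, cellOf, side, diag, pos, Bool.false_eq_true, if_false]
        rw [Nat.add_sub_cancel' h1.le]⟩

/-- A product over the labels of a given content, transported to the labels of a given diagonal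
on a given side. -/
theorem prod_main_eq {M : Type*} [CommMonoid M] (σ : Bool) (d : ℕ) (F G : Lab μ → M)
    (hflip : ∀ r, F (flip r) = F r)
    (hF : ∀ r, r.cont ≠ (if σ then (d : ℤ) else -d) → F r = 1)
    (hG : ∀ r, ¬ (r.side = σ ∧ r.diag = d) → G r = 1)
    (hFG : ∀ r, r.side = σ → r.diag = d → F r = G r) :
    ∏ r ∈ main μ, F r = ∏ r, G r := by
  have h1 : ∀ r ∈ main μ, ¬ (r.diag = d ∧ (r.side = σ ∨ d = 0)) → F r = 1 := by
    intro r _ h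
    refine hF r fun hc => h ?_
    unfold cont at hc
    cases h2 : r.side <;> cases σ <;> simp [h2] at hc ⊢ <;> omega
  by_cases hd : σ = false ∧ d = 0
  · obtain ⟨rfl, rfl⟩ := hd
    rw [← Equiv.prod_comp flip G, main, prod_filter]
    refine prod_congr rfl fun r _ => ?_
    by_cases h2 : r.diag = 0
    · cases h3 : r.side with
      | false =>
        rw [if_neg (by simp [h2]), hG]
        rw [flip_side h2, h3]; simp
      | true =>
        rw [if_pos (by simp), ← hflip, hFG]
        · rw [flip_side h2, h3]; rfl
        · rw [flip_diag, h2]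
    · rw [hG _ (by rw [flip_diag]; tauto)]
      split_ifs with h4
      · rfl
      · exact h1 r (mem_main.2 h4) (by tauto)
  · rw [main, prod_filter]
    refine prod_congr rfl fun r _ => ?_
    by_cases h2 : r.side = σ ∧ r.diag = d
    · rw [if_pos, hFG r h2.1 h2.2]
      rintro ⟨h3, h4⟩
      exact hd ⟨h2.1.symm.trans h3, h2.2.symm.trans h4⟩
    · rw [hG r h2]
      split_ifs with h4
      · rfl
      · refine h1 r (mem_main.2 h4) fun h5 => h2 ⟨?_, h5.1⟩
        rcases h5.2 with h6 | h6
        · exact h6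
        · have h7 : r.side = true := by
            by_contra h8
            exact h4 ⟨by simpa using h8, h5.1.trans h6⟩
          have h8 : σ = true := by
            by_contra h9
            exact hd ⟨by simpa using h9, h6⟩
          rw [h7, h8]

/-- A product over all labels as a product over the cells, the factors of the two copies of a cell
of the main diagonal being put together. -/
theorem prod_eq_prod_main {M : Type*} [CommMonoid M] (G : Lab μ → M) :
    ∏ r, G r = ∏ r ∈ main μ, (G r * if r.diag = 0 then G (flip r) else 1) := by
  rw [prod_mul_distrib]
  have h1 : ∏ r ∈ main μ, (if r.diag = 0 then G (flip r) else 1)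
      = ∏ r ∈ univ.filter (fun r : Lab μ => r.side = false ∧ r.diag = 0), G r := by
    rw [main, prod_filter, prod_filter, ← Equiv.prod_comp flip fun r =>
      if r.side = false ∧ r.diag = 0 then G r else 1]
    refine prod_congr rfl fun r _ => ?_
    by_cases h : r.diag = 0
    · cases h3 : r.side <;> simp [h, flip_side h, h3]
    · simp [h]
  rw [h1, mul_comm, main, prod_filter_mul_prod_filter_not]

end Lab

/-! ### The singular part of the Euler class -/

section ValF
variable {μ : YoungDiagram} {a : ℕ} {x : Lab μ → ℤ}

theorem inv_hEps (δ k m : ℤ) : (hEps a δ k m)⁻¹ = if δ = 0 ∧ 0 < k then m * eps a else 1 := by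
  unfold hEps
  split_ifs <;> simp

variable (a) in
/-- The positions, multiplied by `ε`. -/
def epsPos (r : Lab μ) : Coeff₃ := r.pos * eps a

theorem epsPos_flip (r : Lab μ) : epsPos a (Lab.flip r) = epsPos a r := by
  simp [epsPos]

variable (a x) in
/-- The shifted filling; this is `a j - n (i, j)` at the cell `(i, j)`. -/
def shiftX (r : Lab μ) : ℤ := x r + a * r.off

/-- The column of the cell of a label, if `e` is the position of the label. -/
def shiftJ (e : Lab μ → ℤ) (r : Lab μ) : ℤ := e r + r.off

variable (μ) in
/-- The positions of the labels, as integers. -/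
def posZ (r : Lab μ) : ℤ := r.pos

theorem Valid.shiftX_flip (h : Valid a x) (r : Lab μ) : shiftX a x (Lab.flip r) = shiftX a x r := by
  rw [shiftX, shiftX, h.compat, Lab.off_flip]

theorem shiftJ_flip (r : Lab μ) : shiftJ (posZ μ) (Lab.flip r) = shiftJ (posZ μ) r := by
  simp [shiftJ, posZ, Lab.off_flip]

section
variable (a x)
/-- The factors of `facT` for the label `r'`. -/
def pT (r' : Lab μ) : Coeff₃ := ∏ r : Lab μ,
  if (r.side = r'.side ∧ r.diag = r'.diag + 1) ∧ x r' < x r then epsPos a r - epsPos a r' else 1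
/-- The factors of the numerators in `valF` for the label `r'` outside the main diagonal. -/
def pE (r' : Lab μ) : Coeff₃ := ∏ r : Lab μ,
  if (r.side = r'.side ∧ r.diag + 1 = r'.diag) ∧ x r' + a < x r then
    epsPos a r - epsPos a r' - eps a else 1
/-- The factors of the denominators in `valF` for the label `r'` outside the main diagonal. -/
def pM (r' : Lab μ) : Coeff₃ := ∏ r : Lab μ,
  if (r.side = r'.side ∧ r.diag = r'.diag) ∧ x r' + a < x r then
    epsPos a r - epsPos a r' - eps a else 1
/-- The factors of `denF` for the label `r'`. -/
def pD (r' : Lab μ) : Coeff₃ := ∏ r : Lab μ,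
  if (r.side = r'.side ∧ r.diag = r'.diag) ∧ x r' < x r then epsPos a r - epsPos a r' else 1
end

theorem pD_ne_zero (r' : Lab μ) : pD a x r' ≠ 0 := by
  rw [pD, Ne, prod_ite_eq_zero_iff]
  rintro ⟨r, ⟨⟨h1, h2⟩, h3⟩, h4⟩
  rw [epsPos, epsPos, ← sub_mul, mul_eq_zero, or_iff_left eps_ne_zero, sub_eq_zero] at h4
  rw [Lab.ext' h1 h2 (by exact_mod_cast h4)] at h3
  exact lt_irrefl _ h3

theorem cont_eq_iff (r r' : Lab μ) : r.cont = (if r'.side then (r'.diag : ℤ) else -r'.diag)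
    ↔ r.cont - r'.cont = 0 := by
  rw [sub_eq_zero]; rfl

variable (h : Valid a x)
include h

theorem prod_hEps_eq_pE_of_true {r' : Lab μ} (hs : r'.side = true) (hd : 1 ≤ r'.diag) :
    ∏ r ∈ Lab.main μ, (hEps a (r.cont - r'.cont + 1) (shiftX a x r - shiftX a x r' - a)
      (shiftJ (posZ μ) r - shiftJ (posZ μ) r' - 1))⁻¹ = pE a x r' := by
  refine Lab.prod_main_eq true (r'.diag - 1) _ _ ?_ ?_ ?_ ?_
  · intro r
    rw [Lab.cont_flip, h.shiftX_flip, shiftJ_flip]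
  · intro r hr
    rw [inv_hEps, if_neg]
    rintro ⟨h1, -⟩
    apply hr
    simp only [Lab.cont, hs, if_true] at h1 ⊢
    omega
  · intro r hr
    rw [if_neg]
    rintro ⟨⟨h1, h2⟩, -⟩
    exact hr ⟨h1.trans hs, by omega⟩
  · intro r h1 h2
    rw [inv_hEps]
    have e1 : r.cont - r'.cont + 1 = 0 := by simp only [Lab.cont, hs, h1, if_true]; omega
    have e2 : 0 < shiftX a x r - shiftX a x r' - a ↔ x r' + a < x r := by
      simp only [shiftX, Lab.off, hs, h1, if_true]; omega
    simp only [e1, e2, true_and, hs, h1, (by omega : r.diag + 1 = r'.diag)]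
    congr 1
    simp only [shiftJ, posZ, Lab.off, hs, h1, if_true, epsPos]
    push_cast; ring

theorem prod_hEps_eq_pT_of_true {r' : Lab μ} (hs : r'.side = true) :
    ∏ r ∈ Lab.main μ, (hEps a (r.cont - r'.cont - 1) (shiftX a x r - shiftX a x r')
      (shiftJ (posZ μ) r - shiftJ (posZ μ) r'))⁻¹ = pT a x r' := by
  refine Lab.prod_main_eq true (r'.diag + 1) _ _ ?_ ?_ ?_ ?_
  · intro r
    rw [Lab.cont_flip, h.shiftX_flip, shiftJ_flip]
  · intro r hr
    rw [inv_hEps, if_neg]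
    rintro ⟨h1, -⟩
    apply hr
    simp only [Lab.cont, hs, if_true] at h1 ⊢
    push_cast
    omega
  · intro r hr
    rw [if_neg]
    rintro ⟨⟨h1, h2⟩, -⟩
    exact hr ⟨h1.trans hs, by omega⟩
  · intro r h1 h2
    rw [inv_hEps]
    have e1 : r.cont - r'.cont - 1 = 0 := by simp only [Lab.cont, hs, h1, if_true]; omega
    have e2 : 0 < shiftX a x r - shiftX a x r' ↔ x r' < x r := by
      simp only [shiftX, Lab.off, hs, h1, if_true]; omega
    simp only [e1, e2, true_and, hs, h1, h2]
    congr 1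
    simp only [shiftJ, posZ, Lab.off, hs, h1, if_true, epsPos]
    push_cast; ring

theorem prod_hEps_eq_pT_of_false {r' : Lab μ} (hs : r'.side = false) :
    ∏ r ∈ Lab.main μ, (hEps a (r.cont - r'.cont + 1) (shiftX a x r - shiftX a x r' - a)
      (shiftJ (posZ μ) r - shiftJ (posZ μ) r' - 1))⁻¹ = pT a x r' := by
  refine Lab.prod_main_eq false (r'.diag + 1) _ _ ?_ ?_ ?_ ?_
  · intro r
    rw [Lab.cont_flip, h.shiftX_flip, shiftJ_flip]
  · intro r hr
    rw [inv_hEps, if_neg]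
    rintro ⟨h1, -⟩
    apply hr
    simp only [Lab.cont, hs, Bool.false_eq_true, if_false] at h1 ⊢
    push_cast
    omega
  · intro r hr
    rw [if_neg]
    rintro ⟨⟨h1, h2⟩, -⟩
    exact hr ⟨h1.trans hs, by omega⟩
  · intro r h1 h2
    rw [inv_hEps]
    have e1 : r.cont - r'.cont + 1 = 0 := by
      simp only [Lab.cont, hs, h1, Bool.false_eq_true, if_false]; omega
    have e2 : 0 < shiftX a x r - shiftX a x r' - a ↔ x r' < x r := by
      simp only [shiftX, Lab.off, hs, h1, Bool.false_eq_true, if_false, h2]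
      push_cast
      rw [mul_add]
      omega
    simp only [e1, e2, true_and, hs, h1, h2]
    congr 1
    simp only [shiftJ, posZ, Lab.off, hs, h1, Bool.false_eq_true, if_false, epsPos, h2]
    push_cast; ring

theorem prod_hEps_eq_pE_of_false {r' : Lab μ} (hs : r'.side = false) (hd : 1 ≤ r'.diag) :
    ∏ r ∈ Lab.main μ, (hEps a (r.cont - r'.cont - 1) (shiftX a x r - shiftX a x r')
      (shiftJ (posZ μ) r - shiftJ (posZ μ) r'))⁻¹ = pE a x r' := by
  refine Lab.prod_main_eq false (r'.diag - 1) _ _ ?_ ?_ ?_ ?_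
  · intro r
    rw [Lab.cont_flip, h.shiftX_flip, shiftJ_flip]
  · intro r hr
    rw [inv_hEps, if_neg]
    rintro ⟨h1, -⟩
    apply hr
    simp only [Lab.cont, hs, Bool.false_eq_true, if_false] at h1 ⊢
    omega
  · intro r hr
    rw [if_neg]
    rintro ⟨⟨h1, h2⟩, -⟩
    exact hr ⟨h1.trans hs, by omega⟩
  · intro r h1 h2
    rw [inv_hEps]
    have h3 : (r'.diag : ℤ) = r.diag + 1 := by omega
    have e1 : r.cont - r'.cont - 1 = 0 := by
      simp only [Lab.cont, hs, h1, Bool.false_eq_true, if_false]; omega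
    have e2 : 0 < shiftX a x r - shiftX a x r' ↔ x r' + a < x r := by
      simp only [shiftX, Lab.off, hs, h1, Bool.false_eq_true, if_false, h3]
      rw [mul_add]
      omega
    simp only [e1, e2, true_and, hs, h1, (by omega : r.diag + 1 = r'.diag)]
    congr 1
    simp only [shiftJ, posZ, Lab.off, hs, h1, Bool.false_eq_true, if_false, epsPos, h3]
    push_cast; ring

theorem prod_hEps_eq_pM (r' : Lab μ) :
    ∏ r ∈ Lab.main μ, hEps a (r.cont - r'.cont) (shiftX a x r - shiftX a x r' - a)
      (shiftJ (posZ μ) r - shiftJ (posZ μ) r' - 1) = (pM a x r')⁻¹ := by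
  rw [← inv_inj, inv_inv, ← prod_inv_distrib]
  refine Lab.prod_main_eq r'.side r'.diag _ _ ?_ ?_ ?_ ?_
  · intro r
    rw [Lab.cont_flip, h.shiftX_flip, shiftJ_flip]
  · intro r hr
    rw [inv_hEps, if_neg]
    rintro ⟨h1, -⟩
    exact hr ((cont_eq_iff r r').2 h1)
  · intro r hr
    rw [if_neg]
    rintro ⟨h1, -⟩
    exact hr h1
  · intro r h1 h2
    rw [inv_hEps]
    have e1 : r.cont - r'.cont = 0 := by simp only [Lab.cont, h1, h2, sub_self]
    have e3 : r.off = r'.off := by simp only [Lab.off, h1, h2]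
    have e2 : 0 < shiftX a x r - shiftX a x r' - a ↔ x r' + a < x r := by
      simp only [shiftX, e3]; omega
    simp only [e1, e2, true_and, h1, h2]
    congr 1
    simp only [shiftJ, posZ, e3, epsPos]
    push_cast; ring

theorem prod_hEps_eq_pD (r' : Lab μ) :
    ∏ r ∈ Lab.main μ, hEps a (r.cont - r'.cont) (shiftX a x r - shiftX a x r')
      (shiftJ (posZ μ) r - shiftJ (posZ μ) r') = (pD a x r')⁻¹ := by
  rw [← inv_inj, inv_inv, ← prod_inv_distrib]
  refine Lab.prod_main_eq r'.side r'.diag _ _ ?_ ?_ ?_ ?_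
  · intro r
    rw [Lab.cont_flip, h.shiftX_flip, shiftJ_flip]
  · intro r hr
    rw [inv_hEps, if_neg]
    rintro ⟨h1, -⟩
    exact hr ((cont_eq_iff r r').2 h1)
  · intro r hr
    rw [if_neg]
    rintro ⟨h1, -⟩
    exact hr h1
  · intro r h1 h2
    rw [inv_hEps]
    have e1 : r.cont - r'.cont = 0 := by simp only [Lab.cont, h1, h2, sub_self]
    have e3 : r.off = r'.off := by simp only [Lab.off, h1, h2]
    have e2 : 0 < shiftX a x r - shiftX a x r' ↔ x r' < x r := by
      simp only [shiftX, e3]; omega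
    simp only [e1, e2, true_and, h1, h2]
    congr 1
    simp only [shiftJ, posZ, e3, epsPos]
    push_cast; ring

theorem prod_flip_diag_zero (q : ℤ) (c : Coeff₃) :
    (∏ r : Lab μ, if (r.side = false ∧ r.diag = 0) ∧ q < x r then epsPos a r - c else 1)
      = ∏ r : Lab μ, if (r.side = true ∧ r.diag = 0) ∧ q < x r then epsPos a r - c else 1 := by
  rw [← Equiv.prod_comp Lab.flip]
  refine prod_congr rfl fun r _ => ?_
  by_cases h1 : r.diag = 0
  · rw [Lab.flip_diag, Lab.flip_side h1, h.compat, epsPos_flip]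
    simp
  · rw [Lab.flip_diag]
    simp [h1]

/-- For the filling of a reverse plane partition, the singular part of the Euler class is given by
the formula `valF`. -/
theorem Valid.pairProd_hEps : pairProd a (hEps a) (Lab.main μ) Lab.cont (shiftX a x)
    (shiftJ (posZ μ)) = valF a x (epsPos a) (eps a) := by
  have hval : valF a x (epsPos a) (eps a) = ∏ r' : Lab μ,
      ((if (r'.side = true ∧ r'.diag = 0) ∧ 0 < x r' then epsPos a r' - 0 else 1)
        * pT a x r' * (if 1 ≤ r'.diag then pE a x r' / pM a x r' else 1)
        * (if r'.side = false ∧ r'.diag = 0 then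
      ((∏ r : Lab μ, if (r.side = true ∧ r.diag = 0) ∧ x r' < x r then
          epsPos a r - epsPos a r' else 1)
        * (if x r' < -(a : ℤ) then -eps a - epsPos a r' else 1))
      / (∏ r : Lab μ, if (r.side = true ∧ r.diag = 0) ∧ x r' + a < x r then
        epsPos a r - epsPos a r' - eps a else 1) else 1)
      / pD a x r') := by
    rw [prod_div_distrib, prod_mul_distrib, prod_mul_distrib, prod_mul_distrib]
    rfl
  rw [hval, Lab.prod_eq_prod_main, pairProd, prod_comm (s := Lab.main μ) (t := Lab.main μ),
    ← prod_mul_distrib]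
  refine prod_congr rfl fun r' hr' => ?_
  rw [prod_mul_distrib, prod_mul_distrib, prod_mul_distrib, prod_hEps_eq_pM h, prod_hEps_eq_pD h]
  by_cases hd : r'.diag = 0
  · have hs : r'.side = true := by
      by_contra hs
      exact Lab.mem_main.1 hr' ⟨by simpa using hs, hd⟩
    have hfs : (Lab.flip r').side = false := by rw [Lab.flip_side hd, hs]; rfl
    have hfd : (Lab.flip r').diag = 0 := by rw [Lab.flip_diag, hd]
    have hK5 := prod_hEps_eq_pT_of_false h hfs
    rw [Lab.cont_flip, h.shiftX_flip, shiftJ_flip] at hK5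
    rw [hK5, prod_hEps_eq_pT_of_true h hs, inv_hEps, inv_hEps]
    have hD1 : pD a x (Lab.flip r') = pD a x r' := by
      simp only [pD, hfs, hfd, hs, hd, h.compat, epsPos_flip]
      exact prod_flip_diag_zero h _ _
    have hD2 : (∏ r : Lab μ, if (r.side = true ∧ r.diag = 0) ∧ x r' < x r then
          epsPos a r - epsPos a r' else 1) = pD a x r' := by
      simp only [pD, hs, hd]
    have hM2 : (∏ r : Lab μ, if (r.side = true ∧ r.diag = 0) ∧ x r' + a < x r then
          epsPos a r - epsPos a r' - eps a else 1) = pM a x r' := by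
      simp only [pM, hs, hd]
    have hD0 := pD_ne_zero (a := a) (x := x) r'
    simp only [h.compat, epsPos_flip, hfs, hfd, hs, hd, hD1, hD2, hM2, if_true, true_and, and_self,
      Bool.false_eq_true, false_and, if_false, (by decide : ¬ (1 ≤ 0)),
      Bool.true_eq_false]
    have e1 : r'.cont = 0 := by simp [Lab.cont, hd]
    have e2 : r'.off = 0 := by simp [Lab.off, hs]
    have e3 : shiftX a x r' = x r' := by simp [shiftX, e2]
    have e4 : shiftJ (posZ μ) r' = r'.pos := by simp [shiftJ, posZ, e2]
    have e5 : 0 < -x r' - a ↔ x r' < -(a : ℤ) := by omega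
    have e6 : (((-(r'.pos : ℤ) - 1 : ℤ)) : Coeff₃) * eps a = -eps a - epsPos a r' := by
      simp only [epsPos]; push_cast; ring
    have e7 : ((r'.pos : ℤ) : Coeff₃) * eps a = epsPos a r' := by simp [epsPos]
    rw [e1, e3, e4, neg_zero, e6, e7]
    simp only [e5, true_and, sub_zero]
    field_simp
  · have hd' : 1 ≤ r'.diag := by omega
    have e1 : r'.cont ≠ 0 := by
      unfold Lab.cont
      split_ifs <;> omega
    rw [inv_hEps, inv_hEps, if_neg (by tauto), if_neg (by rw [neg_eq_zero]; tauto)]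
    simp only [hd, and_false, false_and, if_false, hd', if_true]
    cases hs : r'.side with
    | true =>
      rw [prod_hEps_eq_pE_of_true h hs hd', prod_hEps_eq_pT_of_true h hs]
      field_simp
    | false =>
      rw [prod_hEps_eq_pT_of_false h hs, prod_hEps_eq_pE_of_false h hs hd']
      field_simp

end ValF

/-! ### Homogeneity -/

section Scale
variable {μ : YoungDiagram} {a : ℕ} {x : Lab μ → ℤ}

theorem prod_ite_scale {ι : Type*} (S : Finset ι) (P : ι → Prop) [DecidablePred P]
    {g : ι → Coeff₃} {f : ι → ℚ} {n : ι → ℤ}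
    (h : ∀ i, P i → g i = eps a ^ n i * algebraMap ℚ Coeff₃ (f i)) :
    ∏ i ∈ S, (if P i then g i else 1)
      = eps a ^ (∑ i ∈ S, if P i then n i else 0)
        * algebraMap ℚ Coeff₃ (∏ i ∈ S, if P i then f i else 1) := by
  classical
  induction S using Finset.induction_on with
  | empty => simp
  | insert i S hi ih =>
    rw [prod_insert hi, prod_insert hi, sum_insert hi, ih, zpow_add₀ eps_ne_zero, map_mul]
    by_cases hP : P i
    · simp only [if_pos hP, h i hP]; ring
    · simp only [if_neg hP]; simp

theorem prod_scale {ι : Type*} (S : Finset ι)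
    {g : ι → Coeff₃} {f : ι → ℚ} {n : ι → ℤ}
    (h : ∀ i, g i = eps a ^ n i * algebraMap ℚ Coeff₃ (f i)) :
    ∏ i ∈ S, g i = eps a ^ (∑ i ∈ S, n i) * algebraMap ℚ Coeff₃ (∏ i ∈ S, f i) := by
  simpa using prod_ite_scale (a := a) S (fun _ => True) (fun i _ => h i)

theorem scale_div {y z : Coeff₃} {p q : ℚ} {m n : ℤ}
    (hy : y = eps a ^ m * algebraMap ℚ Coeff₃ p) (hz : z = eps a ^ n * algebraMap ℚ Coeff₃ q) :
    y / z = eps a ^ (m - n) * algebraMap ℚ Coeff₃ (p / q) := by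
  rw [hy, hz, zpow_sub₀ eps_ne_zero, map_div₀, mul_div_mul_comm]

theorem scale_mul {y z : Coeff₃} {p q : ℚ} {m n : ℤ}
    (hy : y = eps a ^ m * algebraMap ℚ Coeff₃ p) (hz : z = eps a ^ n * algebraMap ℚ Coeff₃ q) :
    y * z = eps a ^ (m + n) * algebraMap ℚ Coeff₃ (p * q) := by
  rw [hy, hz, zpow_add₀ eps_ne_zero, map_mul]; ring

theorem epsPos_sub (r r' : Lab μ) :
    epsPos a r - epsPos a r' = eps a ^ (1 : ℤ) * algebraMap ℚ Coeff₃ (posQ r - posQ r') := by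
  simp only [epsPos, posQ, zpow_one, map_sub, map_natCast]; ring

theorem epsPos_sub_sub (r r' : Lab μ) : epsPos a r - epsPos a r' - eps a
    = eps a ^ (1 : ℤ) * algebraMap ℚ Coeff₃ (posQ r - posQ r' - 1) := by
  simp only [epsPos, posQ, zpow_one, map_sub, map_natCast, map_one]; ring

theorem denF_epsPos : denF x (epsPos a)
    = eps a ^ degDen x * algebraMap ℚ Coeff₃ (denF x posQ) :=
  prod_scale _ fun r' => prod_ite_scale _ _ fun r _ => epsPos_sub r r'

theorem valF_epsPos : valF a x (epsPos a) (eps a)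
    = eps a ^ (degF a x - degDen x) * algebraMap ℚ Coeff₃ (valF a x posQ 1) := by
  refine scale_div (scale_mul (scale_mul (scale_mul ?_ ?_) ?_) ?_) denF_epsPos
  · refine prod_ite_scale _ _ fun r _ => ?_
    simp only [epsPos, posQ, zpow_one, map_sub, map_natCast, map_zero]; ring
  · exact prod_scale _ fun r' => prod_ite_scale _ _ fun r _ => epsPos_sub r r'
  · refine prod_ite_scale _ _ fun r' _ => scale_div ?_ ?_
    · exact prod_ite_scale _ _ fun r _ => epsPos_sub_sub r r'
    · exact prod_ite_scale _ _ fun r _ => epsPos_sub_sub r r'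
  · refine prod_ite_scale _ _ fun r' _ => scale_div (scale_mul ?_ ?_) ?_
    · exact prod_ite_scale _ _ fun r _ => epsPos_sub r r'
    · split_ifs
      · simp only [epsPos, posQ, zpow_one, map_sub, map_natCast, map_neg, map_one]; ring
      · simp
    · exact prod_ite_scale _ _ fun r _ => epsPos_sub_sub r r'

end Scale

/-! ### The order of the empty configuration -/

section Count
variable {μ : YoungDiagram} {a : ℕ}

/-- The number of labels with position less than `k` on a given diagonal. -/
def cntLt (μ : YoungDiagram) (σ : Bool) (d k : ℕ) : ℤ :=
  ∑ r' : Lab μ, if (r'.side = σ ∧ r'.diag = d) ∧ r'.pos < k then 1 else 0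

theorem cntLt_le (σ : Bool) (d k : ℕ) : cntLt μ σ d k ≤ k := by
  classical
  rw [cntLt, ← sum_filter, sum_const, nsmul_one]
  refine Int.ofNat_le.2 ?_
  refine (card_le_card_of_injOn (t := range k) Lab.pos ?_ ?_).trans_eq (card_range k)
  · intro r hr
    simpa using (mem_filter.1 hr).2.2
  · intro r hr r' hr' h
    have h1 := (mem_filter.1 hr).2.1
    have h2 := (mem_filter.1 hr').2.1
    exact Lab.ext' (h1.1.trans h2.1.symm) (h1.2.trans h2.2.symm) h

/-- All positions below that of a label are taken on its diagonal. -/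
theorem le_cntLt {r : Lab μ} {k : ℕ} (hk : k ≤ r.pos) : (k : ℤ) ≤ cntLt μ r.side r.diag k := by
  classical
  rw [cntLt, ← sum_filter, sum_const, nsmul_one]
  refine Int.ofNat_le.2 ?_
  refine (card_range k).symm.le.trans <| (card_le_card (t := (univ.filter fun r' : Lab μ =>
    (r'.side = r.side ∧ r'.diag = r.diag) ∧ r'.pos < k).image Lab.pos) ?_).trans card_image_le
  intro j hj
  obtain ⟨r', h1, h2, h3⟩ := r.exists_pos_of_le (k := j) (by have := mem_range.1 hj; omega)
  exact mem_image.2 ⟨r', mem_filter.2 ⟨mem_univ _, ⟨h1, h2⟩, by have := mem_range.1 hj; omega⟩, h3⟩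

/-- For the empty configuration, the numerator has at most the degree of the denominator. -/
theorem degF_sub_degDen_le (ha : 0 < a) :
    degF a (fun r : Lab μ => (a : ℤ) * r.pos) - degDen (fun r : Lab μ => (a : ℤ) * r.pos) ≤ 0 := by
  have ha' : (0 : ℤ) < a := by exact_mod_cast ha
  have h1 : ∀ r r' : Lab μ, (a : ℤ) * r'.pos < a * r.pos ↔ r'.pos < r.pos := by
    intro r r'
    rw [mul_lt_mul_iff_right₀ ha']; omega
  have h2 : ∀ r r' : Lab μ, (a : ℤ) * r'.pos + a < a * r.pos ↔ r'.pos < r.pos - 1 := by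
    intro r r'
    have : (a : ℤ) * r'.pos + a = a * (r'.pos + 1) := by ring
    rw [this, mul_lt_mul_iff_right₀ ha']; omega
  have h3 : ∀ r : Lab μ, (0 : ℤ) < a * r.pos ↔ 0 < r.pos := by
    intro r
    rw [mul_pos_iff_of_pos_left ha']; omega
  have h4 : ∀ r : Lab μ, ¬ ((a : ℤ) * r.pos < -(a : ℤ)) := by
    intro r
    have : (0 : ℤ) ≤ a * r.pos := by positivity
    omega
  unfold degF degDen
  simp only [h1, h2, h3, h4, if_false, add_zero]
  -- all double sums are organized by the label with the larger entry
  have hT : (∑ r' : Lab μ, ∑ r : Lab μ,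
      if (r.side = r'.side ∧ r.diag = r'.diag + 1) ∧ r'.pos < r.pos then (1 : ℤ) else 0)
      ≤ ∑ r : Lab μ, if 1 ≤ r.diag then (r.pos : ℤ) else 0 := by
    rw [sum_comm]
    refine sum_le_sum fun r _ => ?_
    split_ifs with hd
    · refine le_trans (le_of_eq ?_) (cntLt_le (μ := μ) r.side (r.diag - 1) r.pos)
      refine sum_congr rfl fun r' _ => if_congr ?_ rfl rfl
      constructor <;> rintro ⟨⟨h5, h6⟩, h7⟩ <;> exact ⟨⟨h5.symm, by omega⟩, h7⟩
    · refine le_of_eq (sum_eq_zero fun r' _ => if_neg ?_)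
      rintro ⟨⟨-, h5⟩, -⟩
      omega
  have hE : (∑ r' : Lab μ, if 1 ≤ r'.diag then (∑ r : Lab μ,
      if (r.side = r'.side ∧ r.diag + 1 = r'.diag) ∧ r'.pos < r.pos - 1 then (1 : ℤ) else 0) else 0)
      ≤ ∑ r : Lab μ, ((r.pos - 1 : ℕ) : ℤ) := by
    have : ∀ r' : Lab μ, (if 1 ≤ r'.diag then (∑ r : Lab μ,
      if (r.side = r'.side ∧ r.diag + 1 = r'.diag) ∧ r'.pos < r.pos - 1 then (1 : ℤ) else 0) else 0)
      = ∑ r : Lab μ,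
      if (r.side = r'.side ∧ r.diag + 1 = r'.diag) ∧ r'.pos < r.pos - 1 then (1 : ℤ) else 0 := by
      intro r'
      split_ifs with h5
      · rfl
      · refine (sum_eq_zero fun r _ => if_neg ?_).symm
        rintro ⟨⟨-, h6⟩, -⟩
        omega
    rw [sum_congr rfl fun r' _ => this r', sum_comm]
    refine sum_le_sum fun r _ => ?_
    refine le_trans (le_of_eq ?_) (cntLt_le (μ := μ) r.side (r.diag + 1) (r.pos - 1))
    refine sum_congr rfl fun r' _ => if_congr ?_ rfl rfl
    constructor <;> rintro ⟨⟨h5, h6⟩, h7⟩ <;> exact ⟨⟨h5.symm, by omega⟩, h7⟩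
  have hM : (∑ r : Lab μ, if 1 ≤ r.diag then ((r.pos - 1 : ℕ) : ℤ) else 0)
      ≤ ∑ r' : Lab μ, if 1 ≤ r'.diag then (∑ r : Lab μ,
      if (r.side = r'.side ∧ r.diag = r'.diag) ∧ r'.pos < r.pos - 1 then (1 : ℤ) else 0)
        else 0 := by
    have : ∀ r' : Lab μ, (if 1 ≤ r'.diag then (∑ r : Lab μ,
      if (r.side = r'.side ∧ r.diag = r'.diag) ∧ r'.pos < r.pos - 1 then (1 : ℤ) else 0) else 0)
      = ∑ r : Lab μ, if 1 ≤ r.diag then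
        (if (r'.side = r.side ∧ r'.diag = r.diag) ∧ r'.pos < r.pos - 1 then (1 : ℤ) else 0)
        else 0 := by
      intro r'
      split_ifs with h5
      · refine sum_congr rfl fun r _ => ?_
        rw [← ite_and]
        refine if_congr ?_ rfl rfl
        constructor
        · rintro ⟨⟨h6, h7⟩, h8⟩; exact ⟨by omega, ⟨h6.symm, h7.symm⟩, h8⟩
        · rintro ⟨-, ⟨h6, h7⟩, h8⟩; exact ⟨⟨h6.symm, h7.symm⟩, h8⟩
      · refine (sum_eq_zero fun r _ => ?_).symm
        rw [← ite_and]
        refine if_neg ?_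
        rintro ⟨h6, ⟨-, h7⟩, -⟩
        omega
    rw [sum_congr rfl fun r' _ => this r', sum_comm]
    refine sum_le_sum fun r _ => ?_
    split_ifs with h5
    · exact le_cntLt (Nat.sub_le _ _)
    · exact le_of_eq (by simp)
  have hD : (∑ r : Lab μ, (r.pos : ℤ)) ≤ ∑ r' : Lab μ, ∑ r : Lab μ,
      if (r.side = r'.side ∧ r.diag = r'.diag) ∧ r'.pos < r.pos then (1 : ℤ) else 0 := by
    rw [sum_comm]
    refine sum_le_sum fun r _ => (le_cntLt le_rfl).trans (le_of_eq ?_)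
    refine sum_congr rfl fun r' _ => if_congr ?_ rfl rfl
    constructor <;> rintro ⟨⟨h5, h6⟩, h7⟩ <;> exact ⟨⟨h5.symm, h6.symm⟩, h7⟩
  have key0 : ∀ f : Lab μ → Lab μ → Prop, ∀ [∀ r r', Decidable (f r r')],
      (∑ r' : Lab μ, if r'.side = false ∧ r'.diag = 0 then (∑ r : Lab μ,
        if (r.side = true ∧ r.diag = 0) ∧ f r r' then (1 : ℤ) else 0) else 0)
      = ∑ r : Lab μ, if r.side = true ∧ r.diag = 0 then (∑ r' : Lab μ,
        if (r'.side = false ∧ r'.diag = 0) ∧ f r r' then (1 : ℤ) else 0) else 0 := by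
    intro f _
    have e1 : ∀ r' : Lab μ, (if r'.side = false ∧ r'.diag = 0 then (∑ r : Lab μ,
        if (r.side = true ∧ r.diag = 0) ∧ f r r' then (1 : ℤ) else 0) else 0)
        = ∑ r : Lab μ, if (r'.side = false ∧ r'.diag = 0) ∧ (r.side = true ∧ r.diag = 0) ∧ f r r'
          then (1 : ℤ) else 0 := by
      intro r'
      by_cases h5 : r'.side = false ∧ r'.diag = 0
      · simp only [h5, true_and, and_self, if_true]
      · simp only [h5, false_and, if_false, sum_const_zero]
    have e2 : ∀ r : Lab μ, (if r.side = true ∧ r.diag = 0 then (∑ r' : Lab μ,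
        if (r'.side = false ∧ r'.diag = 0) ∧ f r r' then (1 : ℤ) else 0) else 0)
        = ∑ r' : Lab μ, if (r'.side = false ∧ r'.diag = 0) ∧ (r.side = true ∧ r.diag = 0) ∧ f r r'
          then (1 : ℤ) else 0 := by
      intro r
      by_cases h5 : r.side = true ∧ r.diag = 0
      · simp only [h5, true_and, and_self, if_true]
      · simp only [h5, false_and, and_false, if_false, sum_const_zero]
    rw [sum_congr rfl fun r' _ => e1 r', sum_congr rfl fun r _ => e2 r]
    exact sum_comm
  have hD0 : (∑ r' : Lab μ, if r'.side = false ∧ r'.diag = 0 then (∑ r : Lab μ,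
        if (r.side = true ∧ r.diag = 0) ∧ r'.pos < r.pos then (1 : ℤ) else 0) else 0)
      ≤ ∑ r : Lab μ, if r.side = true ∧ r.diag = 0 then (r.pos : ℤ) else 0 := by
    rw [key0]
    refine sum_le_sum fun r _ => ?_
    split_ifs
    · exact cntLt_le _ _ _
    · exact le_rfl
  have hM0 : (∑ r : Lab μ, if r.side = true ∧ r.diag = 0 then ((r.pos - 1 : ℕ) : ℤ) else 0)
      ≤ ∑ r' : Lab μ, if r'.side = false ∧ r'.diag = 0 then (∑ r : Lab μ,
        if (r.side = true ∧ r.diag = 0) ∧ r'.pos < r.pos - 1 then (1 : ℤ) else 0)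
        else 0 := by
    rw [key0]
    refine sum_le_sum fun r _ => ?_
    split_ifs with h5
    · have h6 := le_cntLt (r := Lab.flip r) (k := r.pos - 1) (by rw [Lab.flip_pos]; omega)
      rw [Lab.flip_side h5.2, h5.1, Lab.flip_diag, h5.2] at h6
      exact h6
    · exact le_rfl
  have hI : (∑ r : Lab μ, if (r.side = true ∧ r.diag = 0) ∧ 0 < r.pos then (1 : ℤ) else 0)
      = ∑ r : Lab μ, if (r.side = false ∧ r.diag = 0) ∧ 0 < r.pos then (1 : ℤ) else 0 := by
    rw [← Equiv.sum_comp Lab.flip]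
    refine sum_congr rfl fun r _ => ?_
    by_cases h5 : r.diag = 0
    · rw [Lab.flip_diag, Lab.flip_pos, Lab.flip_side h5]; simp
    · rw [Lab.flip_diag, Lab.flip_pos]; simp [h5]
  have hsum : (∑ r : Lab μ, if (r.side = false ∧ r.diag = 0) ∧ 0 < r.pos then (1 : ℤ) else 0)
      + (∑ r : Lab μ, if 1 ≤ r.diag then (r.pos : ℤ) else 0)
      + (∑ r : Lab μ, ((r.pos - 1 : ℕ) : ℤ))
      + (∑ r : Lab μ, if r.side = true ∧ r.diag = 0 then (r.pos : ℤ) else 0)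
      = (∑ r : Lab μ, if 1 ≤ r.diag then ((r.pos - 1 : ℕ) : ℤ) else 0)
      + (∑ r : Lab μ, (r.pos : ℤ))
      + (∑ r : Lab μ, if r.side = true ∧ r.diag = 0 then ((r.pos - 1 : ℕ) : ℤ) else 0) := by
    simp only [← sum_add_distrib]
    refine sum_congr rfl fun r _ => ?_
    by_cases h5 : r.diag = 0
    · cases h6 : r.side <;> by_cases h7 : 0 < r.pos <;>
        simp only [h5, h7, if_true, if_false, and_self, and_true, and_false,
          Bool.false_eq_true, reduceCtorEq, nonpos_iff_eq_zero, one_ne_zero] <;> omega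
    · have h6 : 1 ≤ r.diag := by omega
      simp only [h5, h6, if_true, if_false, and_false, false_and]
      ring
  have hEM : (∑ r' : Lab μ, if 1 ≤ r'.diag then
      (∑ r : Lab μ, if (r.side = r'.side ∧ r.diag + 1 = r'.diag) ∧ r'.pos < r.pos - 1
        then (1 : ℤ) else 0)
      - (∑ r : Lab μ, if (r.side = r'.side ∧ r.diag = r'.diag) ∧ r'.pos < r.pos - 1
        then (1 : ℤ) else 0) else 0)
      = (∑ r' : Lab μ, if 1 ≤ r'.diag then (∑ r : Lab μ,
      if (r.side = r'.side ∧ r.diag + 1 = r'.diag) ∧ r'.pos < r.pos - 1 then (1 : ℤ) else 0) else 0)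
      - ∑ r' : Lab μ, if 1 ≤ r'.diag then (∑ r : Lab μ,
      if (r.side = r'.side ∧ r.diag = r'.diag) ∧ r'.pos < r.pos - 1 then (1 : ℤ) else 0)
        else 0 := by
    rw [← sum_sub_distrib]
    refine sum_congr rfl fun r _ => ?_
    split_ifs <;> simp
  have hDM : (∑ r' : Lab μ, if r'.side = false ∧ r'.diag = 0 then
      (∑ r : Lab μ, if (r.side = true ∧ r.diag = 0) ∧ r'.pos < r.pos then (1 : ℤ) else 0)
      - (∑ r : Lab μ, if (r.side = true ∧ r.diag = 0) ∧ r'.pos < r.pos - 1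
        then (1 : ℤ) else 0) else 0)
      = (∑ r' : Lab μ, if r'.side = false ∧ r'.diag = 0 then (∑ r : Lab μ,
        if (r.side = true ∧ r.diag = 0) ∧ r'.pos < r.pos then (1 : ℤ) else 0) else 0)
      - ∑ r' : Lab μ, if r'.side = false ∧ r'.diag = 0 then (∑ r : Lab μ,
        if (r.side = true ∧ r.diag = 0) ∧ r'.pos < r.pos - 1 then (1 : ℤ) else 0)
        else 0 := by
    rw [← sum_sub_distrib]
    refine sum_congr rfl fun r _ => ?_
    split_ifs <;> simp
  rw [hEM, hDM]
  linarith

end Count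

/-! ### Sums over the rearrangements of a filling -/

section Orbit
variable {μ : YoungDiagram} {a : ℕ} (x : Lab μ → ℤ)

/-- A key refining the order of the entries to a linear order of the labels. -/
def key (r : Lab μ) : ℤ ×ₗ Fin (Fintype.card (Lab μ)) := toLex (x r, Fintype.equivFin _ r)

theorem key_injective : Function.Injective (key x) := by
  intro r r' h
  have := congrArg (fun z => (ofLex z).2) h
  exact (Fintype.equivFin _).injective this

theorem key_lt_iff (r r' : Lab μ) : key x r' < key x r ↔ x r' < x r ∨
    x r' = x r ∧ Fintype.equivFin _ r' < Fintype.equivFin _ r := by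
  simp [key, Prod.Lex.toLex_lt_toLex]

open Classical in
/-- The differences of positions of labels in one block with equal entries. -/
def ties {K : Type*} [CommRing K] (e : Lab μ → K) : K := ∏ r : Lab μ, ∏ r' : Lab μ,
  if r.block = r'.block ∧ x r' = x r ∧ Fintype.equivFin _ r' < Fintype.equivFin _ r
    then e r - e r' else 1

open Classical in
/-- The factors of the ties complete the denominator to the product of the differences of positions
over all pairs of labels in one block. -/
theorem denF_mul_ties {K : Type*} [CommRing K] (e : Lab μ → K) :
    denF x e * ties x e = ∏ r : Lab μ, ∏ r' : Lab μ,
      if r.block = r'.block ∧ key x r' < key x r then e r - e r' else 1 := by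
  rw [denF, ties, prod_comm, ← prod_mul_distrib]
  refine prod_congr rfl fun r _ => ?_
  rw [← prod_mul_distrib]
  refine prod_congr rfl fun r' _ => ?_
  simp only [key_lt_iff, Lab.block_eq_iff]
  by_cases h1 : r.side = r'.side ∧ r.diag = r'.diag
  · rcases lt_trichotomy (x r') (x r) with h2 | h2 | h2
    · simp [h1, h2, h2.ne]
    · simp [h1, h2]
    · simp [h1, h2.not_gt, h2.ne']
  · simp [h1]

open Classical in
/-- The number of pairs of labels in one block is the sum of the positions. -/
theorem degDen_add_ties : degDen x + (∑ r : Lab μ, ∑ r' : Lab μ,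
    if r.block = r'.block ∧ x r' = x r ∧ Fintype.equivFin _ r' < Fintype.equivFin _ r
      then (1 : ℤ) else 0) = (∑ r : Lab μ, r.pos : ℕ) := by
  have h1 := (Lab.isPos μ).sum_eq
  have h2 := two_mul_card_lt (b := Lab.block (μ := μ)) Lab.pos (Lab.isPos μ).inj
  have h3 := two_mul_card_lt (b := Lab.block (μ := μ)) (key x) fun r r' _ h => key_injective x h
  have h4 : (∑ r : Lab μ, r.pos) = ∑ r : Lab μ, ∑ r' : Lab μ,
    if r.block = r'.block ∧ key x r' < key x r then 1 else 0 := by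
    rw [h1]
    omega
  rw [h4, degDen, sum_comm, ← sum_add_distrib]
  push_cast
  refine sum_congr rfl fun r _ => ?_
  rw [← sum_add_distrib]
  refine sum_congr rfl fun r' _ => ?_
  simp only [key_lt_iff, Lab.block_eq_iff]
  by_cases h1 : r.side = r'.side ∧ r.diag = r'.diag
  · rcases lt_trichotomy (x r') (x r) with h2 | h2 | h2
    · simp [h1, h2, h2.ne]
    · simp [h1, h2]
    · simp [h1, h2.not_gt, h2.ne']
  · simp [h1]

/-- Together with the factors of the ties, the denominator is alternating. -/
theorem prod_key_comp [inst : DecidableEq (Lab μ)] {σ : Equiv.Perm (Lab μ)}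
    (hσ : σ ∈ blockPerms (Lab.block (μ := μ))) :
    denF x (fun r => posQ (σ r)) * ties x (fun r => posQ (σ r))
      = (Equiv.Perm.sign σ : ℤ) * (denF x posQ * ties x posQ) := by
  let I : LinearOrder (Lab μ) := LinearOrder.lift' (key x) (key_injective x)
  have h := prod_block_sub_comp (Λ := Lab μ) Lab.block posQ hσ
  rw [denF_mul_ties, denF_mul_ties]
  refine Eq.trans ?_ (h.trans (congrArg (_ * ·) ?_))
  · exact prod_congr rfl fun r _ => prod_congr rfl fun r' _ => if_congr Iff.rfl rfl rfl
  · exact prod_congr rfl fun r _ => prod_congr rfl fun r' _ => if_congr Iff.rfl rfl rfl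

theorem denF_posQ_ne_zero : denF x (posQ (μ := μ)) ≠ 0 := by
  refine prod_ne_zero_iff.2 fun r' _ => ?_
  rw [Ne, prod_ite_eq_zero_iff]
  rintro ⟨r, ⟨⟨h1, h2⟩, h3⟩, h4⟩
  rw [posQ, posQ, sub_eq_zero] at h4
  rw [Lab.ext' h1 h2 (by exact_mod_cast h4)] at h3
  exact lt_irrefl _ h3

theorem ties_posQ_ne_zero : ties x (posQ (μ := μ)) ≠ 0 := by
  refine prod_ne_zero_iff.2 fun r _ => ?_
  rw [Ne, prod_ite_eq_zero_iff]
  rintro ⟨r', ⟨h1, -, h3⟩, h4⟩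
  rw [posQ, posQ, sub_eq_zero] at h4
  rw [(Lab.isPos μ).inj r r' h1 (by exact_mod_cast h4)] at h3
  exact lt_irrefl _ h3

theorem map_ties {K L : Type*} [CommRing K] [CommRing L] (φ : K →+* L) (e : Lab μ → K) :
    φ (ties x e) = ties x (fun r => φ (e r)) := by
  simp only [ties, map_prod]
  refine Finset.prod_congr rfl fun r _ => Finset.prod_congr rfl fun r' _ => ?_
  split_ifs <;> simp

variable (a) in
/-- The alternating numerator of the weight, as a polynomial in the positions of the labels and in
the two parameters `w` and `t`. -/
def altNum : MvPolynomial (Lab μ ⊕ Bool) ℚ :=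
  numF a x (fun r => MvPolynomial.X (Sum.inl r)) (MvPolynomial.X (Sum.inr false))
    (MvPolynomial.X (Sum.inr true)) * ties x fun r => MvPolynomial.X (Sum.inl r)

theorem degLE_altNum :
    DegLE (altNum a x) ((degF a x - degDen x) + (∑ r : Lab μ, r.pos : ℕ)) := by
  have hX : ∀ i, DegLE (MvPolynomial.X i : MvPolynomial (Lab μ ⊕ Bool) ℚ) 1 := DegLE.X
  rw [← degDen_add_ties x, ← add_assoc, sub_add_cancel]
  refine (degLE_numF a x (fun r => hX _) (hX _) (hX _)).mul ?_
  exact DegLE.prod fun r _ => DegLE.prod fun r' _ => ((hX _).sub (hX _)).ite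

theorem eval_altNum (e : Lab μ → ℚ) (y : Bool → ℚ) :
    MvPolynomial.eval (Sum.elim e y) (altNum a x)
      = numF a x e (y false) (y true) * ties x e := by
  rw [altNum, map_mul, map_numF, map_ties]
  simp

theorem numF_perm {σ : Equiv.Perm (Lab μ)} (hσ : σ ∈ blockPerms (Lab.block (μ := μ))) (w t : ℚ) :
    numF a x (fun r => posQ (σ r)) w t = numF a (fun r => x (σ.symm r)) posQ w t := by
  have h := numF_comp a (fun r => x (σ.symm r)) (posQ (μ := μ)) w t hσ
  simpa using h

theorem symm_mem_blockPerms {σ : Equiv.Perm (Lab μ)}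
    (hσ : σ ∈ blockPerms (Lab.block (μ := μ))) :
    σ.symm ∈ blockPerms (Lab.block (μ := μ)) := by
  rw [mem_blockPerms] at hσ ⊢
  intro r
  rw [← hσ (σ.symm r), Equiv.apply_symm_apply]

/-- The sum of the weights over all rearrangements of a filling is regular at `ε = 0`, and vanishes
there if the numerator vanishes identically for other values of the parameters. -/
theorem orbit_sum_mem {g : (Lab μ → ℤ) → Coeff₃} (hg : IsEpsPoly a g) (κ : ℕ) (hκ : κ ≤ 1)
    (hgap : κ = 1 → ∃ w t : ℚ, ∀ σ ∈ blockPerms (Lab.block (μ := μ)),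
      numF a (fun r => x (σ r)) posQ w t = 0) :
    ∃ u ∈ evalRing a, ∑ σ ∈ blockPerms (Lab.block (μ := μ)),
      eps a ^ (degF a x - degDen x) * algebraMap ℚ Coeff₃ (numF a x (fun r => posQ (σ r)) 0 1
        / denF x (fun r => posQ (σ r))) * g (fun r => posZ μ (σ r)) = eps a ^ κ * u := by
  obtain ⟨u, hu, h⟩ := eps_zpow_mul_sum_mem (Lab.isPos μ) (degLE_altNum (a := a) x) hg
    (fun b => if b then 1 else 0) κ hκ (fun h => by
      obtain ⟨w, t, hwt⟩ := hgap h
      refine ⟨fun b => if b then t else w, fun σ hσ => ?_⟩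
      refine (eval_altNum (a := a) x (fun r => posQ (σ r)) _).trans ?_
      rw [numF_perm x hσ]
      simp only [if_true, Bool.false_eq_true, if_false]
      rw [hwt _ (symm_mem_blockPerms hσ), zero_mul])
  have hc : denF x (posQ (μ := μ)) * ties x posQ ≠ 0 :=
    mul_ne_zero (denF_posQ_ne_zero x) (ties_posQ_ne_zero x)
  refine ⟨algebraMap ℚ Coeff₃ (denF x (posQ (μ := μ)) * ties x posQ)⁻¹ * u,
    mul_mem (algebraMap_rat_mem_evalRing _) hu, ?_⟩
  rw [mul_left_comm, ← h, ← mul_assoc, mul_comm _ (eps a ^ _), mul_assoc, mul_sum, mul_sum]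
  refine sum_congr rfl fun σ hσ => ?_
  rw [mul_assoc, ← mul_assoc (algebraMap ℚ Coeff₃ _⁻¹), ← map_mul]
  congr 3
  have h1 : MvPolynomial.eval (Sum.elim (fun r => ((σ r).pos : ℚ)) fun b => if b then 1 else 0)
      (altNum a x) = numF a x (fun r => posQ (σ r)) 0 1 * ties x (fun r => posQ (σ r)) := by
    refine (eval_altNum (a := a) x (fun r => posQ (σ r)) _).trans ?_
    simp
  rw [h1]
  have h2 := prod_key_comp (inst := fun _ _ => Classical.propDecidable _) x hσ
  have h3 := congrArg (Int.cast : ℤ → ℚ) (Int.units_coe_mul_self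
    (@Equiv.Perm.sign _ (fun _ _ => Classical.propDecidable _) _ σ))
  rw [Int.cast_mul, Int.cast_one] at h3
  have h4 : denF x (fun r => posQ (σ r)) * ties x (fun r => posQ (σ r)) ≠ 0 := by
    rw [h2]
    exact mul_ne_zero (left_ne_zero_of_mul_eq_one h3) hc
  have h5 := left_ne_zero_of_mul h4
  have h6 := right_ne_zero_of_mul h4
  rw [div_eq_iff h5, ← mul_left_inj' h6]
  have h7 : (denF x posQ * ties x posQ)⁻¹ * (denF x (posQ (μ := μ)) * ties x posQ) = 1 :=
    inv_mul_cancel₀ hc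
  rw [mul_assoc _ (denF x _) _, h2]
  linear_combination (exp := 1) (-(numF a x (fun r => posQ (σ r)) 0 1
    * ties x (fun r => posQ (σ r)))) * (h3
      + (@Equiv.Perm.sign _ (fun _ _ => Classical.propDecidable _) _ σ : ℤ) ^ 2 * h7)

end Orbit

/-! ### Torus-fixed submodules and reverse plane partitions -/

section Heights
variable {μ : YoungDiagram}

namespace FixedPair

theorem boxSet_fibre_finite (P : FixedPair μ) (c : ℕ × ℕ) :
    {k : ℤ | (c.1, c.2, k) ∈ P.boxSet}.Finite :=
  P.boxSet_finite.preimage fun k _ k' _ h => by simpa using h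

/-- The number of boxes of a torus-fixed datum over a cell of `μ`. -/
def height (P : FixedPair μ) (c : ℕ × ℕ) : ℕ :=
  (P.boxSet_fibre_finite c).toFinset.sup fun k => (-k).toNat

theorem mem_boxSet_iff (P : FixedPair μ) (c : ℕ × ℕ) (k : ℤ) :
    (c.1, c.2, k) ∈ P.boxSet ↔ k < 0 ∧ -(P.height c : ℤ) ≤ k := by
  constructor
  · intro h
    refine ⟨h.1.2, ?_⟩
    have : (-k).toNat ≤ P.height c := le_sup (f := fun k : ℤ => (-k).toNat) (by simpa using h)
    omega
  · rintro ⟨h0, h⟩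
    have h1 : (-k).toNat ≤ P.height c := by omega
    rw [height, Finset.le_sup_iff (by rw [Nat.bot_eq_zero]; omega)] at h1
    obtain ⟨b, hb, hk⟩ := h1
    have hb : (c.1, c.2, b) ∈ P.boxSet := by simpa using hb
    have h2 := P.boxSet_up hb (k - b).toNat (by omega)
    rwa [show b + ((k - b).toNat : ℤ) = k by omega] at h2

/-- Boxes are closed under multiplication by `x₁` and `x₂` as long as the product is nonzero. -/
theorem boxSet_right (P : FixedPair μ) {c c' : ℕ × ℕ} {k : ℤ} (hc : c ≤ c') (hc' : c' ∈ μ)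
    (h : (c.1, c.2, k) ∈ P.boxSet) : (c'.1, c'.2, k) ∈ P.boxSet := by
  refine ⟨⟨hc', h.1.2⟩, ?_⟩
  have h1 := P.Q.smul_mem (MvPolynomial.X 0 ^ (c'.1 - c.1) * MvPolynomial.X 1 ^ (c'.2 - c.2)) h.2
  rw [← map_smul, Algebra.smul_def, map_mul (algebraMap CoordRing LocRing), map_pow, map_pow] at h1
  have hX : ∀ n, algebraMap CoordRing LocRing (MvPolynomial.X n)
      = (![mono (1, 0, 0), mono (0, 1, 0), mono (0, 0, 1)] : Fin 3 → LocRing) n :=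
    fun n => MvPolynomial.aeval_X _ n
  rw [hX, hX] at h1
  have h2 : mono (1, 0, 0) ^ (c'.1 - c.1) * mono (0, 1, 0) ^ (c'.2 - c.2) * mono (c.1, c.2, k)
      = mono (c'.1, c'.2, k) := by
    have := hc.1
    have := hc.2
    simp only [mono, AddMonoidAlgebra.single_pow, AddMonoidAlgebra.single_mul_single, one_pow,
      mul_one]
    congr 1
    refine Prod.ext ?_ (Prod.ext ?_ ?_) <;> simp <;> omega
  simp only [Matrix.cons_val_zero, Matrix.cons_val_one] at h1
  rwa [h2] at h1

theorem height_mono (P : FixedPair μ) {c c' : ℕ × ℕ} (hc : c ≤ c') (hc' : c' ∈ μ) :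
    P.height c ≤ P.height c' := by
  rcases Nat.eq_zero_or_pos (P.height c) with h | h
  · omega
  · have h1 := (P.mem_boxSet_iff c (-(P.height c : ℤ))).2 ⟨by omega, le_rfl⟩
    have h2 := (P.mem_boxSet_iff c' _).1 (P.boxSet_right hc hc' h1)
    omega

theorem eq_of_height_eq {P P' : FixedPair μ} (h : ∀ c ∈ μ, P.height c = P'.height c) : P = P' := by
  apply boxSet_injective
  ext ⟨i, j, k⟩
  by_cases hc : (i, j) ∈ μ
  · rw [P.mem_boxSet_iff (i, j) k, P'.mem_boxSet_iff (i, j) k, h _ hc]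
  · exact ⟨fun h => absurd h.1.1 hc, fun h => absurd h.1.1 hc⟩

end FixedPair

variable (μ) in
/-- The boxes with at most `n c` boxes over each cell `c`, as a finite set. -/
def boxFin (n : ℕ × ℕ → ℕ) : Finset Expo :=
  (μ.cells.sigma fun c => range (n c)).image fun x => (x.1.1, x.1.2, -((x.2 : ℤ) + 1))

theorem boxFin_injective : Function.Injective
    fun x : (_ : ℕ × ℕ) × ℕ => ((x.1.1, x.1.2, -((x.2 : ℤ) + 1)) : Expo) := by
  rintro ⟨⟨i, j⟩, k⟩ ⟨⟨i', j'⟩, k'⟩ h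
  simp only [Prod.mk.injEq] at h
  obtain ⟨rfl, rfl, h⟩ := h
  have : k = k' := by omega
  rw [this]

theorem mem_boxFin {n : ℕ × ℕ → ℕ} {e : Expo} :
    e ∈ boxFin μ n ↔ e ∈ boxes μ ∧ -(n (e.1, e.2.1) : ℤ) ≤ e.2.2 := by
  obtain ⟨i, j, k⟩ := e
  simp only [boxFin, mem_image, mem_sigma, mem_range, YoungDiagram.mem_cells, boxes,
    Set.mem_ofPred_eq]
  constructor
  · rintro ⟨⟨⟨i', j'⟩, k'⟩, ⟨h1, h2⟩, h⟩
    simp only [Prod.mk.injEq] at h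
    obtain ⟨rfl, rfl, rfl⟩ := h
    dsimp only at h1 h2 ⊢
    exact ⟨⟨h1, by omega⟩, by omega⟩
  · rintro ⟨⟨h1, h2⟩, h3⟩
    refine ⟨⟨(i, j), (-k - 1).toNat⟩, ⟨h1, ?_⟩, ?_⟩
    · dsimp only; omega
    · simp only [Prod.mk.injEq, true_and]; omega

theorem card_boxFin (n : ℕ × ℕ → ℕ) : (boxFin μ n).card = ∑ c ∈ μ.cells, n c := by
  rw [boxFin, card_image_of_injective _ boxFin_injective, card_sigma]
  simp

theorem cls_mono_ne_zero {e : Expo} (he : e ∈ boxes μ) : cls μ (mono e) ≠ 0 := by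
  intro h
  have := cls_eq_zero h he
  simp [mono] at this

theorem span_boxFin_le {n : ℕ × ℕ → ℕ} {f : LocRing}
    (hf : ∀ e ∈ boxes μ, f.coeff e ≠ 0 → -(n (e.1, e.2.1) : ℤ) ≤ e.2.2) :
    cls μ f ∈ Submodule.span ℂ (Set.range fun e : boxFin μ n => cls μ (mono e)) := by
  rw [← f.sum_coeff_single, Finsupp.sum, map_sum]
  refine Submodule.sum_mem _ fun e he => ?_
  rw [single_eq, cls_smul]
  refine Submodule.smul_mem _ _ ?_
  by_cases hb : e ∈ boxes μ
  · exact Submodule.subset_span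
      ⟨⟨e, mem_boxFin.2 ⟨hb, hf e hb (Finsupp.mem_support_iff.1 he)⟩⟩, rfl⟩
  · rw [cls_mono_eq_zero hb]
    exact Submodule.zero_mem _

namespace FixedPair

theorem mem_boxFin_height (P : FixedPair μ) {e : Expo} :
    e ∈ boxFin μ P.height ↔ e ∈ P.boxSet := by
  rw [mem_boxFin]
  constructor
  · rintro ⟨h1, h2⟩
    exact (P.mem_boxSet_iff (e.1, e.2.1) e.2.2).2 ⟨h1.2, h2⟩
  · intro h
    exact ⟨h.1, ((P.mem_boxSet_iff (e.1, e.2.1) e.2.2).1 h).2⟩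

theorem length_eq (P : FixedPair μ) : P.length = ∑ c ∈ μ.cells, P.height c := by
  rw [← card_boxFin]
  refine le_antisymm ?_ (P.card_le _ fun e he => P.mem_boxFin_height.1 he)
  have h : P.Q.restrictScalars ℂ
      ≤ Submodule.span ℂ (Set.range fun e : boxFin μ P.height => cls μ (mono e)) := by
    intro y hy
    obtain ⟨f, rfl⟩ := cls_surjective μ y
    refine span_boxFin_le fun e he hne => ?_
    exact ((P.mem_boxSet_iff (e.1, e.2.1) e.2.2).1 ⟨he, P.mono_mem hy hne⟩).2
  have : FiniteDimensional ℂ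
      (Submodule.span ℂ (Set.range fun e : boxFin μ P.height => cls μ (mono e))) :=
    FiniteDimensional.span_of_finite ℂ (Set.finite_range _)
  refine (Submodule.finrank_mono h).trans ((finrank_range_le_card _).trans ?_)
  rw [Fintype.card_coe]

open Classical in
theorem mult_eq (P : FixedPair μ) (e : Expo) : P.mult e = if e ∈ P.boxSet then 1 else 0 := by
  split_ifs with h
  · rw [mult, inf_eq_right.2, finrank_span_singleton (cls_mono_ne_zero h.1)]
    rw [Submodule.span_singleton_le_iff_mem]
    exact h.2
  · have hbot : (P.Q.restrictScalars ℂ ⊓ Submodule.span ℂ {cls μ (mono e)}) = ⊥ := by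
      rw [Submodule.eq_bot_iff]
      rintro y ⟨hy1, hy2⟩
      obtain ⟨c, rfl⟩ := Submodule.mem_span_singleton.1 hy2
      by_cases hb : e ∈ boxes μ
      · by_cases hc : c = 0
        · rw [hc, zero_smul]
        · refine absurd ⟨hb, ?_⟩ h
          have := (P.Q.restrictScalars ℂ).smul_mem c⁻¹ hy1
          rwa [inv_smul_smul₀ hc] at this
      · rw [cls_mono_eq_zero hb, smul_zero]
    rw [mult, hbot, finrank_bot]

theorem charLaurent_eq (P : FixedPair μ) :
    P.charLaurent = ∑ c ∈ μ.cells, ∑ k ∈ range (P.height c), tmono c.1 c.2 (-((k : ℤ) + 1)) := by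
  classical
  rw [charLaurent, finsum_eq_sum_of_support_subset (s := boxFin μ P.height), boxFin,
    sum_image fun _ _ _ _ h => boxFin_injective h, sum_sigma]
  · refine sum_congr rfl fun c hc => sum_congr rfl fun k hk => ?_
    have : ((c.1, c.2, -((k : ℤ) + 1)) : Expo) ∈ P.boxSet := by
      rw [mem_boxSet_iff]
      have := mem_range.1 hk
      omega
    rw [mult_eq, if_pos this, one_smul]
  · intro e he
    rw [Function.mem_support, mult_eq] at he
    rw [mem_coe, mem_boxFin_height]
    by_contra h
    rw [if_neg h, zero_smul] at he
    exact he rfl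

/-- The numerator of the character of the sheaf, with respect to the denominator `1 - t₃`. -/
theorem charLaurent_mul (P : FixedPair μ) :
    legLaurent μ + P.charLaurent * (1 - tmono 0 0 1) = confLaurent μ fun c => P.height c := by
  rw [charLaurent_eq, legLaurent, confLaurent, sum_mul, ← sum_add_distrib]
  refine sum_congr rfl fun c _ => ?_
  have h := sum_range_sub (fun k : ℕ => tmono c.1 c.2 (-(k : ℤ))) (P.height c)
  rw [sum_mul]
  have h1 : ∀ k : ℕ, tmono c.1 c.2 (-((k : ℤ) + 1)) * (1 - tmono 0 0 1)
      = tmono c.1 c.2 (-((k + 1 : ℕ) : ℤ)) - tmono c.1 c.2 (-(k : ℤ)) := by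
    intro k
    rw [mul_sub, mul_one, tmono_mul]
    congr 2
    ring
  rw [sum_congr rfl fun k _ => h1 k, h]
  simp

end FixedPair

/-- The elements of `ℂ[x₁, x₂, x₃, x₃⁻¹]` whose nonzero monomials in `M₃ / ⟨1⟩` lie under the given
heights. -/
def heightSubmodule {n : ℕ × ℕ → ℕ} (hn : ∀ c c', c ≤ c' → c' ∈ μ → n c ≤ n c') :
    Submodule CoordRing LocRing where
  carrier := {f | ∀ e ∈ boxes μ, f.coeff e ≠ 0 → -(n (e.1, e.2.1) : ℤ) ≤ e.2.2}
  zero_mem' := fun e _ h => absurd rfl h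
  add_mem' := fun {f g} hf hg e he h => by
    by_cases h1 : f.coeff e = 0
    · refine hg e he fun h2 => h ?_
      rw [AddMonoidAlgebra.coeff_add, Finsupp.add_apply, h1, h2, add_zero]
    · exact hf e he h1
  smul_mem' := fun r f hf e he h => by
    rw [Algebra.smul_def] at h
    obtain ⟨u, hu, v, hv, rfl⟩ := Finset.mem_add.1
      (AddMonoidAlgebra.support_coeff_mul_subset _ _ (Finsupp.mem_support_iff.2 h))
    have hu := coeff_algebraMap r u (Finsupp.mem_support_iff.1 hu)
    have hle : (v.1, v.2.1) ≤ ((u + v).1, (u + v).2.1) := ⟨by simp, by simp⟩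
    have hz : (u + v).2.2 = u.2.2 + v.2.2 := rfl
    have hv' : v ∈ boxes μ := ⟨μ.isLowerSet hle he.1, by have := he.2; omega⟩
    have h1 := hf v hv' (Finsupp.mem_support_iff.1 hv)
    have h2 := hn _ _ hle he.1
    omega

/-- Membership only depends on the coefficients at the boxes, hence not on the representative. -/
theorem cls_mem_map_iff {n : ℕ × ℕ → ℕ} (hn : ∀ c c', c ≤ c' → c' ∈ μ → n c ≤ n c')
    {f : LocRing} : cls μ f ∈ (heightSubmodule hn).map (cls μ) ↔ f ∈ heightSubmodule hn := by
  refine ⟨?_, Submodule.mem_map_of_mem⟩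
  rintro ⟨g, hg, h⟩ e he hne
  refine hg e he fun h0 => hne ?_
  have h1 : cls μ (g - f) = 0 := by rw [map_sub, h, sub_self]
  have h2 := cls_eq_zero h1 he
  rw [AddMonoidAlgebra.coeff_sub, Finsupp.sub_apply, h0] at h2
  simpa using h2

/-- The torus-fixed datum with given heights. -/
def FixedPair.ofHeight {n : ℕ × ℕ → ℕ} (hn : ∀ c c', c ≤ c' → c' ∈ μ → n c ≤ n c') :
    FixedPair μ where
  Q := (heightSubmodule hn).map (cls μ)
  finiteDimensional := by
    have : FiniteDimensional ℂ
        (Submodule.span ℂ (Set.range fun e : boxFin μ n => cls μ (mono e))) :=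
      FiniteDimensional.span_of_finite ℂ (Set.finite_range _)
    refine Submodule.finiteDimensional_of_le
      (S₁ := ((heightSubmodule hn).map (cls μ)).restrictScalars ℂ)
      (S₂ := Submodule.span ℂ (Set.range fun e : boxFin μ n => cls μ (mono e))) ?_
    rintro _ ⟨f, hf, rfl⟩
    exact span_boxFin_le hf
  invariant := fun t f h => by
    rw [cls_mem_map_iff] at h ⊢
    intro e he hne
    rw [coeff_torusAct] at hne
    exact h e he (right_ne_zero_of_mul hne)

theorem FixedPair.height_ofHeight {n : ℕ × ℕ → ℕ} (hn : ∀ c c', c ≤ c' → c' ∈ μ → n c ≤ n c')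
    {c : ℕ × ℕ} (hc : c ∈ μ) : (ofHeight hn).height c = n c := by
  have key : ∀ k : ℤ, k < 0 → (-((ofHeight hn).height c : ℤ) ≤ k ↔ -(n c : ℤ) ≤ k) := by
    intro k hk
    have h1 := (ofHeight hn).mem_boxSet_iff c k
    have h2 : (c.1, c.2, k) ∈ (ofHeight hn).boxSet ↔ -(n c : ℤ) ≤ k := by
      have h3 : ((c.1, c.2, k) : Expo) ∈ boxes μ := ⟨hc, hk⟩
      constructor
      · intro h
        exact (cls_mem_map_iff hn).1 h.2 _ h3 (by simp [mono])
      · intro h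
        refine ⟨h3, (cls_mem_map_iff hn).2 fun e he hne => ?_⟩
        have : e = (c.1, c.2, k) := by
          by_contra h4
          rw [mono, AddMonoidAlgebra.coeff_single, Finsupp.single_apply, if_neg (Ne.symm h4)] at hne
          exact hne rfl
        rw [this]
        exact h
    rw [← h2, h1]
    simp [hk]
  rcases Nat.lt_trichotomy ((ofHeight hn).height c) (n c) with h | h | h
  · have := (key (-(n c : ℤ)) (by omega)).2 le_rfl
    omega
  · exact h
  · have := (key (-((ofHeight hn).height c : ℤ)) (by omega)).1 le_rfl
    omega

end Heights

/-! ### Reverse plane partitions as fillings of the labels -/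

section Fill
variable {μ : YoungDiagram} {a : ℕ} {x : Lab μ → ℤ}

namespace Lab

theorem exists_cell_eq {c : ℕ × ℕ} (hc : c ∈ μ) : ∃ r ∈ main μ, r.cell = c := by
  have : c ∈ (main μ).image cell := by rw [image_cell_main]; exact hc
  simpa using this

theorem exists_true {i j : ℕ} (h : (i, j) ∈ μ) (hij : j ≤ i) :
    ∃ r : Lab μ, r.cell = (i, j) ∧ r.side = true ∧ r.diag = i - j ∧ r.pos = j := by
  have hc : cellOf true (i - j) j = (i, j) := by simp [cellOf, hij]
  exact ⟨⟨(true, i - j, j), by rw [hc]; exact h⟩, hc, rfl, rfl, rfl⟩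

theorem exists_false {i j : ℕ} (h : (i, j) ∈ μ) (hij : i ≤ j) :
    ∃ r : Lab μ, r.cell = (i, j) ∧ r.side = false ∧ r.diag = j - i ∧ r.pos = i := by
  have hc : cellOf false (j - i) i = (i, j) := by simp [cellOf, hij]
  exact ⟨⟨(false, j - i, i), by rw [hc]; exact h⟩, hc, rfl, rfl, rfl⟩

theorem cell_flip (r : Lab μ) : (flip r).cell = r.cell := by
  by_cases h : r.diag = 0
  · simp only [cell, flip_diag, flip_pos, h, cellOf, add_zero, ite_self]
  · rw [flip_of_diag_ne h]

theorem eq_or_eq_flip {r r' : Lab μ} (h : r.cell = r'.cell) : r = r' ∨ r = flip r' := by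
  have h1 : r.cell.1 = r'.cell.1 := by rw [h]
  have h2 : r.cell.2 = r'.cell.2 := by rw [h]
  simp only [cell, cellOf] at h1 h2
  by_cases hs : r.side = r'.side
  · left
    cases h4 : r'.side <;> simp [hs, h4] at h1 h2
    · exact ext' hs (by omega) (by omega)
    · exact ext' hs (by omega) (by omega)
  · right
    have hs' : r.side = !r'.side := by cases h3 : r.side <;> cases h4 : r'.side <;> simp_all
    have hd : r'.diag = 0 ∧ r.diag = 0 ∧ r.pos = r'.pos := by
      cases h4 : r'.side <;> simp [hs', h4] at h1 h2 <;> omega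
    exact ext' (by rw [flip_side hd.1, hs']) (by rw [flip_diag]; omega) (by rw [flip_pos]; omega)

theorem sum_main_cell {M : Type*} [AddCommMonoid M] (f : ℕ × ℕ → M) :
    ∑ r ∈ main μ, f r.cell = ∑ c ∈ μ.cells, f c := by
  rw [← image_cell_main, sum_image cell_injOn_main]

end Lab

variable (a) in
/-- The filling of the labels given by a reverse plane partition. -/
def fill (n : ℕ × ℕ → ℤ) (r : Lab μ) : ℤ := a * r.pos - n r.cell

/-- The filling of a reverse plane partition is valid. -/
theorem valid_fill {n : ℕ × ℕ → ℤ} (h0 : ∀ c ∈ μ.cells, 0 ≤ n c)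
    (hn : ∀ c ∈ μ.cells, ∀ c' ∈ μ.cells, c' ≤ c → n c' ≤ n c) : Valid a (fill (μ := μ) a n) where
  init r _ _ h3 := by
    have := h0 r.cell r.2
    simp only [fill, h3]
    push_cast
    linarith
  step r r' h1 h2 h3 := by
    have : n r.cell ≤ n r'.cell := by
      refine hn _ r'.2 _ r.2 ?_
      cases h : r.side <;> simp [Lab.cell, cellOf, h1, h2, h3, h]
    simp only [fill, h3]
    linarith
  climb r r' h1 h2 h3 := by
    have : n r'.cell ≤ n r.cell := by
      refine hn _ r.2 _ r'.2 ?_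
      cases h : r.side <;> simp [Lab.cell, cellOf, h1, h2, h3, h] <;>
        (change _ ≤ r'.pos + 1 + r.diag; omega)
    simp only [fill, h3]
    push_cast
    linarith
  compat r := by
    simp only [fill, Lab.cell_flip, Lab.flip_pos]

theorem shiftX_fill (n : ℕ × ℕ → ℤ) (r : Lab μ) :
    shiftX a (fill a n) r = a * r.cell.2 - n r.cell := by
  rw [shiftX, fill, Lab.cell_snd]; ring

theorem shiftJ_posZ (r : Lab μ) : shiftJ (posZ μ) r = r.cell.2 := by
  rw [shiftJ, posZ, Lab.cell_snd]

open Classical in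
variable (a x) in
/-- The reverse plane partition of a filling of the labels. -/
def unfill (c : ℕ × ℕ) : ℤ :=
  if h : ∃ r : Lab μ, r.cell = c then a * h.choose.pos - x h.choose else 0

theorem Valid.unfill_cell (h : Valid a x) (r : Lab μ) : unfill a x r.cell = a * r.pos - x r := by
  have h1 : ∃ r' : Lab μ, r'.cell = r.cell := ⟨r, rfl⟩
  rw [unfill, dif_pos h1]
  rcases Lab.eq_or_eq_flip h1.choose_spec with h2 | h2
  · rw [h2]
  · rw [h2, Lab.flip_pos, h.compat]

theorem Valid.unfill_le_right (h : Valid a x) {i j : ℕ} (hc : (i + 1, j) ∈ μ) :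
    unfill a x (i, j) ≤ unfill a x (i + 1, j) := by
  have hc' : (i, j) ∈ μ := μ.isLowerSet (a := (i + 1, j)) ⟨by simp, by simp⟩ hc
  rcases le_or_gt j i with hij | hij
  · obtain ⟨r, h1, h2, h3, h4⟩ := Lab.exists_true hc' hij
    obtain ⟨r', q1, q2, q3, q4⟩ := Lab.exists_true hc (by omega)
    have := h.step r r' (q2.trans h2.symm) (by omega) (by omega)
    rw [← h1, ← q1, h.unfill_cell, h.unfill_cell, h4, q4]
    linarith
  · obtain ⟨r, h1, h2, h3, h4⟩ := Lab.exists_false hc' hij.le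
    obtain ⟨r', q1, q2, q3, q4⟩ := Lab.exists_false hc (by omega)
    have := h.climb r' r (h2.trans q2.symm) (by omega) (by omega)
    rw [← h1, ← q1, h.unfill_cell, h.unfill_cell, h4, q4]
    push_cast
    linarith

theorem Valid.unfill_le_up (h : Valid a x) {i j : ℕ} (hc : (i, j + 1) ∈ μ) :
    unfill a x (i, j) ≤ unfill a x (i, j + 1) := by
  have hc' : (i, j) ∈ μ := μ.isLowerSet (a := (i, j + 1)) ⟨by simp, by simp⟩ hc
  rcases le_or_gt i j with hij | hij
  · obtain ⟨r, h1, h2, h3, h4⟩ := Lab.exists_false hc' hij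
    obtain ⟨r', q1, q2, q3, q4⟩ := Lab.exists_false hc (by omega)
    have := h.step r r' (q2.trans h2.symm) (by omega) (by omega)
    rw [← h1, ← q1, h.unfill_cell, h.unfill_cell, h4, q4]
    linarith
  · obtain ⟨r, h1, h2, h3, h4⟩ := Lab.exists_true hc' hij.le
    obtain ⟨r', q1, q2, q3, q4⟩ := Lab.exists_true hc (by omega)
    have := h.climb r' r (h2.trans q2.symm) (by omega) (by omega)
    rw [← h1, ← q1, h.unfill_cell, h.unfill_cell, h4, q4]
    push_cast
    linarith

theorem Valid.unfill_mono (h : Valid a x) {c c' : ℕ × ℕ} (hcc : c ≤ c') (hc' : c' ∈ μ) :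
    unfill a x c ≤ unfill a x c' := by
  obtain ⟨i, j⟩ := c
  obtain ⟨i', j'⟩ := c'
  obtain ⟨h1, h2⟩ := hcc
  have hj : unfill a x (i, j) ≤ unfill a x (i, j') := by
    have hc : (i, j') ∈ μ := μ.isLowerSet (a := (i', j')) ⟨h1, le_rfl⟩ hc'
    clear hc'
    induction j', h2 using Nat.le_induction with
    | base => exact le_rfl
    | succ j' h2 ih =>
      exact le_trans (ih h1 (μ.isLowerSet (a := (i, j' + 1)) (b := (i, j'))
        ⟨le_rfl, Nat.le_succ j'⟩ hc))
        (h.unfill_le_up hc)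
  refine hj.trans ?_
  clear hj h2
  induction i', h1 using Nat.le_induction with
  | base => exact le_rfl
  | succ i' h1 ih =>
    exact le_trans (ih (μ.isLowerSet (a := (i' + 1, j')) (b := (i', j'))
      ⟨Nat.le_succ i', le_rfl⟩ hc'))
      (h.unfill_le_right hc')

theorem Valid.unfill_nonneg (h : Valid a x) {c : ℕ × ℕ} (hc : c ∈ μ) : 0 ≤ unfill a x c := by
  have h0 : ((0, 0) : ℕ × ℕ) ≤ c := ⟨Nat.zero_le _, Nat.zero_le _⟩
  refine le_trans ?_ (h.unfill_mono h0 hc)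
  obtain ⟨r, h1, h2, h3, h4⟩ := Lab.exists_true (μ.isLowerSet h0 hc) le_rfl
  have := h.init r h2 (by omega) h4
  rw [← h1, h.unfill_cell, h4]
  push_cast
  linarith

theorem Valid.balanced (h : Valid a x) : Balanced x := by
  have h1 : (univ.filter fun r : Lab μ => r.side = false ∧ r.diag = 0)
      = (univ.filter fun r : Lab μ => r.side = true ∧ r.diag = 0).map Lab.flip.toEmbedding := by
    ext r
    simp only [mem_filter, mem_univ, true_and, mem_map_equiv]
    have : Lab.flip.symm r = Lab.flip r := rfl
    rw [this, Lab.flip_diag]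
    by_cases hd : r.diag = 0
    · rw [Lab.flip_side hd]; simp
    · simp [hd]
  rw [Balanced, h1, map_val, Multiset.map_map]
  refine Multiset.map_congr rfl fun r _ => ?_
  exact (h.compat r).symm

variable (a) in
/-- The filling of the labels given by a torus-fixed datum. -/
def FixedPair.filling (P : FixedPair μ) : Lab μ → ℤ := fill a fun c => P.height c

theorem FixedPair.valid_filling (P : FixedPair μ) : Valid a (P.filling a) :=
  valid_fill (fun _ _ => by positivity) fun c hc c' _ h => by
    exact_mod_cast P.height_mono h hc

theorem FixedPair.filling_injective : Function.Injective (FixedPair.filling (μ := μ) a) := by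
  intro P P' h
  refine FixedPair.eq_of_height_eq fun c hc => ?_
  obtain ⟨r, -, rfl⟩ := Lab.exists_cell_eq hc
  have := congrFun h r
  simp only [FixedPair.filling, fill] at this
  omega

/-- Every valid filling comes from a torus-fixed datum. -/
theorem Valid.exists_filling_eq (h : Valid a x) : ∃ P : FixedPair μ, P.filling a = x := by
  have hn : ∀ c c', c ≤ c' → c' ∈ μ → (unfill a x c).toNat ≤ (unfill a x c').toNat :=
    fun c c' h1 h2 => Int.toNat_le_toNat (h.unfill_mono h1 h2)
  refine ⟨FixedPair.ofHeight hn, funext fun r => ?_⟩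
  rw [FixedPair.filling, fill, FixedPair.height_ofHeight hn (c := r.cell) r.2,
    Int.toNat_of_nonneg (h.unfill_nonneg (c := r.cell) r.2), h.unfill_cell]
  ring

theorem FixedPair.sum_filling (P : FixedPair μ) :
    ∑ r ∈ Lab.main μ, P.filling a r = (∑ r ∈ Lab.main μ, (a : ℤ) * r.pos) - P.length := by
  rw [P.length_eq, ← Lab.sum_main_cell, Nat.cast_sum, ← sum_sub_distrib]
  rfl

theorem FixedPair.filling_mem (P : FixedPair μ) (r : Lab μ) :
    P.filling a r ∈ Icc (-(P.length : ℤ)) (a * ∑ r : Lab μ, (r.pos : ℤ)) := by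
  have h1 : P.height r.cell ≤ P.length := by
    rw [P.length_eq]
    exact single_le_sum (f := P.height) (fun _ _ => Nat.zero_le _) r.2
  have h2 : (r.pos : ℤ) ≤ ∑ r : Lab μ, (r.pos : ℤ) :=
    single_le_sum (f := fun r : Lab μ => (r.pos : ℤ)) (fun _ _ => by positivity) (mem_univ r)
  have h3 := mul_le_mul_of_nonneg_left h2 (Int.natCast_nonneg a)
  have h4 : (0 : ℤ) ≤ a * r.pos := by positivity
  rw [mem_Icc, FixedPair.filling, fill]
  constructor <;> linarith [(Int.ofNat_le.2 h1), Int.natCast_nonneg (P.height r.cell)]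

end Fill

/-! ### The descendent weight of a filling -/

section Weight
variable {μ : YoungDiagram} {a : ℕ}

theorem edgeSum_rl_coeff_zero {n : ℕ × ℕ → ℤ} (h0 : ∀ c ∈ μ.cells, 0 ≤ n c)
    (hn : ∀ c ∈ μ.cells, ∀ c' ∈ μ.cells, c' ≤ c → n c' ≤ n c) :
    (edgeSum μ n (rl a)).coeff 0 = 0 := by
  rw [edgeSum, AddMonoidAlgebra.coeff_add, Finsupp.add_apply, AddMonoidAlgebra.coeff_sum,
    AddMonoidAlgebra.coeff_sum, Finsupp.finsetSum_apply, Finsupp.finsetSum_apply, sum_eq_zero,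
    sum_eq_zero, add_zero]
  · intro c hc
    rw [AddMonoidAlgebra.coeff_sum, Finsupp.finsetSum_apply]
    refine sum_eq_zero fun c' hc' => ?_
    have key : ∀ u v : ℤ, 0 ≤ u → 0 ≤ v →
        ((c.1 : ℤ) - c'.1 - u = 0 → (c.2 : ℤ) - c'.2 - v = 0 → n c' - n c ≤ 0) := by
      intro u v hu hv h1 h2
      have : c' ≤ c := ⟨by zify; linarith, by zify; linarith⟩
      linarith [hn c hc c' hc' this]
    have k00 := key 0 0 le_rfl le_rfl
    have k01 := key 0 1 le_rfl zero_le_one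
    have k10 := key 1 0 zero_le_one le_rfl
    have k11 := key 1 1 zero_le_one zero_le_one
    simp only [sub_zero] at k00 k01 k10
    simp only [AddMonoidAlgebra.coeff_add, AddMonoidAlgebra.coeff_sub, Finsupp.add_apply,
      Finsupp.sub_apply, rl_coeff_zero k00, rl_coeff_zero k01, rl_coeff_zero k10,
      rl_coeff_zero k11]
    rfl
  · intro c hc
    have h1 : (rl a c.1 c.2 (-n c)).coeff 0 = 0 := rl_coeff_zero fun _ _ => by linarith [h0 c hc]
    have h2 : (rl a (-c.1 - 1) (-c.2 - 1) (n c)).coeff 0 = 0 := rl_coeff_zero fun h => by omega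
    simp only [AddMonoidAlgebra.coeff_sub, AddMonoidAlgebra.coeff_neg, Finsupp.sub_apply,
      Finsupp.neg_apply, h1, h2]
    rfl

/-- The Euler class of the edge term of a reverse plane partition, split into a power of `ε`, a
rational number, and a factor that is regular and invertible at `ε = 0`. -/
theorem eul_edgeSum_eq {n : ℕ × ℕ → ℤ} (h0 : ∀ c ∈ μ.cells, 0 ≤ n c)
    (hn : ∀ c ∈ μ.cells, ∀ c' ∈ μ.cells, c' ≤ c → n c' ≤ n c) :
    eul (edgeSum μ n (rl a)) = eps a ^ (degF a (fill (μ := μ) a n) - degDen (fill (μ := μ) a n))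
      * algebraMap ℚ Coeff₃ (valF a (fill (μ := μ) a n) posQ 1)
      * pairProd a (hUnit a) (Lab.main μ) Lab.cont (shiftX a (fill a n)) (shiftJ (posZ μ)) := by
  rw [← valF_epsPos, ← (valid_fill h0 hn).pairProd_hEps, ← pairProd_mul, eul_edgeSum h0 hn,
    ← Lab.image_cell_main, pairProd_image _ _ _ Lab.cell_injOn_main]
  congr 1
  · funext r; exact Lab.cell_fst_sub r
  · funext r; exact (shiftX_fill n r).symm
  · funext r; exact (shiftJ_posZ r).symm

variable (μ a) in
/-- The Euler class of the edge term of the empty configuration. -/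
def baseEul : Coeff₃ := eul (edgeSum μ 0 (rl a))

theorem IsEpsPoly.mem_evalRing {Λ : Type*} {g : (Λ → ℤ) → Coeff₃} (h : IsEpsPoly a g)
    (e : Λ → ℤ) : g e ∈ evalRing a := by
  obtain ⟨g', hg, -⟩ := h
  rw [hg]
  exact (g' e).2

theorem inv_pairProd_hUnit_mem (ha : 0 < a) {ι : Type*} (S : Finset ι) (C X J : ι → ℤ) :
    (pairProd a (hUnit a) S C X J)⁻¹ ∈ evalRing a := by
  have h1 : ∀ δ k m : ℤ, hUnit a δ k m ∈ evalRing a := fun δ k m =>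
    (isEpsPoly_hUnit (Λ := Empty) ha δ k (IsAffine.const m)).mem_evalRing Empty.elim
  have h2 : ∀ δ k m : ℤ, (hUnit a δ k m)⁻¹ ∈ evalRing a := fun δ k m =>
    (isEpsPoly_inv_hUnit (Λ := Empty) ha δ k (IsAffine.const m)).mem_evalRing Empty.elim
  unfold pairProd
  simp only [mul_inv, ← prod_inv_distrib, inv_inv]
  refine mul_mem (prod_mem fun r _ => mul_mem (h1 _ _ _) (h1 _ _ _))
    (prod_mem fun r _ => prod_mem fun r' _ => ?_)
  exact mul_mem (mul_mem (mul_mem (h2 _ _ _) (h1 _ _ _)) (h1 _ _ _)) (h2 _ _ _)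

/-- The Euler class of the edge term of the empty configuration may have a pole at `ε = 0`, but no
zero. -/
theorem inv_baseEul_mem (ha : 0 < a) : (baseEul μ a)⁻¹ ∈ evalRing a := by
  have h0 : fill a (0 : ℕ × ℕ → ℤ) = fun r : Lab μ => (a : ℤ) * r.pos := by
    funext r; simp [fill]
  rw [baseEul, eul_edgeSum_eq (n := 0) (fun _ _ => le_rfl) fun _ _ _ _ _ => le_rfl, h0,
    mul_inv, mul_inv,
    ← zpow_neg, ← map_inv₀]
  obtain ⟨d, hd⟩ := Int.eq_ofNat_of_zero_le (neg_nonneg.2 (degF_sub_degDen_le (μ := μ) ha))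
  rw [hd]
  refine mul_mem (mul_mem ?_ (algebraMap_rat_mem_evalRing _)) (inv_pairProd_hUnit_mem ha _ _ _ _)
  rw [zpow_natCast]
  exact pow_mem eps_mem_evalRing d

variable (a) in
/-- The degree `n` part of the Chern character of `F_U (1 - t₁) (1 - t₂) (1 - t₃)`, for a filling
`x` and positions `e` of the labels. -/
def descSum (n : ℕ) (x e : Lab μ → ℤ) : Coeff₃ := ∑ r ∈ Lab.main μ,
  (lin a r.cont (shiftX a x r) (shiftJ e r) ^ n
    + -1 * lin a (r.cont + 1) (shiftX a x r) (shiftJ e r) ^ n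
    + -1 * lin a (r.cont - 1) (shiftX a x r + a) (shiftJ e r + 1) ^ n
    + lin a r.cont (shiftX a x r + a) (shiftJ e r + 1) ^ n) * algebraMap ℚ Coeff₃ (n.factorial)⁻¹

theorem chern_descChar (P : FixedPair μ) (n : ℕ) :
    chern n (toLaurent P.descChar) = descSum a n (P.filling a) (posZ μ) := by
  have h1 : ∀ (i j k : ℤ), tmono i j k * ((1 - tmono 1 0 0) * (1 - tmono 0 1 0))
      = tmono i j k - tmono (i + 1) j k - tmono i (j + 1) k + tmono (i + 1) (j + 1) k := by
    intro i j k
    have e1 := tmono_mul i j k 1 0 0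
    have e2 := tmono_mul i j k 0 1 0
    have e3 := tmono_mul (i + 1) j k 0 1 0
    simp only [add_zero] at e1 e2 e3
    rw [← e3, ← e2, ← e1]
    ring
  rw [P.descChar_eq P.charLaurent_mul, confLaurent, sum_mul, chern_sum, descSum,
    ← Lab.sum_main_cell fun c => chern n (tmono c.1 c.2 (-(P.height c : ℤ))
      * ((1 - tmono 1 0 0) * (1 - tmono 0 1 0)))]
  refine sum_congr rfl fun r _ => ?_
  rw [h1, chern_add, chern_sub, chern_sub, chern_tmono, chern_tmono, chern_tmono, chern_tmono,
    weight_eq_lin (a := a), weight_eq_lin (a := a), weight_eq_lin (a := a),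
    weight_eq_lin (a := a), FixedPair.filling, shiftX_fill, shiftJ_posZ, ← Lab.cell_fst_sub,
    map_inv₀, map_natCast]
  dsimp only
  have e1 : -(P.height r.cell : ℤ) + a * r.cell.2 = a * r.cell.2 - P.height r.cell := by ring
  have e2 : -(P.height r.cell : ℤ) + a * (r.cell.2 + 1) = a * r.cell.2 - P.height r.cell + a := by
    ring
  have e3 : (r.cell.1 : ℤ) + 1 - r.cell.2 = r.cell.1 - r.cell.2 + 1 := by ring
  have e4 : (r.cell.1 : ℤ) - (r.cell.2 + 1) = r.cell.1 - r.cell.2 - 1 := by ring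
  have e5 : (r.cell.1 : ℤ) + 1 - (r.cell.2 + 1) = r.cell.1 - r.cell.2 := by ring
  rw [e1, e2, e3, e4, e5]
  ring

variable (a) in
/-- The part of the descendent weight that is regular at `ε = 0`, for a filling `x` and positions
`e` of the labels. -/
def regPart {k : ℕ} (i : Fin k → ℕ) (x e : Lab μ → ℤ) : Coeff₃ :=
  pairProd a (hUnit a) (Lab.main μ) Lab.cont (shiftX a x) (fun r => shiftJ e r)
    * ∏ j, descSum a (2 + i j) x e

theorem isAffine_shiftJ (r : Lab μ) : IsAffine a fun e => shiftJ e r :=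
  (IsAffine.coord r).add (IsAffine.const _)

theorem isEpsPoly_regPart (ha : 0 < a) {k : ℕ} (i : Fin k → ℕ) (x : Lab μ → ℤ) :
    IsEpsPoly a (regPart a i x) := by
  have hJ := fun r : Lab μ => isAffine_shiftJ (a := a) r
  have hJ1 : ∀ r : Lab μ, IsAffine a fun e => shiftJ e r + 1 := fun r =>
    (hJ r).add (IsAffine.const 1)
  have hneg : IsEpsPoly a fun _ : Lab μ → ℤ => (-1 : Coeff₃) :=
    IsEpsPoly.const (neg_mem (one_mem _))
  refine (isEpsPoly_pairProd_hUnit ha _ _ _ hJ).mul (IsEpsPoly.prod _ fun j _ =>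
    IsEpsPoly.sum _ fun r _ => IsEpsPoly.mul ?_ (IsEpsPoly.const (algebraMap_rat_mem_evalRing _)))
  exact ((((isEpsPoly_lin _ _ (hJ r)).pow _).add
    (hneg.mul ((isEpsPoly_lin _ _ (hJ r)).pow _))).add
    (hneg.mul ((isEpsPoly_lin _ _ (hJ1 r)).pow _))).add ((isEpsPoly_lin _ _ (hJ1 r)).pow _)

section Relabel
variable {σ : Equiv.Perm (Lab μ)} (hσ : σ ∈ blockPerms (Lab.block (μ := μ)))
include hσ

theorem cont_perm (r : Lab μ) : (σ r).cont = r.cont := by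
  simp only [Lab.cont, side_perm hσ, diag_perm hσ]

theorem off_perm (r : Lab μ) : (σ r).off = r.off := by
  simp only [Lab.off, side_perm hσ, diag_perm hσ]

theorem prod_main_perm {M : Type*} [CommMonoid M] (f : Lab μ → M) :
    ∏ r ∈ Lab.main μ, f (σ r) = ∏ r ∈ Lab.main μ, f r := by
  refine prod_equiv σ (fun r => ?_) fun _ _ => rfl
  rw [Lab.mem_main, Lab.mem_main, side_perm hσ, diag_perm hσ]

theorem sum_main_perm {M : Type*} [AddCommMonoid M] (f : Lab μ → M) :
    ∑ r ∈ Lab.main μ, f (σ r) = ∑ r ∈ Lab.main μ, f r := by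
  refine sum_equiv σ (fun r => ?_) fun _ _ => rfl
  rw [Lab.mem_main, Lab.mem_main, side_perm hσ, diag_perm hσ]

theorem regPart_comp {k : ℕ} (i : Fin k → ℕ) (x e : Lab μ → ℤ) :
    regPart a i (fun r => x (σ r)) (fun r => e (σ r)) = regPart a i x e := by
  have hX : ∀ r, shiftX a (fun r => x (σ r)) r = shiftX a x (σ r) := fun r => by
    simp only [shiftX, off_perm hσ]
  have hJ : ∀ r, shiftJ (fun r => e (σ r)) r = shiftJ e (σ r) := fun r => by
    simp only [shiftJ, off_perm hσ]
  unfold regPart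
  congr 1
  · unfold pairProd
    refine (congr_arg₂ _ ?_ ?_).symm
    · rw [← prod_main_perm hσ]
      refine prod_congr rfl fun r _ => ?_
      simp only [hX, hJ, cont_perm hσ]
    · rw [← prod_main_perm hσ]
      refine prod_congr rfl fun r _ => ?_
      rw [← prod_main_perm hσ]
      refine prod_congr rfl fun r' _ => ?_
      simp only [hX, hJ, cont_perm hσ]
  · refine prod_congr rfl fun j _ => Eq.symm ?_
    unfold descSum
    rw [← sum_main_perm hσ]
    refine sum_congr rfl fun r _ => ?_
    simp only [hX, hJ, cont_perm hσ]

end Relabel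

variable (a) in
/-- The descendent weight, up to the factor of the empty configuration, for a filling `x` and a
rearrangement `σ` of the positions of the labels. -/
def fillWeight {k : ℕ} (i : Fin k → ℕ) (x : Lab μ → ℤ) (σ : Equiv.Perm (Lab μ)) : Coeff₃ :=
  eps a ^ (degF a x - degDen x) * algebraMap ℚ Coeff₃ (numF a x (fun r => posQ (σ r)) 0 1
    / denF x (fun r => posQ (σ r))) * regPart a i x (fun r => posZ μ (σ r))

/-- Rearranging the entries of a filling amounts to rearranging the positions of the labels. -/
theorem fillWeight_comp {k : ℕ} (i : Fin k → ℕ) (x : Lab μ → ℤ) {σ : Equiv.Perm (Lab μ)}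
    (hσ : σ ∈ blockPerms (Lab.block (μ := μ))) :
    fillWeight a i (fun r => x (σ r)) 1 = fillWeight a i x σ.symm := by
  have h1 := numF_comp a x (fun r => posQ (μ := μ) (σ.symm r)) (0 : ℚ) 1 hσ
  have h2 := denF_comp x (fun r => posQ (μ := μ) (σ.symm r)) hσ
  have h3 := regPart_comp (a := a) hσ i x (fun r => posZ μ (σ.symm r))
  simp only [Equiv.symm_apply_apply] at h1 h2 h3
  unfold fillWeight
  rw [degF_comp a x hσ, degDen_comp x hσ, ← h1, ← h2, ← h3]
  rfl

theorem descWeight_eq (P : FixedPair μ) {k : ℕ} (i : Fin k → ℕ) :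
    P.descWeight i = (baseEul μ a)⁻¹ * fillWeight a i (P.filling a) 1 := by
  have h0 : ∀ c ∈ μ.cells, (0 : ℤ) ≤ (fun c => (P.height c : ℤ)) c := fun _ _ => by positivity
  have hn : ∀ c ∈ μ.cells, ∀ c' ∈ μ.cells, c' ≤ c → ((P.height c' : ℤ)) ≤ P.height c :=
    fun c hc c' _ h => by exact_mod_cast P.height_mono h hc
  have hV : -toLaurent P.vertexChar
      = edgeSum μ (fun c => P.height c) (rl a) - edgeSum μ 0 (rl a) := by
    rw [P.vertexChar_eq (a := a) P.charLaurent_mul, neg_sub]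
  have hcoeff : (-toLaurent P.vertexChar).coeff 0 = 0 := by
    rw [hV, AddMonoidAlgebra.coeff_sub, Finsupp.sub_apply, edgeSum_rl_coeff_zero h0 hn,
      edgeSum_rl_coeff_zero (n := 0) (fun _ _ => le_rfl) fun _ _ _ _ _ => le_rfl, sub_zero]
  rw [FixedPair.descWeight, euler_eq_eul hcoeff, hV, eul_sub, eul_edgeSum_eq h0 hn, fillWeight]
  have h1 := (P.valid_filling (a := a)).numF_div_denF
  have h2 : valF a (fill (μ := μ) a fun c => P.height c) posQ 1
      = numF a (P.filling a) posQ 0 1 / denF (P.filling a) posQ := h1.symm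
  rw [h2, prod_congr rfl fun j _ => chern_descChar (a := a) P (2 + i j)]
  unfold regPart baseEul
  simp only [Equiv.Perm.one_apply]
  change _ * algebraMap ℚ Coeff₃ (numF a (P.filling a) posQ 0 1 / denF (P.filling a) posQ)
    * pairProd a (hUnit a) (Lab.main μ) Lab.cont (shiftX a (P.filling a)) (shiftJ (posZ μ)) * _ * _
    = _ * (_ * algebraMap ℚ Coeff₃ (numF a (P.filling a) posQ 0 1 / denF (P.filling a) posQ)
    * (pairProd a (hUnit a) (Lab.main μ) Lab.cont (shiftX a (P.filling a)) (shiftJ (posZ μ))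
      * ∏ j, descSum a (2 + i j) (P.filling a) (posZ μ)))
  rw [FixedPair.filling]
  ring

end Weight

/-! ### The coefficients of the vertex -/

section Coefficients
variable {μ : YoungDiagram} {a : ℕ}

open Classical in
variable (μ a) in
/-- A finite set of fillings, closed under the block permutations, that contains the fillings of
the torus-fixed data of length `N`. -/
def fillings (N : ℕ) : Finset (Lab μ → ℤ) :=
  (Fintype.piFinset fun _ => Icc (-(N : ℤ)) (a * ∑ r : Lab μ, (r.pos : ℤ))).filter fun x =>
    Balanced x ∧ ∑ r ∈ Lab.main μ, x r = (∑ r ∈ Lab.main μ, (a : ℤ) * r.pos) - N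

theorem mem_fillings {N : ℕ} {x : Lab μ → ℤ} : x ∈ fillings μ a N ↔
    (∀ r, x r ∈ Icc (-(N : ℤ)) (a * ∑ r : Lab μ, (r.pos : ℤ))) ∧ Balanced x ∧
      ∑ r ∈ Lab.main μ, x r = (∑ r ∈ Lab.main μ, (a : ℤ) * r.pos) - N := by
  simp only [fillings, mem_filter, Fintype.mem_piFinset]

theorem Balanced.comp {x : Lab μ → ℤ} (h : Balanced x) {σ : Equiv.Perm (Lab μ)}
    (hσ : σ ∈ blockPerms (Lab.block (μ := μ))) : Balanced fun r => x (σ r) := by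
  have key : ∀ b : Bool, (univ.filter fun r : Lab μ => r.side = b ∧ r.diag = 0).val.map
      (fun r => x (σ r)) = (univ.filter fun r : Lab μ => r.side = b ∧ r.diag = 0).val.map x := by
    intro b
    have h1 : (univ.filter fun r : Lab μ => r.side = b ∧ r.diag = 0)
        = (univ.filter fun r : Lab μ => r.side = b ∧ r.diag = 0).map σ.toEmbedding := by
      ext r
      simp only [mem_filter, mem_univ, true_and, mem_map_equiv]
      rw [side_perm (symm_mem_blockPerms hσ), diag_perm (symm_mem_blockPerms hσ)]
    conv_rhs => rw [h1, map_val, Multiset.map_map]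
    rfl
  rw [Balanced, key, key]
  exact h

theorem comp_mem_fillings {N : ℕ} {x : Lab μ → ℤ} (hx : x ∈ fillings μ a N)
    {σ : Equiv.Perm (Lab μ)} (hσ : σ ∈ blockPerms (Lab.block (μ := μ))) :
    (fun r => x (σ r)) ∈ fillings μ a N := by
  obtain ⟨h1, h2, h3⟩ := mem_fillings.1 hx
  exact mem_fillings.2 ⟨fun r => h1 _, h2.comp hσ, (sum_main_perm hσ x).trans h3⟩

/-- Sums over the fillings are invariant under rearrangements. -/
theorem sum_fillings_comp {N : ℕ} {σ : Equiv.Perm (Lab μ)}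
    (hσ : σ ∈ blockPerms (Lab.block (μ := μ))) (f : (Lab μ → ℤ) → Coeff₃) :
    ∑ x ∈ fillings μ a N, f (fun r => x (σ r)) = ∑ x ∈ fillings μ a N, f x := by
  refine sum_bij' (fun x _ r => x (σ r)) (fun x _ r => x (σ.symm r))
    (fun x hx => comp_mem_fillings hx hσ)
    (fun x hx => comp_mem_fillings hx (symm_mem_blockPerms hσ)) ?_ ?_ fun _ _ => rfl
  · intro x _; funext r; simp
  · intro x _; funext r; simp

/-- Averaging over the block permutations. -/
theorem card_mul_sum_fillWeight {k : ℕ} (i : Fin k → ℕ) (N : ℕ) :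
    ((blockPerms (Lab.block (μ := μ))).card : Coeff₃) * ∑ x ∈ fillings μ a N, fillWeight a i x 1
      = ∑ x ∈ fillings μ a N, ∑ σ ∈ blockPerms (Lab.block (μ := μ)), fillWeight a i x σ := by
  rw [← nsmul_eq_mul, ← sum_const]
  refine Eq.trans ?_ sum_comm
  refine (sum_bij' (fun σ _ => σ.symm) (fun σ _ => σ.symm)
    (fun σ hσ => symm_mem_blockPerms hσ) (fun σ hσ => symm_mem_blockPerms hσ)
    (fun _ _ => rfl) (fun _ _ => rfl) fun σ hσ => ?_)
  rw [← sum_fillings_comp hσ]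
  exact sum_congr rfl fun x _ => fillWeight_comp i x hσ

/-- Of more bands of width `a` than labels, one contains no entry of the filling. -/
theorem exists_gap (x : Lab μ → ℤ)
    (hx : ∃ r, x r ≤ -(((a : ℤ) + 1) * ((Fintype.card (Lab μ) : ℤ) + 1))) :
    ∃ P : ℤ, P < -(a : ℤ) ∧ (∀ r, x r ≤ P ∨ P + a < x r) ∧ ∃ r, x r ≤ P := by
  by_contra! hcon
  have hband : ∀ j : Fin (Fintype.card (Lab μ) + 1), ∃ r : Lab μ,
      -(((a : ℤ) + 1) * ((j : ℕ) + 1)) < x r ∧ x r ≤ -(((a : ℤ) + 1) * ((j : ℕ) + 1)) + a := by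
    intro j
    by_contra! hj
    obtain ⟨r, hr⟩ := hx
    have h1 : ((j : ℕ) : ℤ) ≤ Fintype.card (Lab μ) := by exact_mod_cast Nat.lt_succ_iff.1 j.2
    have h2 : (0 : ℤ) ≤ ((a : ℤ) + 1) * (j : ℕ) := by positivity
    have h3 := hcon (-(((a : ℤ) + 1) * ((j : ℕ) + 1))) (by linarith) (fun r => by
      rcases le_or_gt (x r) (-(((a : ℤ) + 1) * ((j : ℕ) + 1))) with h | h
      · exact Or.inl h
      · exact Or.inr (hj r h)) r
    have h4 : ((a : ℤ) + 1) * ((j : ℕ) + 1) ≤ ((a : ℤ) + 1) * ((Fintype.card (Lab μ) : ℤ) + 1) :=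
      mul_le_mul_of_nonneg_left (by linarith) (by positivity)
    linarith
  choose f hf using hband
  have hinj : Function.Injective f := by
    have key : ∀ j j' : Fin (Fintype.card (Lab μ) + 1), j < j' → f j ≠ f j' := by
      intro j j' hlt h
      have h1 := (hf j).1
      have h2 := (hf j').2
      rw [h] at h1
      have h3 : ((j : ℕ) : ℤ) + 1 ≤ (j' : ℕ) := by exact_mod_cast hlt
      have h4 := mul_le_mul_of_nonneg_left h3 (by positivity : (0 : ℤ) ≤ (a : ℤ) + 1)
      linarith
    intro j j' h
    rcases lt_trichotomy j j' with hlt | heq | hlt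
    · exact absurd h (key j j' hlt)
    · exact heq
    · exact absurd h.symm (key j' j hlt)
  have := Fintype.card_le_of_injective f hinj
  simp at this

/-- If some entry of a filling is very negative, then the numerator of the weight vanishes for
suitable parameters, uniformly for all rearrangements of the filling. -/
theorem exists_numF_eq_zero {x : Lab μ → ℤ} (hbal : Balanced x)
    (hx : ∃ r, x r ≤ -(((a : ℤ) + 1) * ((Fintype.card (Lab μ) : ℤ) + 1))) :
    ∃ w t : ℚ, ∀ σ ∈ blockPerms (Lab.block (μ := μ)),
      numF a (fun r => x (σ r)) posQ w t = 0 := by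
  obtain ⟨P, hP, hsplit, r₀, hr₀⟩ := exists_gap x hx
  by_cases hL : ∃ r : Lab μ, r.side = false ∧ x r ≤ P
  · obtain ⟨r₁, h1, hmax⟩ := exists_max_image
      (univ.filter fun r : Lab μ => r.side = false ∧ x r ≤ P) Lab.diag
      (by obtain ⟨r, hr⟩ := hL; exact ⟨r, mem_filter.2 ⟨mem_univ _, hr⟩⟩)
    obtain ⟨h2, h3⟩ := (mem_filter.1 h1).2
    obtain ⟨rs, h4, hpos⟩ := exists_max_image
      (univ.filter fun r : Lab μ => r.side = false ∧ r.diag = r₁.diag) Lab.pos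
      ⟨r₁, mem_filter.2 ⟨mem_univ _, h2, rfl⟩⟩
    obtain ⟨h5, h6⟩ := (mem_filter.1 h4).2
    refine ⟨posQ rs, 0, fun σ hσ => numF_gap_eq_zero hP (fun r => hsplit _) h5 ?_ ?_ ?_⟩
    · intro r hr1 hr2
      exact hpos r (mem_filter.2 ⟨mem_univ _, hr1, hr2.trans h6⟩)
    · refine ⟨σ.symm r₁, ?_, ?_, ?_⟩
      · rw [side_perm (symm_mem_blockPerms hσ), h2]
      · rw [diag_perm (symm_mem_blockPerms hσ), h6]
      · rw [Equiv.apply_symm_apply]; exact h3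
    · intro r hr1 hr2
      have := hmax (σ r) (mem_filter.2 ⟨mem_univ _, by rw [side_perm hσ]; exact hr1, hr2⟩)
      rw [diag_perm hσ] at this
      exact this.trans_eq h6.symm
  · push Not at hL
    refine ⟨0, 0, fun σ hσ => numF_gap_eq_zero_of_forall (P := P) (hbal.comp hσ)
      (fun r => hsplit _) ⟨σ.symm r₀, ?_⟩ (fun r hr => ?_) 0⟩
    · rw [Equiv.apply_symm_apply]; exact hr₀
    · rw [not_le]
      exact hL (σ r) (by rw [side_perm hσ]; exact hr)

variable (μ a) in
/-- A length beyond which the coefficients of the vertex vanish at `ε = 0`. -/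
def lengthBound : ℤ := (∑ r ∈ Lab.main μ, (a : ℤ) * r.pos)
  + (Lab.main μ).card * (((a : ℤ) + 1) * ((Fintype.card (Lab μ) : ℤ) + 1))

theorem exists_entry_le {N : ℕ} (hN : lengthBound μ a < N) {x : Lab μ → ℤ}
    (hx : x ∈ fillings μ a N) :
    ∃ r, x r ≤ -(((a : ℤ) + 1) * ((Fintype.card (Lab μ) : ℤ) + 1)) := by
  by_contra! h
  have h1 := card_nsmul_le_sum (Lab.main μ) x _ fun r _ => (h r).le
  rw [(mem_fillings.1 hx).2.2, nsmul_eq_mul] at h1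
  unfold lengthBound at hN
  linarith

/-- The sum of the weights over all fillings is regular at `ε = 0`, and vanishes there for large
length. -/
theorem sum_fillWeight_mem (ha : 0 < a) {k : ℕ} (i : Fin k → ℕ) (N : ℕ) :
    ∃ u ∈ evalRing a, ∑ x ∈ fillings μ a N, fillWeight a i x 1
      = eps a ^ (if lengthBound μ a < N then 1 else 0) * u := by
  set κ := if lengthBound μ a < N then 1 else 0 with hκ
  have hκ1 : κ ≤ 1 := by rw [hκ]; split_ifs <;> simp
  have h : ∀ x ∈ fillings μ a N, ∃ u ∈ evalRing a,
      ∑ σ ∈ blockPerms (Lab.block (μ := μ)), fillWeight a i x σ = eps a ^ κ * u := by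
    intro x hx
    refine orbit_sum_mem x (isEpsPoly_regPart ha i x) κ hκ1 fun h1 => ?_
    have hN : lengthBound μ a < N := by
      by_contra h2
      rw [hκ, if_neg h2] at h1
      exact zero_ne_one h1
    exact exists_numF_eq_zero (mem_fillings.1 hx).2.1 (exists_entry_le hN hx)
  choose! u hu hsum using h
  have hcard : ((blockPerms (Lab.block (μ := μ))).card : Coeff₃) ≠ 0 := by
    have : (1 : Equiv.Perm (Lab μ)) ∈ blockPerms (Lab.block (μ := μ)) :=
      mem_blockPerms.2 fun _ => rfl
    exact_mod_cast (card_pos.2 ⟨1, this⟩).ne'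
  refine ⟨algebraMap ℚ Coeff₃ ((blockPerms (Lab.block (μ := μ))).card)⁻¹
    * ∑ x ∈ fillings μ a N, u x, mul_mem (algebraMap_rat_mem_evalRing _)
      (sum_mem fun x hx => hu x hx), ?_⟩
  have h1 := card_mul_sum_fillWeight (μ := μ) (a := a) i N
  rw [sum_congr rfl hsum, ← mul_sum] at h1
  rw [map_inv₀, map_natCast, ← mul_right_inj' hcard, h1]
  field_simp

/-- The sum over the torus-fixed data of length `N` is a sum over a set of fillings: the fillings
that do not come from torus-fixed data have weight zero. -/
theorem sum_descWeight_eq {k : ℕ} (i : Fin k → ℕ) (N : ℕ) :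
    ∑ P ∈ (FixedPair.finite_length μ N).toFinset, P.descWeight i
      = (baseEul μ a)⁻¹ * ∑ x ∈ fillings μ a N, fillWeight a i x 1 := by
  classical
  rw [mul_sum, sum_congr rfl fun P _ => descWeight_eq (a := a) P i,
    ← sum_image (g := FixedPair.filling a)
      (f := fun x => (baseEul μ a)⁻¹ * fillWeight a i x 1)
      fun P _ P' _ h => FixedPair.filling_injective h]
  refine sum_subset ?_ ?_
  · intro x hx
    obtain ⟨P, hP, rfl⟩ := mem_image.1 hx
    have hP : P.length = N := by simpa using hP
    exact mem_fillings.2 ⟨fun r => hP ▸ P.filling_mem r, P.valid_filling.balanced,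
      hP ▸ P.sum_filling⟩
  · intro x hx hx'
    obtain ⟨-, hbal, hsum⟩ := mem_fillings.1 hx
    by_cases h : numF a x posQ (0 : ℚ) 1 = 0
    · have h1 : fillWeight a i x 1 = eps a ^ (degF a x - degDen x)
        * algebraMap ℚ Coeff₃ (numF a x posQ 0 1 / denF x posQ) * regPart a i x (posZ μ) := rfl
      rw [h1, h, zero_div, map_zero, mul_zero, zero_mul, mul_zero]
    · obtain ⟨P, rfl⟩ := (valid_of_numF_ne_zero hbal h).exists_filling_eq
      refine absurd (mem_image_of_mem _ ?_) hx'
      rw [P.sum_filling] at hsum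
      simp only [Set.Finite.mem_toFinset, Set.mem_ofPred_eq]
      omega

theorem vertex_coeff {k : ℕ} (i : Fin k → ℕ) (n : ℤ) : (vertex μ i).coeff n
    = (1 / (s 0 * s 1)) ^ k * ∑ᶠ (P : FixedPair μ) (_ : (P.length : ℤ) + μ.card = n),
      P.descWeight i := rfl

theorem vertex_coeff_of_lt {k : ℕ} (i : Fin k → ℕ) {n : ℤ} (hn : n < μ.card) :
    (vertex μ i).coeff n = 0 := by
  rw [vertex_coeff]
  have h : ∀ P : FixedPair μ, ¬ ((P.length : ℤ) + μ.card = n) := fun P h => by omega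
  simp [h]

theorem vertex_coeff_add {k : ℕ} (i : Fin k → ℕ) (N : ℕ) :
    (vertex μ i).coeff (N + μ.card) = (1 / (s 0 * s 1)) ^ k
      * ((baseEul μ a)⁻¹ * ∑ x ∈ fillings μ a N, fillWeight a i x 1) := by
  rw [vertex_coeff, ← sum_descWeight_eq, ← finsum_mem_eq_finite_toFinset_sum]
  congr 1
  refine finsum_congr fun P => ?_
  have h : ((P.length : ℤ) + μ.card = N + μ.card) = (P ∈ {P : FixedPair μ | P.length = N}) := by
    simp
  rw [h]

theorem inv_s_mul_s_mem : 1 / (s 0 * s 1) ∈ evalRing a := by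
  have h0 : evalPoly a (MvPolynomial.X 0) ≠ 0 := by
    simp only [evalPoly, MvPolynomial.aeval_X, Matrix.cons_val_zero]
    rw [Ne, map_eq_zero_iff _ (IsFractionRing.injective (MvPolynomial (Fin 2) ℚ) Coeff₂)]
    exact MvPolynomial.X_ne_zero _
  have h1 : evalPoly a (MvPolynomial.X 1) ≠ 0 := by
    simp only [evalPoly, MvPolynomial.aeval_X, Matrix.cons_val_one, Matrix.cons_val_zero]
    rw [Ne, map_eq_zero_iff _ (IsFractionRing.injective (MvPolynomial (Fin 2) ℚ) Coeff₂)]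
    exact MvPolynomial.X_ne_zero _
  rw [one_div, mul_inv]
  exact mul_mem ⟨_, EvaluatesTo.inv_poly h0⟩ ⟨_, EvaluatesTo.inv_poly h1⟩

/-- The coefficients of the vertex can be evaluated at `ε = 0`, and only finitely many of the values
are nonzero. -/
theorem exists_evaluatesTo_vertex_coeff (ha : 0 < a) {k : ℕ} (i : Fin k → ℕ) (n : ℤ) :
    ∃ y, EvaluatesTo a ((vertex μ i).coeff n) y
      ∧ (n ∉ Icc (μ.card : ℤ) (lengthBound μ a + μ.card) → y = 0) := by
  have hzero : EvaluatesTo a (0 : Coeff₃) 0 := by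
    simpa using EvaluatesTo.of_poly (a := a) 0
  rcases lt_or_ge n μ.card with hn | hn
  · exact ⟨0, by rw [vertex_coeff_of_lt i hn]; exact hzero, fun _ => rfl⟩
  · obtain ⟨N, hN⟩ := Int.eq_ofNat_of_zero_le (sub_nonneg.2 hn)
    obtain rfl : n = N + μ.card := by omega
    obtain ⟨u, hu, hsum⟩ := sum_fillWeight_mem (μ := μ) ha i N
    have hv : (1 / (s 0 * s 1)) ^ k * (baseEul μ a)⁻¹ * u ∈ evalRing a :=
      mul_mem (mul_mem (pow_mem inv_s_mul_s_mem k) (inv_baseEul_mem ha)) hu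
    obtain ⟨y, hy⟩ := hv
    rw [vertex_coeff_add (a := a), hsum]
    by_cases hb : lengthBound μ a < N
    · refine ⟨0, ?_, fun _ => rfl⟩
      have h := (evaluatesTo_eps ha).mul hy
      rw [zero_mul] at h
      rw [if_pos hb, pow_one]
      convert h using 1
      ring
    · refine ⟨y, ?_, fun h => absurd (mem_Icc.2 ⟨hn, by omega⟩) h⟩
      rw [if_neg hb, pow_zero, one_mul, ← mul_assoc]
      exact hy

end Coefficients

end OneLeg

end

theorem theorem4p1 (μ : YoungDiagram) (k : ℕ) (i : Fin k → ℕ) (a : ℕ) (ha : 0 < a) :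
    ∃ L : LaurentPolynomial OneLeg.Coeff₂,
      ∀ n : ℤ, OneLeg.EvaluatesTo a ((OneLeg.vertex μ i).coeff n) (L.coeff n) := by
  choose y hy hy0 using fun n => OneLeg.exists_evaluatesTo_vertex_coeff (μ := μ) ha i n
  refine ⟨∑ n ∈ Finset.Icc (μ.card : ℤ) (OneLeg.lengthBound μ a + μ.card),
    AddMonoidAlgebra.single n (y n), fun n => ?_⟩
  have h : (∑ m ∈ Finset.Icc (μ.card : ℤ) (OneLeg.lengthBound μ a + μ.card),
      (AddMonoidAlgebra.single m (y m) : LaurentPolynomial OneLeg.Coeff₂)).coeff n = y n := by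
    rw [AddMonoidAlgebra.coeff_sum, Finsupp.finsetSum_apply]
    simp only [AddMonoidAlgebra.coeff_single, Finsupp.single_apply]
    rw [Finset.sum_ite_eq']
    split_ifs with hn
    · rfl
    · exact (hy0 n hn).symm
  rw [h]
  exact hy n
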